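/- **Setting.** Let $(\Omega,\Sigma,\mu)$ be a non-atomic measure space: every $A\in\Sigma$ with $\mu(A)>0$ contains some $B\in\Sigma$ with $0<\mu(B)<\mu(A)$. Let $\mathcal F$ be a finite, nonempty collection of sets in $\Sigma$ (repetitions allowed) with $0<\mu(Q)<\infty$ for all $Q\in\mathcal F$. Suppose that $\mathcal F$ satisfies the $\Lambda$-Carleson condition for some real $\Lambda\ge 1$, i.e. $\sum_{Q\in\mathcal A}\mu(Q)\le\Lambda\,\mu\big(\bigcup_{Q\in\mathcal A}Q\big)$ for all $\mathcal A\subseteq\mathcal F$. For $\mathcal A\subseteq\mathcal F$ put $E_{\mathcal A}:=\bigcap_{Q\in\mathcal A}Q\cap\bigcap_{Q\in\mathcal F\setminus\mathcal A}Q^{\mathrm c}$ and let $\mathcal P_0$ be the set of nonempty $\mathcal A\subseteq\mathcal F$ with $E_{\mathcal A}\ne\emptyset$. Put $n=|\mathcal F|$, counted with repetitions, and $m=|\mathcal P_0|$. Let $G$ be the directed graph with the distinct vertices $s$, $t$, $v_Q$ ($Q\in\mathcal F$), $v_{\mathcal A}$ ($\mathcal A\in\mathcal P_0$) and the edges $(s,v_{\mathcal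 A})$ of capacity $\mu(E_{\mathcal A})$, $(v_{\mathcal A},v_Q)$ for $Q\in\mathcal A$ of capacity $\infty$, and $(v_Q,t)$ of capacity $\Lambda^{-1}\mu(Q)$. A flow assigns to each edge a number in $[0,\infty)$ that is at most its capacity, with inflow equal to outflow at every vertex other than $s,t$; it is a maximum flow if the total $\sum_{\mathcal A}f(s,v_{\mathcal A})$ is largest possible. **Algorithm.** Construct $G$, compute a maximum flow $f$ from $s$ to $t$, and set $E_Q=\emptyset$ for all $Q\in\mathcal F$. For each $\mathcal A\in\mathcal P_0$: set $F=E_{\mathcal A}$, and for each $Q\in\mathcal A$ take a measurable $F_Q\subseteq F$ with $\mu(F_Q)=f(v_{\mathcal A},v_Q)$, update $E_Q\leftarrow E_Q\cup F_Q$ and $F\leftarrow F\setminus F_Q$. The output is $\{E_Q\}_{Q\in\mathcal F}$. **Oracles.** $(\mathrm O_1)$ returns $\mu\big(\bigcup_{Q\in\mathcal A}Q\big)$ for a given $\mathcal A\subseteq\mathcal F$; $(\mathrm O_2)$ returns, for given $E\in\Sigma$ and $a\in[0,1]$, a measurable $E_a\subseteq E$ with $\mu(E_a)=a\,\mu(E)$.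 A call takes time $\mathrm{EO}_1$, respectively $\mathrm{EO}_2$. **Theorem.** 1. A maximum flow exists. For every maximum flow, every order of the loops and every choice of the pieces, a required piece $F_Q$ exists whenever one has to be taken, and the output consists of pairwise disjoint measurable sets $E_Q\subseteq Q$ with $\mu(E_Q)\ge\frac1\Lambda\mu(Q)$ for all $Q\in\mathcal F$. In particular $\mathcal F$ is $\frac1\Lambda$-sparse, i.e. sets $E_Q$ with these properties exist. 2. The algorithm can be implemented with runtime $$O\big(m\cdot\mathrm{EO}_1+nm\cdot\mathrm{EO}_2+n^2m+nm^2\big).$$ That is, there are one program and one absolute constant in $O(\cdot)$ such that the following holds for all data as above and all oracles that answer correctly. The program, given $n$, $m$, $\Lambda$, the sets in $\mathcal F$ and, as indicator vectors in any order, the elements of $\mathcal P_0$, halts within this time with an output of the algorithm for some maximum flow. The program runs on a random access machine with (two-dimensional arrays of) cells for natural numbers, real numbers and subsets of $\Omega$. Unit cost is charged for each memory access, each addition, truncated subtraction and comparison of natural numbers, each exact arithmetic operation and comparison of real numbers, each union, intersection and difference of sets, and each control step. Measures of sets are available only through $(\mathrm O_1)$. -/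

import Mathlib

open MeasureTheory
open scoped NNReal ENNReal

noncomputable section

namespace CarlesonSparse

/-! ## Carleson and sparse collections

A finite collection of sets, repetitions allowed, is a family `F : ι → Set Ω` over a finite type. -/

section Collections

variable {Ω ι : Type*} [MeasurableSpace Ω]

/-- A measure is non-atomic if every measurable set of positive measure has a measurable subset of
positive and strictly smaller measure.  (Mathlib's `NoAtoms` only says that points are null.) -/
def NonAtomic (μ : Measure Ω) : Prop :=
  ∀ A : Set Ω, MeasurableSet A → 0 < μ A → ∃ B ⊆ A, MeasurableSet B ∧ 0 < μ B ∧ μ B < μ A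

/-- The `Λ`-Carleson condition. -/
def IsCarleson (μ : Measure Ω) (F : ι → Set Ω) (Λ : ℝ) : Prop :=
  1 ≤ Λ ∧ ∀ A : Finset ι, ∑ Q ∈ A, μ (F Q) ≤ ENNReal.ofReal Λ * μ (⋃ Q ∈ A, F Q)

/-- The sets `E Q` witness that the collection `F` is `η`-sparse. -/
structure IsSparseWitness (μ : Measure Ω) (F : ι → Set Ω) (η : ℝ) (E : ι → Set Ω) : Prop where
  measurableSet : ∀ Q, MeasurableSet (E Q)
  subset : ∀ Q, E Q ⊆ F Q
  le_measure : ∀ Q, ENNReal.ofReal η * μ (F Q) ≤ μ (E Q)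
  disjoint : Pairwise fun Q R => Disjoint (E Q) (E R)

/-- `η`-sparse collections. -/
def IsSparse (μ : Measure Ω) (F : ι → Set Ω) (η : ℝ) : Prop :=
  0 < η ∧ η ≤ 1 ∧ ∃ E : ι → Set Ω, IsSparseWitness μ F η E

/-- The set `E_A` of the points that lie in `F Q` exactly for the `Q ∈ A`. -/
def atom (F : ι → Set Ω) (A : Finset ι) : Set Ω :=
  (⋂ Q ∈ A, F Q) ∩ ⋂ Q ∉ A, (F Q)ᶜ

open Classical in
/-- `P₀(F)`: the subcollections `A` with `E_A ≠ ∅`, where the ambient space is taken to be the union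
of the collection, so that `A = ∅` does not occur. -/
def P0 [Fintype ι] (F : ι → Set Ω) : Finset (Finset ι) :=
  Finset.univ.filter fun A => A.Nonempty ∧ (atom F A).Nonempty

end Collections

/-! ## Flows in networks -/

/-- A directed graph with capacities, a source and a sink.  Only the capacities of edges matter. -/
structure Network (V : Type*) where
  Edge : V → V → Prop
  cap : V → V → ℝ≥0∞
  source : V
  sink : V

section Flows

variable {V : Type*} [Fintype V]

open Classical in
/-- A flow: non-negative numbers on the edges (the values at other pairs are never used) that obey
the capacities and are conserved at every vertex other than the source and the sink. -/
structure Network.IsFlow (N : Network V) (f : V → V → ℝ≥0) : Prop where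
  conservation : ∀ v, v ≠ N.source → v ≠ N.sink →
    ∑ u with N.Edge u v, f u v = ∑ w with N.Edge v w, f v w
  capacity : ∀ u v, N.Edge u v → (f u v : ℝ≥0∞) ≤ N.cap u v

open Classical in
/-- The value of a flow: the amount that leaves the source.  (No edge of the networks below enters
the source.) -/
def Network.value (N : Network V) (f : V → V → ℝ≥0) : ℝ≥0 :=
  ∑ v with N.Edge N.source v, f N.source v

/-- Maximum flows. -/
def Network.IsMaxFlow (N : Network V) (f : V → V → ℝ≥0) : Prop :=
  N.IsFlow f ∧ ∀ g, N.IsFlow g → N.value g ≤ N.value f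

end Flows

/-! ## The network of a collection -/

section Graph

variable {Ω ι : Type*} [Fintype ι]

/-- The vertices `s`, `t`, `v_A` for `A ∈ P₀(F)`, and `v_Q` for `Q ∈ F`. -/
inductive Vertex (F : ι → Set Ω) : Type _
  | source : Vertex F
  | sink : Vertex F
  | coll : {A // A ∈ P0 F} → Vertex F
  | elt : ι → Vertex F

instance (F : ι → Set Ω) : Fintype (Vertex F) :=
  Fintype.ofEquiv (Unit ⊕ Unit ⊕ {A // A ∈ P0 F} ⊕ ι)
    { toFun := fun x => match x with
        | Sum.inl _ => Vertex.source
        | Sum.inr (Sum.inl _) => Vertex.sink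
        | Sum.inr (Sum.inr (Sum.inl A)) => Vertex.coll A
        | Sum.inr (Sum.inr (Sum.inr Q)) => Vertex.elt Q
      invFun := fun v => match v with
        | Vertex.source => Sum.inl ()
        | Vertex.sink => Sum.inr (Sum.inl ())
        | Vertex.coll A => Sum.inr (Sum.inr (Sum.inl A))
        | Vertex.elt Q => Sum.inr (Sum.inr (Sum.inr Q))
      left_inv := by rintro (_ | _ | _ | _) <;> rfl
      right_inv := by rintro (_ | _ | _ | _) <;> rfl }

/-- The edges `(s, v_A)`, `(v_A, v_Q)` for `Q ∈ A`, and `(v_Q, t)`. -/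
inductive Vertex.Edge (F : ι → Set Ω) : Vertex F → Vertex F → Prop
  | sourceColl (A : {A // A ∈ P0 F}) : Vertex.Edge F .source (.coll A)
  | collElt (A : {A // A ∈ P0 F}) (Q : ι) (h : Q ∈ A.1) : Vertex.Edge F (.coll A) (.elt Q)
  | eltSink (Q : ι) : Vertex.Edge F (.elt Q) .sink

/-- The capacities `μ(E_A)`, `∞` and `Λ⁻¹ μ(Q)` of the three kinds of edges. -/
def edgeCap [MeasurableSpace Ω] (μ : Measure Ω) (F : ι → Set Ω) (Λ : ℝ) :
    Vertex F → Vertex F → ℝ≥0∞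
  | .source, .coll A => μ (atom F A.1)
  | .coll _, .elt _ => ∞
  | .elt Q, .sink => ENNReal.ofReal Λ⁻¹ * μ (F Q)
  | _, _ => 0

/-- The weighted directed graph based on the collection `F` and the constant `Λ`. -/
def network [MeasurableSpace Ω] (μ : Measure Ω) (F : ι → Set Ω) (Λ : ℝ) : Network (Vertex F) where
  Edge := Vertex.Edge F
  cap := edgeCap μ F Λ
  source := .source
  sink := .sink

end Graph

/-! ## The cutting loops

The two nested loops that cut the sets `E_A` into pieces, as a transition system: the order in which
the loops run and the pieces that are taken are left open. -/

section Cutting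

variable {Ω ι : Type*} [Fintype ι]

/-- A state of the loops. -/
structure CutState (F : ι → Set Ω) where
  /-- the `A ∈ P₀(F)` for which the outer loop has still to be run -/
  atoms : List {A // A ∈ P0 F}
  /-- the pairs `(A, Q)`, with the current `A`, for which the inner loop has still to be run -/
  queue : List ({A // A ∈ P0 F} × ι)
  /-- the current value of the variable `F` of the algorithm, the uncut part of `E_A` -/
  rest : Set Ω
  /-- the current values of the `E_Q` -/
  E : ι → Set Ω

open Classical in
/-- One transition: begin with the next `A`, or take a piece of measure `f(v_A, v_Q)` off the
uncut part of `E_A` and put it into `E_Q`. -/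
inductive CutStep [MeasurableSpace Ω] (μ : Measure Ω) (F : ι → Set Ω)
    (f : Vertex F → Vertex F → ℝ≥0) : CutState F → CutState F → Prop
  | next (A : {A // A ∈ P0 F}) (As : List {A // A ∈ P0 F}) (R : Set Ω) (E : ι → Set Ω)
      (Qs : List ι) (hnodup : Qs.Nodup) (hmem : ∀ Q, Q ∈ Qs ↔ Q ∈ A.1) :
      CutStep μ F f ⟨A :: As, [], R, E⟩ ⟨As, Qs.map fun Q => (A, Q), atom F A.1, E⟩
  | take (A : {A // A ∈ P0 F}) (Q : ι) (As : List {A // A ∈ P0 F})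
      (q : List ({A // A ∈ P0 F} × ι)) (R : Set Ω) (E : ι → Set Ω)
      (G : Set Ω) (hG : MeasurableSet G) (hsub : G ⊆ R) (hμ : μ G = f (.coll A) (.elt Q)) :
      CutStep μ F f ⟨As, (A, Q) :: q, R, E⟩ ⟨As, q, R \ G, Function.update E Q (E Q ∪ G)⟩

/-- An initial state: the outer loop runs once through `P₀(F)`, in some order, and all `E_Q` are
empty. -/
def CutState.IsInitial {F : ι → Set Ω} (st : CutState F) : Prop :=
  st.atoms.Nodup ∧ (∀ A, A ∈ st.atoms) ∧ st.queue = [] ∧ st.E = fun _ => ∅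

/-- Both loops are finished. -/
def CutState.IsFinal {F : ι → Set Ω} (st : CutState F) : Prop :=
  st.atoms = [] ∧ st.queue = []

/-- The states that occur in some run of the loops. -/
def CutReachable [MeasurableSpace Ω] (μ : Measure Ω) (F : ι → Set Ω)
    (f : Vertex F → Vertex F → ℝ≥0) (st : CutState F) : Prop :=
  ∃ st₀ : CutState F, st₀.IsInitial ∧ Relation.ReflTransGen (CutStep μ F f) st₀ st

/-- `E` is a possible output of the loops for the flow `f`. -/
def IsCutOutput [MeasurableSpace Ω] (μ : Measure Ω) (F : ι → Set Ω)
    (f : Vertex F → Vertex F → ℝ≥0) (E : ι → Set Ω) : Prop :=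
  ∃ st : CutState F, CutReachable μ F f st ∧ st.IsFinal ∧ st.E = E

end Cutting

/-! ## The machine

A random access machine with cells for natural numbers, for real numbers and for subsets of `Ω`.
The cells of each kind form arrays: cell `(i, j)` of the array `a`, where `a` is fixed in the
program and `i`, `j` are computed.  Arithmetic operations (exact, on real numbers as well),
comparisons, set operations and memory accesses take one unit of time each.  Sets can only be
combined and handed to an oracle; a real number cannot be turned into a natural number. -/

/-- Memory contents. -/
structure Store (Ω : Type*) where
  nat : ℕ → ℕ → ℕ → ℕ
  real : ℕ → ℕ → ℕ → ℝ
  set : ℕ → ℕ → ℕ → Set Ω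

/-- Overwrite one cell. -/
def write {α : Type*} (M : ℕ → ℕ → ℕ → α) (a i j : ℕ) (x : α) : ℕ → ℕ → ℕ → α :=
  fun a' i' j' => if a' = a ∧ i' = i ∧ j' = j then x else M a' i' j'

/-- Expressions for natural numbers; `sub` is truncated subtraction. -/
inductive NExp : Type
  | lit (k : ℕ)
  | get (a : ℕ) (i j : NExp)
  | add (x y : NExp)
  | sub (x y : NExp)

/-- Expressions for real numbers; dividing by zero gives zero. -/
inductive RExp : Type
  | lit (k : ℕ)
  | get (a : ℕ) (i j : NExp)
  | add (x y : RExp)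
  | sub (x y : RExp)
  | mul (x y : RExp)
  | div (x y : RExp)

/-- Expressions for sets. -/
inductive SExp : Type
  | empty
  | get (a : ℕ) (i j : NExp)
  | union (x y : SExp)
  | inter (x y : SExp)
  | diff (x y : SExp)

/-- Tests. -/
inductive BExp : Type
  | natLe (x y : NExp)
  | realLe (x y : RExp)
  | not (b : BExp)
  | and (b c : BExp)

/-- Programs. -/
inductive Prog : Type
  | skip
  | setNat (a : ℕ) (i j : NExp) (x : NExp)
  | setReal (a : ℕ) (i j : NExp) (x : RExp)
  | setSet (a : ℕ) (i j : NExp) (x : SExp)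
  /-- Query the first oracle about the subcollection whose indicator vector is the row `r` of the
  array `q` of natural numbers; the answer goes to a real cell. -/
  | callUnion (a : ℕ) (i j : NExp) (q : ℕ) (r : NExp)
  /-- Query the second oracle about a set and a fraction; the answer goes to a set cell. -/
  | callSplit (a : ℕ) (i j : NExp) (E : SExp) (x : RExp)
  | seq (p q : Prog)
  | ite (b : BExp) (p q : Prog)
  | while (b : BExp) (p : Prog)

section Semantics

variable {Ω : Type*}

def NExp.eval (s : Store Ω) : NExp → ℕ
  | .lit k => k
  | .get a i j => s.nat a (i.eval s) (j.eval s)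
  | .add x y => x.eval s + y.eval s
  | .sub x y => x.eval s - y.eval s

def RExp.eval (s : Store Ω) : RExp → ℝ
  | .lit k => k
  | .get a i j => s.real a (i.eval s) (j.eval s)
  | .add x y => x.eval s + y.eval s
  | .sub x y => x.eval s - y.eval s
  | .mul x y => x.eval s * y.eval s
  | .div x y => x.eval s / y.eval s

def SExp.eval (s : Store Ω) : SExp → Set Ω
  | .empty => ∅
  | .get a i j => s.set a (i.eval s) (j.eval s)
  | .union x y => x.eval s ∪ y.eval s
  | .inter x y => x.eval s ∩ y.eval s
  | .diff x y => x.eval s \ y.eval s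

def BExp.eval (s : Store Ω) : BExp → Prop
  | .natLe x y => x.eval s ≤ y.eval s
  | .realLe x y => x.eval s ≤ y.eval s
  | .not b => ¬ b.eval s
  | .and b c => b.eval s ∧ c.eval s

/-- The time for evaluating an expression: the number of its operations. -/
def NExp.time : NExp → ℕ
  | .lit _ => 1
  | .get _ i j => i.time + j.time + 1
  | .add x y => x.time + y.time + 1
  | .sub x y => x.time + y.time + 1

def RExp.time : RExp → ℕ
  | .lit _ => 1
  | .get _ i j => i.time + j.time + 1
  | .add x y => x.time + y.time + 1
  | .sub x y => x.time + y.time + 1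
  | .mul x y => x.time + y.time + 1
  | .div x y => x.time + y.time + 1

def SExp.time : SExp → ℕ
  | .empty => 1
  | .get _ i j => i.time + j.time + 1
  | .union x y => x.time + y.time + 1
  | .inter x y => x.time + y.time + 1
  | .diff x y => x.time + y.time + 1

def BExp.time : BExp → ℕ
  | .natLe x y => x.time + y.time + 1
  | .realLe x y => x.time + y.time + 1
  | .not b => b.time + 1
  | .and b c => b.time + c.time + 1

/-- The two oracles of the machine, for a collection of `n` sets, with the time of a call. -/
structure Oracles (Ω : Type*) (n : ℕ) where
  union : Finset (Fin n) → ℝ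
  split : Set Ω → ℝ → Set Ω
  EO₁ : ℕ
  EO₂ : ℕ

/-- The subcollection with the indicator vector `v`. -/
def ofIndicator (n : ℕ) (v : ℕ → ℕ) : Finset (Fin n) :=
  Finset.univ.filter fun Q => v Q ≠ 0

/-- `Exec O p s s' T`: the program `p`, started with the memory contents `s`, halts after time `T`
with the memory contents `s'`. -/
inductive Exec {n : ℕ} (O : Oracles Ω n) : Prog → Store Ω → Store Ω → ℕ → Prop
  | skip (s : Store Ω) : Exec O .skip s s 1
  | setNat (s : Store Ω) (a : ℕ) (i j x : NExp) :
      Exec O (.setNat a i j x) s { s with nat := write s.nat a (i.eval s) (j.eval s) (x.eval s) }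
        (i.time + j.time + x.time + 1)
  | setReal (s : Store Ω) (a : ℕ) (i j : NExp) (x : RExp) :
      Exec O (.setReal a i j x) s { s with real := write s.real a (i.eval s) (j.eval s) (x.eval s) }
        (i.time + j.time + x.time + 1)
  | setSet (s : Store Ω) (a : ℕ) (i j : NExp) (x : SExp) :
      Exec O (.setSet a i j x) s { s with set := write s.set a (i.eval s) (j.eval s) (x.eval s) }
        (i.time + j.time + x.time + 1)
  | callUnion (s : Store Ω) (a : ℕ) (i j : NExp) (q : ℕ) (r : NExp) :
      Exec O (.callUnion a i j q r) s
        { s with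
          real := write s.real a (i.eval s) (j.eval s)
            (O.union (ofIndicator n (s.nat q (r.eval s)))) }
        (i.time + j.time + r.time + 1 + O.EO₁)
  | callSplit (s : Store Ω) (a : ℕ) (i j : NExp) (E : SExp) (x : RExp) :
      Exec O (.callSplit a i j E x) s
        { s with set := write s.set a (i.eval s) (j.eval s) (O.split (E.eval s) (x.eval s)) }
        (i.time + j.time + E.time + x.time + 1 + O.EO₂)
  | seq {p q : Prog} {s s' s'' : Store Ω} {T T' : ℕ} (hp : Exec O p s s' T)
      (hq : Exec O q s' s'' T') : Exec O (.seq p q) s s'' (T + T')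
  | iteTrue {b : BExp} {p q : Prog} {s s' : Store Ω} {T : ℕ} (hb : b.eval s)
      (hp : Exec O p s s' T) : Exec O (.ite b p q) s s' (b.time + 1 + T)
  | iteFalse {b : BExp} {p q : Prog} {s s' : Store Ω} {T : ℕ} (hb : ¬ b.eval s)
      (hq : Exec O q s s' T) : Exec O (.ite b p q) s s' (b.time + 1 + T)
  | whileTrue {b : BExp} {p : Prog} {s s' s'' : Store Ω} {T T' : ℕ} (hb : b.eval s)
      (hp : Exec O p s s' T) (hw : Exec O (.while b p) s' s'' T') :
      Exec O (.while b p) s s'' (b.time + 1 + T + T')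
  | whileFalse {b : BExp} {p : Prog} {s : Store Ω} (hb : ¬ b.eval s) :
      Exec O (.while b p) s s (b.time + 1)

/-- The oracles give correct answers: `union A` is `μ(⋃_{Q ∈ A} Q)`, and `split E a`, for a
measurable set `E` and `a ∈ [0, 1]`, is a measurable subset of `E` of measure `a μ(E)`. -/
structure Oracles.Correct [MeasurableSpace Ω] {n : ℕ} (O : Oracles Ω n) (μ : Measure Ω)
    (F : Fin n → Set Ω) : Prop where
  union : ∀ A, O.union A = (μ (⋃ Q ∈ A, F Q)).toReal
  split : ∀ (E : Set Ω) (a : ℝ), MeasurableSet E → 0 ≤ a → a ≤ 1 →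
    MeasurableSet (O.split E a) ∧ O.split E a ⊆ E ∧ μ (O.split E a) = ENNReal.ofReal a * μ E

open Classical in
/-- The memory at the start: `n` and `m` in the cells `(0, 0)` and `(0, 1)` of array 0 of natural
numbers, the indicator vectors of the given subcollections in the rows of array 1 of natural numbers,
`Λ` in the cell `(0, 0)` of real array 0, the sets of the collection in row 0 of set array 0.
Everything else is zero or empty. -/
def input {n m : ℕ} (F : Fin n → Set Ω) (Λ : ℝ) (P : Fin m → Finset (Fin n)) : Store Ω where
  nat a i j :=
    if a = 0 ∧ i = 0 ∧ j = 0 then n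
    else if a = 0 ∧ i = 0 ∧ j = 1 then m
    else if a = 1 ∧ ∃ (k : Fin m) (Q : Fin n), i = k ∧ j = Q ∧ Q ∈ P k then 1
    else 0
  real a i j := if a = 0 ∧ i = 0 ∧ j = 0 then Λ else 0
  set a i j := if h : a = 0 ∧ i = 0 ∧ j < n then F ⟨j, h.2.2⟩ else ∅

/-- The output: row 0 of set array 1. -/
def output {n : ℕ} (s : Store Ω) : Fin n → Set Ω :=
  fun Q => s.set 1 0 Q

end Semantics

end CarlesonSparse

end

/-! The Carleson condition is Hall's condition for a transport problem. The atom `E_A` supplies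
`μ(E_A)`, the set `Q` demands `Λ⁻¹ μ(Q)`, and `E_A` may serve `Q` when `Q ∈ A`. Since the atoms that
meet `S ⊆ F` fill `⋃ Q ∈ S, Q`, the demand of `S` never exceeds the supply it can reach. Hence some
flow saturates all edges into the sink; it is maximal, and comparing values shows that every maximum
flow saturates them too (`IsSaturating.of_isMaxFlow`). Non-atomicity turns a flow into sets: a
measure takes all intermediate values on subsets (`NonAtomic.exists_subset_measure_eq`), and
conservation at `v_A` keeps enough of `E_A` uncut for the pieces still due. This is the invariant
`CutInv`. The pieces put into `E_Q` come from distinct atoms and have total measure `f(v_Q, t) = Λ⁻¹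
μ(Q)`. The saturating flow is obtained from the termination of a push-relabel method, so one
argument gives both existence and the runtime. Excess starts at the sets and moves to the atoms,
whose supplies are negative excesses. A gap argument based on Hall's condition
(`FlowInv.exists_label_eq`) shows that the labels below that of an active vertex are all in use; as
labels alternate in parity between the two sides, they are `O(min n m)` (`FlowInv.label_le`). A
potential of size `O((n + m)² min n m) = O(n²m + nm²)` drops at each step
(`PassInv.potential_step_lt`). The program gets the measures of the atoms from `m + 1` calls of the
first oracle: the measure of the points lying in no set outside `A` is the sum of the atoms of all
`B ⊆ A`, a triangular system that is solved by rank (`Enumerates.mass_eq`). A simulation relation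
`Sim` transfers the analysis of the method to the machine. -/

noncomputable section

namespace CarlesonSparse

/-! ## Non-atomic measures take all intermediate values -/

section Sierpinski

variable {Ω : Type*} [MeasurableSpace Ω] {μ : Measure Ω}

/-- Of the two parts into which non-atomicity splits `A`, the smaller one serves. -/
theorem NonAtomic.exists_subset_measure_le_half (hμ : NonAtomic μ) {A : Set Ω}
    (hA : MeasurableSet A) (h0 : 0 < μ A) :
    ∃ B ⊆ A, MeasurableSet B ∧ 0 < μ B ∧ μ B ≤ μ A / 2 := by
  obtain ⟨B, hBA, hB, hB0, hBlt⟩ := hμ A hA h0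
  have hsum : μ B + μ (A \ B) = μ A := by
    rw [measure_add_sdiff hB.nullMeasurableSet, Set.union_eq_self_of_subset_left hBA]
  rcases le_or_gt (μ B) (μ A / 2) with h | h
  · exact ⟨B, hBA, hB, hB0, h⟩
  · refine ⟨A \ B, Set.sdiff_subset, hA.diff hB, ?_, ?_⟩
    · rw [pos_iff_ne_zero]
      intro h0
      rw [h0, add_zero] at hsum
      exact hBlt.ne hsum
    · by_contra! h'
      have := ENNReal.add_lt_add h h'
      rw [hsum, ENNReal.add_halves] at this
      exact lt_irrefl _ this

theorem NonAtomic.exists_subset_measure_lt (hμ : NonAtomic μ) {A : Set Ω}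
    (hA : MeasurableSet A) (h0 : 0 < μ A) (hfin : μ A ≠ ∞) {ε : ℝ≥0∞} (hε : ε ≠ 0) :
    ∃ B ⊆ A, MeasurableSet B ∧ 0 < μ B ∧ μ B < ε := by
  have key : ∀ k : ℕ, ∃ B ⊆ A, MeasurableSet B ∧ 0 < μ B ∧ μ B ≤ μ A * (2⁻¹) ^ k := by
    intro k
    induction k with
    | zero => exact ⟨A, subset_rfl, hA, h0, by simp⟩
    | succ k ih =>
      obtain ⟨B, hBA, hB, hB0, hle⟩ := ih
      obtain ⟨C, hCB, hC, hC0, hCle⟩ := hμ.exists_subset_measure_le_half hB hB0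
      refine ⟨C, hCB.trans hBA, hC, hC0, hCle.trans ?_⟩
      rw [pow_succ, ← mul_assoc, div_eq_mul_inv]
      gcongr
  have hlim : Filter.Tendsto (fun k : ℕ => μ A * (2⁻¹ : ℝ≥0∞) ^ k) Filter.atTop (nhds 0) := by
    have := ENNReal.Tendsto.const_mul (a := μ A)
      (ENNReal.tendsto_pow_atTop_nhds_zero_of_lt_one (r := 2⁻¹) (by simp)) (Or.inr hfin)
    simpa using this
  obtain ⟨k, hk⟩ := ((hlim.eventually_lt_const (pos_iff_ne_zero.2 hε))).exists
  obtain ⟨B, h1, h2, h3, h4⟩ := key k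
  exact ⟨B, h1, h2, h3, h4.trans_lt hk⟩

/-- Sierpiński's theorem. -/
theorem NonAtomic.exists_subset_measure_eq (hμ : NonAtomic μ) {A : Set Ω}
    (hA : MeasurableSet A) (hfin : μ A ≠ ∞) {c : ℝ≥0∞} (hc : c ≤ μ A) :
    ∃ B ⊆ A, MeasurableSet B ∧ μ B = c := by
  let G : Type _ := {B : Set Ω // B ⊆ A ∧ MeasurableSet B ∧ μ B ≤ c}
  have hcfin : c ≠ ∞ := ne_top_of_le_ne_top hfin hc
  -- Nearly greedy choice: among the admissible supersets of `B`, take one within `1/(k+1)` of the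
  -- supremum of their measures. The supremum is finite because it is at most `c`.
  have ext : ∀ (B : G) (k : ℕ), ∃ B' : G, B.1 ⊆ B'.1 ∧
      ∀ D : G, B.1 ⊆ D.1 → μ D.1 ≤ μ B'.1 + ((k : ℝ≥0∞) + 1)⁻¹ := by
    intro B k
    by_contra! hcon
    let S : ℝ≥0∞ := ⨆ D : {D : G // B.1 ⊆ D.1}, μ D.1.1
    have hS : S ≤ c := iSup_le fun D => D.1.2.2.2
    have : Nonempty {D : G // B.1 ⊆ D.1} := ⟨⟨B, subset_rfl⟩⟩
    have h1 : S + ((k : ℝ≥0∞) + 1)⁻¹ ≤ S := by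
      rw [ENNReal.iSup_add]
      refine iSup_le fun D => ?_
      obtain ⟨D', hD', hlt⟩ := hcon D.1 D.2
      exact hlt.le.trans (le_iSup (fun D : {D : G // B.1 ⊆ D.1} => μ D.1.1) ⟨D', hD'⟩)
    refine absurd h1 (not_le.2 (ENNReal.lt_add_right (ne_top_of_le_ne_top hcfin hS) ?_))
    exact ENNReal.inv_ne_zero.2 (by finiteness)
  choose next hnext hmax using ext
  let B : ℕ → G := fun k => Nat.rec ⟨∅, Set.empty_subset _, MeasurableSet.empty, by simp⟩
    (fun k B => next B k) k
  have hBmono : Monotone fun k => (B k).1 := monotone_nat_of_le_succ fun k => hnext (B k) k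
  set U : Set Ω := ⋃ k, (B k).1 with hU
  have hUA : U ⊆ A := Set.iUnion_subset fun k => (B k).2.1
  have hUm : MeasurableSet U := MeasurableSet.iUnion fun k => (B k).2.2.1
  have hUc : μ U ≤ c := by
    rw [hU, hBmono.measure_iUnion]
    exact iSup_le fun k => (B k).2.2.2
  refine ⟨U, hUA, hUm, hUc.antisymm ?_⟩
  by_contra! hlt
  have hpos : 0 < μ (A \ U) := by
    rw [measure_sdiff hUA hUm.nullMeasurableSet (ne_top_of_le_ne_top hcfin hUc)]
    exact tsub_pos_of_lt (hlt.trans_le hc)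
  obtain ⟨D, hDA, hD, hD0, hDlt⟩ := hμ.exists_subset_measure_lt (hA.diff hUm) hpos
    (measure_ne_top_of_subset Set.sdiff_subset hfin) (ε := c - μ U) (tsub_pos_of_lt hlt).ne'
  have hdisj : Disjoint U D := (Set.disjoint_sdiff_right).mono_right hDA
  have hUD : μ (U ∪ D) = μ U + μ D := measure_union hdisj hD
  let W : G := ⟨U ∪ D, Set.union_subset hUA (hDA.trans Set.sdiff_subset), hUm.union hD, by
    rw [hUD]
    calc μ U + μ D ≤ μ U + (c - μ U) := by gcongr
      _ = c := add_tsub_cancel_of_le hUc⟩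
  -- `W = U ∪ D` competed in every choice, so it beats `B (k + 1) ⊆ U` by at most `1/(k+1)`. This
  -- forces `μ D = 0`.
  have hW : ∀ k : ℕ, μ U + μ D ≤ μ U + ((k : ℝ≥0∞) + 1)⁻¹ := by
    intro k
    have h := hmax (B k) k W ((Set.subset_iUnion (fun k => (B k).1) k).trans Set.subset_union_left)
    rw [← hUD]
    refine h.trans ?_
    gcongr
    exact Set.subset_iUnion (fun k => (B k).1) (k + 1)
  have hW' : ∀ k : ℕ, μ D ≤ ((k : ℝ≥0∞) + 1)⁻¹ := fun k =>
    (ENNReal.add_le_add_iff_left (ne_top_of_le_ne_top hcfin hUc)).1 (hW k)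
  obtain ⟨k, hk⟩ := ENNReal.exists_inv_nat_lt hD0.ne'
  refine absurd (hW' k) (not_le.2 (lt_of_le_of_lt ?_ hk))
  exact ENNReal.inv_le_inv.2 le_self_add

end Sierpinski

/-! ## Atoms -/

section Atoms

variable {Ω ι : Type*}

theorem mem_atom_iff {F : ι → Set Ω} {A : Finset ι} {x : Ω} :
    x ∈ atom F A ↔ ∀ Q, x ∈ F Q ↔ Q ∈ A := by
  simp only [atom, Set.mem_inter_iff, Set.mem_iInter, Set.mem_compl_iff]
  constructor
  · rintro ⟨h1, h2⟩ Q
    exact ⟨fun h => by_contra fun h' => h2 Q h' h, h1 Q⟩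
  · exact fun h => ⟨fun Q hQ => (h Q).2 hQ, fun Q hQ h' => hQ ((h Q).1 h')⟩

theorem atom_subset {F : ι → Set Ω} {A : Finset ι} {Q : ι} (hQ : Q ∈ A) : atom F A ⊆ F Q :=
  fun _ hx => (mem_atom_iff.1 hx Q).2 hQ

theorem atom_disjoint {F : ι → Set Ω} {A B : Finset ι} (h : A ≠ B) :
    Disjoint (atom F A) (atom F B) := by
  rw [Set.disjoint_left]
  intro x hA hB
  apply h
  ext Q
  rw [← mem_atom_iff.1 hA Q, mem_atom_iff.1 hB Q]

variable [Fintype ι]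

theorem mem_P0 {F : ι → Set Ω} {A : Finset ι} : A ∈ P0 F ↔ A.Nonempty ∧ (atom F A).Nonempty := by
  simp [P0]

open Classical in
-- A point `x` lies in the atom of `{Q | x ∈ F Q}`, which belongs to `P0 F` as soon as some `F Q`
-- contains `x`.
theorem biUnion_eq_biUnion_atom (F : ι → Set Ω) (S : Finset ι) :
    ⋃ Q ∈ S, F Q = ⋃ A ∈ (P0 F).filter fun A => ∃ Q ∈ S, Q ∈ A, atom F A := by
  ext x
  simp only [Set.mem_iUnion, Finset.mem_filter, exists_prop]
  constructor
  · rintro ⟨Q, hQ, hx⟩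
    have hx' : x ∈ atom F (Finset.univ.filter fun Q => x ∈ F Q) := mem_atom_iff.2 (by simp)
    exact ⟨_, ⟨mem_P0.2 ⟨⟨Q, by simpa⟩, ⟨x, hx'⟩⟩, Q, hQ, by simpa⟩, hx'⟩
  · rintro ⟨A, ⟨-, Q, hQ, hQA⟩, hx⟩
    exact ⟨Q, hQ, atom_subset hQA hx⟩

variable [MeasurableSpace Ω] {μ : Measure Ω}

theorem measurableSet_atom {F : ι → Set Ω} (hF : ∀ Q, MeasurableSet (F Q)) (A : Finset ι) :
    MeasurableSet (atom F A) := by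
  unfold atom
  refine MeasurableSet.inter ?_ ?_
  · exact A.measurableSet_biInter fun Q _ => hF Q
  · exact MeasurableSet.iInter fun Q => MeasurableSet.iInter fun _ => (hF Q).compl

theorem measure_atom_ne_top {F : ι → Set Ω} (hfin : ∀ Q, μ (F Q) < ∞) {A : Finset ι}
    (hA : A ∈ P0 F) : μ (atom F A) ≠ ∞ := by
  obtain ⟨⟨Q, hQ⟩, -⟩ := mem_P0.1 hA
  exact ((measure_mono (atom_subset hQ)).trans_lt (hfin Q)).ne

open Classical in
theorem measure_biUnion_eq_sum_atom {F : ι → Set Ω} (hF : ∀ Q, MeasurableSet (F Q))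
    (S : Finset ι) :
    μ (⋃ Q ∈ S, F Q) = ∑ A ∈ (P0 F).filter fun A => ∃ Q ∈ S, Q ∈ A, μ (atom F A) := by
  rw [biUnion_eq_biUnion_atom]
  exact measure_biUnion_finset (fun A _ B _ h => atom_disjoint h)
    fun A _ => measurableSet_atom hF A

end Atoms

/-! ## Flows in the network of a collection -/

section NetworkFlows

variable {Ω ι : Type*} [Fintype ι] {F : ι → Set Ω}

theorem sum_vertex {M : Type*} [AddCommMonoid M] (g : Vertex F → M) :
    ∑ v, g v = g .source + (g .sink + (∑ A, g (.coll A) + ∑ Q, g (.elt Q))) := by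
  let e : Unit ⊕ Unit ⊕ {A // A ∈ P0 F} ⊕ ι ≃ Vertex F :=
    { toFun := fun x => match x with
        | Sum.inl _ => Vertex.source
        | Sum.inr (Sum.inl _) => Vertex.sink
        | Sum.inr (Sum.inr (Sum.inl A)) => Vertex.coll A
        | Sum.inr (Sum.inr (Sum.inr Q)) => Vertex.elt Q
      invFun := fun v => match v with
        | Vertex.source => Sum.inl ()
        | Vertex.sink => Sum.inr (Sum.inl ())
        | Vertex.coll A => Sum.inr (Sum.inr (Sum.inl A))
        | Vertex.elt Q => Sum.inr (Sum.inr (Sum.inr Q))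
      left_inv := by rintro (_ | _ | _ | _) <;> rfl
      right_inv := by rintro (_ | _ | _ | _) <;> rfl }
  rw [← e.sum_comp]
  simp [e]

theorem edge_iff (u v : Vertex F) : Vertex.Edge F u v ↔
    match u, v with
    | .source, .coll _ => True
    | .coll A, .elt Q => Q ∈ A.1
    | .elt _, .sink => True
    | _, _ => False := by
  constructor
  · rintro (_ | _ | _) <;> simp_all
  · intro h
    match u, v, h with
    | .source, .coll A, _ => exact .sourceColl A
    | .coll A, .elt Q, h => exact .collElt A Q h
    | .elt Q, .sink, _ => exact .eltSink Q

variable [MeasurableSpace Ω] {μ : Measure Ω} {Λ : ℝ}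

open Classical in
theorem network_value (f : Vertex F → Vertex F → ℝ≥0) :
    (network μ F Λ).value f = ∑ A, f .source (.coll A) := by
  simp [Network.value, network, Finset.sum_filter, sum_vertex, edge_iff]

open Classical in
theorem network_isFlow_iff {f : Vertex F → Vertex F → ℝ≥0} :
    (network μ F Λ).IsFlow f ↔
      (∀ A, f .source (.coll A) = ∑ Q ∈ A.1, f (.coll A) (.elt Q)) ∧
      (∀ Q, (∑ A : {A // A ∈ P0 F}, if Q ∈ A.1 then f (.coll A) (.elt Q) else 0)
        = f (.elt Q) .sink) ∧
      (∀ A : {A // A ∈ P0 F}, (f .source (.coll A) : ℝ≥0∞) ≤ μ (atom F A.1)) ∧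
      ∀ Q, (f (.elt Q) .sink : ℝ≥0∞) ≤ ENNReal.ofReal Λ⁻¹ * μ (F Q) := by
  constructor
  · intro h
    refine ⟨fun A => ?_, fun Q => ?_, fun A => ?_, fun Q => ?_⟩
    · have h' := h.conservation (.coll A) (by simp [network]) (by simp [network])
      rw [← Finset.univ_inter A.1, ← Finset.sum_ite_mem]
      simp only [network, Finset.sum_filter, sum_vertex, edge_iff] at h'
      simp at h'
      convert h'
    · have h' := h.conservation (.elt Q) (by simp [network]) (by simp [network])
      simp only [network, Finset.sum_filter, sum_vertex, edge_iff] at h'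
      simp at h'
      convert h'
      simp
    · exact h.capacity _ _ (.sourceColl A)
    · exact h.capacity _ _ (.eltSink Q)
  · rintro ⟨h1, h2, h3, h4⟩
    constructor
    · rintro (_ | _ | A | Q) hs ht
      · exact absurd rfl hs
      · exact absurd rfl ht
      · have h' := h1 A
        rw [← Finset.univ_inter A.1, ← Finset.sum_ite_mem] at h'
        simp only [network, Finset.sum_filter, sum_vertex, edge_iff]
        simp
        convert h'
      · have h' := h2 Q
        simp only [network, Finset.sum_filter, sum_vertex, edge_iff]
        simp
        convert h'
        simp
    · rintro _ _ (A | ⟨A, Q, h⟩ | Q)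
      · exact h3 A
      · exact le_top
      · exact h4 Q

open Classical in
theorem Network.IsFlow.value_eq_sum_sink {f : Vertex F → Vertex F → ℝ≥0}
    (hf : (network μ F Λ).IsFlow f) :
    (network μ F Λ).value f = ∑ Q, f (.elt Q) .sink := by
  obtain ⟨h1, h2, -, -⟩ := network_isFlow_iff.1 hf
  rw [network_value, Finset.sum_congr rfl fun A _ => h1 A, Finset.sum_congr rfl fun Q _ => (h2 Q).symm,
    Finset.sum_comm]
  simp [Finset.sum_ite_mem]

/-- A flow that fills all edges into the sink. -/
def IsSaturating (μ : Measure Ω) (F : ι → Set Ω) (Λ : ℝ) (f : Vertex F → Vertex F → ℝ≥0) : Prop :=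
  (network μ F Λ).IsFlow f ∧
    ∀ Q, (f (.elt Q) .sink : ℝ≥0∞) = ENNReal.ofReal Λ⁻¹ * μ (F Q)

theorem IsSaturating.sink_le {f g : Vertex F → Vertex F → ℝ≥0} (hf : IsSaturating μ F Λ f)
    (hg : (network μ F Λ).IsFlow g) (Q : ι) : g (.elt Q) .sink ≤ f (.elt Q) .sink := by
  have := (network_isFlow_iff.1 hg).2.2.2 Q
  rw [← hf.2 Q] at this
  exact_mod_cast this

/-- The value of a flow can be counted at the sink, where a saturating flow uses the whole capacity.
-/
theorem IsSaturating.isMaxFlow {f : Vertex F → Vertex F → ℝ≥0} (hf : IsSaturating μ F Λ f) :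
    (network μ F Λ).IsMaxFlow f := by
  refine ⟨hf.1, fun g hg => ?_⟩
  rw [hg.value_eq_sum_sink, hf.1.value_eq_sum_sink]
  exact Finset.sum_le_sum fun Q _ => hf.sink_le hg Q

/-- Equal sums with termwise inequality are termwise equal. Through this lemma the cutting argument
applies to every maximum flow, not only to the constructed one. -/
theorem IsSaturating.of_isMaxFlow {f g : Vertex F → Vertex F → ℝ≥0} (hf : IsSaturating μ F Λ f)
    (hg : (network μ F Λ).IsMaxFlow g) : IsSaturating μ F Λ g := by
  refine ⟨hg.1, fun Q => ?_⟩
  rw [← hf.2 Q]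
  have hle := hg.2 f hf.1
  rw [hg.1.value_eq_sum_sink, hf.1.value_eq_sum_sink] at hle
  have := (Finset.sum_eq_sum_iff_of_le fun Q _ => hf.sink_le hg.1 Q).1
    ((Finset.sum_le_sum fun Q _ => hf.sink_le hg.1 Q).antisymm hle)
  rw [this Q (Finset.mem_univ _)]

end NetworkFlows

/-! ## The cutting loops -/

section Cutting

variable {Ω ι : Type*} [Fintype ι] {F : ι → Set Ω} [MeasurableSpace Ω] {μ : Measure Ω} {Λ : ℝ}
  {f : Vertex F → Vertex F → ℝ≥0}

open Classical in
/-- The invariant of the cutting loops. -/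
structure CutInv (μ : Measure Ω) (F : ι → Set Ω) (Λ : ℝ) (f : Vertex F → Vertex F → ℝ≥0)
    (st : CutState F) : Prop where
  nodup : st.atoms.Nodup
  measurable_rest : st.queue ≠ [] → MeasurableSet st.rest
  rest_disjoint : st.queue ≠ [] → ∀ Q, Disjoint st.rest (st.E Q)
  rest_disjoint_atom : st.queue ≠ [] → ∀ A ∈ st.atoms, Disjoint st.rest (atom F A.1)
  rest_subset : ∀ p ∈ st.queue, st.rest ⊆ F p.2
  budget : ((st.queue.map fun p => f (.coll p.1) (.elt p.2)).sum : ℝ≥0) ≤ μ st.rest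
  measurable : ∀ Q, MeasurableSet (st.E Q)
  subset : ∀ Q, st.E Q ⊆ F Q
  disjoint : Pairwise fun Q R => Disjoint (st.E Q) (st.E R)
  disjoint_atom : ∀ A ∈ st.atoms, ∀ Q, Disjoint (atom F A.1) (st.E Q)
  enough : ∀ Q, ENNReal.ofReal Λ⁻¹ * μ (F Q) ≤ μ (st.E Q) +
    ((st.queue.map fun p => if p.2 = Q then f (.coll p.1) (.elt p.2) else 0).sum +
      (st.atoms.map fun A => if Q ∈ A.1 then f (.coll A) (.elt Q) else 0).sum : ℝ≥0)

theorem CutInv.of_isInitial (hf : IsSaturating μ F Λ f) {st : CutState F} (h : st.IsInitial) :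
    CutInv μ F Λ f st := by
  classical
  obtain ⟨h1, h2, h3, h4⟩ := h
  -- The uncut part of an initial state is arbitrary, which is why the clauses about it presuppose a
  -- nonempty queue.
  refine ⟨h1, fun h => absurd h3 h, fun h => absurd h3 h, fun h => absurd h3 h, ?_, ?_, ?_, ?_, ?_,
    ?_, fun Q => ?_⟩
  · simp [h3]
  · simp [h3]
  · simp [h4]
  · simp [h4]
  · simp [h4, Pairwise]
  · simp [h4]
  -- With nothing cut yet, what is still to come for `Q` is its whole inflow, which equals its
  -- demand by conservation and saturation.
  · rw [← hf.2 Q, ← (network_isFlow_iff.1 hf.1).2.1 Q, ← List.sum_toFinset _ h1,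
      (Finset.eq_univ_iff_forall.2 fun A => List.mem_toFinset.2 (h2 A) :
        st.atoms.toFinset = Finset.univ)]
    simp [h3, h4]

theorem CutInv.step (hF : ∀ Q, MeasurableSet (F Q))
    (hf : (network μ F Λ).IsFlow f) {st st' : CutState F} (h : CutInv μ F Λ f st)
    (hst : CutStep μ F f st st') : CutInv μ F Λ f st' := by
  classical
  cases hst with
  | next A As R E Qs hnodup hmem =>
    have hA := List.nodup_cons.1 h.nodup
    have hQs : Qs.toFinset = A.1 := by ext Q; simp [hmem]
    refine ⟨hA.2, fun _ => measurableSet_atom hF _, fun _ => h.disjoint_atom A (by simp), ?_, ?_, ?_,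
      h.measurable, h.subset, h.disjoint, fun B hB => h.disjoint_atom B (by simp_all), ?_⟩
    · intro _ B hB
      exact atom_disjoint fun hAB => hA.1 (Subtype.ext hAB ▸ hB)
    · simp only [List.mem_map, forall_exists_index, and_imp]
      rintro p Q hQ rfl
      exact atom_subset ((hmem Q).1 hQ)
    -- Conservation at `v_A` and the capacity of the edge from the source: the pieces due fit into
    -- the fresh atom.
    · have h3 := (network_isFlow_iff.1 hf).2.2.1 A
      rw [(network_isFlow_iff.1 hf).1 A, ← hQs, List.sum_toFinset _ hnodup] at h3
      rw [hQs] at h3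
      simpa [Function.comp_def] using h3
    · intro Q
      refine (h.enough Q).trans (le_of_eq ?_)
      have h1 : (List.map (fun R => if R = Q then f (.coll A) (.elt R) else 0) Qs).sum =
          if Q ∈ A.1 then f (.coll A) (.elt Q) else 0 := by
        rw [← List.sum_toFinset _ hnodup, hQs, Finset.sum_ite_eq']
      simp only [List.map_map, Function.comp_def, List.map_cons, List.sum_cons, List.map_nil,
        List.sum_nil, zero_add, h1]
  | take A Q As q R E G hG hsub hμ =>
    have hR := h.measurable_rest (by simp)
    have hRE := h.rest_disjoint (by simp)
    have hRF : R ⊆ F Q := h.rest_subset (A, Q) (by simp)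
    have hsplit : μ R = μ G + μ (R \ G) := by
      rw [measure_add_sdiff hG.nullMeasurableSet, Set.union_eq_self_of_subset_left hsub]
    refine ⟨h.nodup, fun _ => hR.diff hG, ?_, fun _ B hB => ?_, ?_, ?_, ?_, ?_, ?_, ?_, ?_⟩
    · intro _ S
      simp only [Function.update_apply]
      split_ifs
      · exact Disjoint.union_right ((hRE Q).mono_left Set.sdiff_subset) Set.disjoint_sdiff_left
      · exact (hRE S).mono_left Set.sdiff_subset
    · exact (h.rest_disjoint_atom (by simp) B hB).mono_left Set.sdiff_subset
    · intro p hp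
      exact Set.sdiff_subset.trans (h.rest_subset p (by simp_all))
    · have := h.budget
      simp only [List.map_cons, List.sum_cons, ENNReal.coe_add, hsplit, hμ] at this
      exact (ENNReal.add_le_add_iff_left ENNReal.coe_ne_top).1 this
    · intro S
      simp only [Function.update_apply]
      split_ifs
      · exact (h.measurable Q).union hG
      · exact h.measurable S
    · intro S
      simp only [Function.update_apply]
      split_ifs with hS
      · subst hS; exact Set.union_subset (h.subset S) (hsub.trans hRF)
      · exact h.subset S
    · intro S T hST
      simp only [Function.update_apply]
      split_ifs with hS hT hT
      · exact absurd (hS.trans hT.symm) hST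
      · exact Disjoint.union_left (h.disjoint fun h => hT h.symm) ((hRE T).mono_left hsub)
      · exact Disjoint.union_right (h.disjoint hS) ((hRE S).mono_left hsub).symm
      · exact h.disjoint hST
    · intro B hB S
      simp only [Function.update_apply]
      split_ifs with hS
      · exact Disjoint.union_right (h.disjoint_atom B hB Q)
          (((h.rest_disjoint_atom (by simp) B hB).mono_left hsub).symm)
      · exact h.disjoint_atom B hB S
    · intro S
      refine (h.enough S).trans ?_
      simp only [List.map_cons, List.sum_cons, Function.update_apply]
      by_cases hS : S = Q
      · subst hS
        simp only [if_true]
        rw [measure_union ((hRE S).mono_left hsub).symm hG, hμ]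
        push_cast
        simp only [add_assoc, le_refl]
      · rw [if_neg hS, if_neg (fun h => hS h.symm), zero_add]

theorem CutInv.of_reachable (hF : ∀ Q, MeasurableSet (F Q)) (hf : IsSaturating μ F Λ f)
    {st : CutState F} (h : CutReachable μ F f st) : CutInv μ F Λ f st := by
  obtain ⟨st₀, h0, h⟩ := h
  induction h with
  | refl => exact .of_isInitial hf h0
  | tail _ hstep ih => exact ih.step hF hf.1 hstep

/-- The only transition that could fail is `take`. There `budget` bounds the flow value by the
measure of the uncut part, and Sierpiński's theorem provides the piece. -/
theorem CutInv.exists_step (hμ : NonAtomic μ) (hfin : ∀ Q, μ (F Q) < ∞)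
    {st : CutState F} (h : CutInv μ F Λ f st) (hst : ¬ st.IsFinal) :
    ∃ st', CutStep μ F f st st' := by
  obtain ⟨atoms, queue, R, E⟩ := st
  cases queue with
  | nil =>
    cases atoms with
    | nil => exact absurd ⟨rfl, rfl⟩ hst
    | cons A As => exact ⟨_, .next A As R E A.1.toList A.1.nodup_toList fun Q => by simp⟩
  | cons p q =>
    obtain ⟨A, Q⟩ := p
    have hb := h.budget
    simp only [List.map_cons, List.sum_cons, ENNReal.coe_add] at hb
    obtain ⟨G, hGR, hG, hGμ⟩ := hμ.exists_subset_measure_eq (h.measurable_rest (by simp))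
      (((measure_mono (h.rest_subset (A, Q) (by simp))).trans_lt (hfin Q)).ne)
      (le_self_add.trans hb)
    exact ⟨_, .take A Q atoms q R E G hG hGR hGμ⟩

theorem CutInv.isSparseWitness {st : CutState F} (h : CutInv μ F Λ f st) (hst : st.IsFinal) :
    IsSparseWitness μ F Λ⁻¹ st.E := by
  refine ⟨h.measurable, h.subset, fun Q => ?_, h.disjoint⟩
  simpa [hst.1, hst.2] using h.enough Q

/-- Starting a new atom refills the queue with at most `Fintype.card ι` entries, so a waiting atom
gets the weight `Fintype.card ι + 1`. -/
theorem CutStep.measure_lt {st st' : CutState F} (hst : CutStep μ F f st st') :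
    st'.atoms.length * (Fintype.card ι + 1) + st'.queue.length <
      st.atoms.length * (Fintype.card ι + 1) + st.queue.length := by
  cases hst with
  | next A As R E Qs hnodup hmem =>
    have := hnodup.length_le_card
    simp only [List.length_map, List.length_cons, List.length_nil]
    linarith
  | take => simp

theorem exists_final (hμ : NonAtomic μ) (hF : ∀ Q, MeasurableSet (F Q)) (hfin : ∀ Q, μ (F Q) < ∞)
    (hf : IsSaturating μ F Λ f) : ∃ st, CutReachable μ F f st ∧ st.IsFinal := by
  have key : ∀ (N : ℕ) (st : CutState F), CutReachable μ F f st →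
      st.atoms.length * (Fintype.card ι + 1) + st.queue.length ≤ N →
      ∃ st, CutReachable μ F f st ∧ st.IsFinal := by
    intro N
    induction N with
    | zero =>
      intro st hst hN
      refine ⟨st, hst, ?_⟩
      simpa [CutState.IsFinal] using hN
    | succ N ih =>
      intro st hst hN
      by_cases hfinal : st.IsFinal
      · exact ⟨st, hst, hfinal⟩
      obtain ⟨st', hstep⟩ := (CutInv.of_reachable hF hf hst).exists_step hμ hfin hfinal
      have hlt := hstep.measure_lt
      obtain ⟨st₀, h0, hrun⟩ := hst
      exact ih st' ⟨st₀, h0, hrun.tail hstep⟩ (by omega)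
  have hinit : CutState.IsInitial (F := F) ⟨Finset.univ.toList, [], ∅, fun _ => ∅⟩ :=
    ⟨Finset.nodup_toList _, by simp, rfl, rfl⟩
  exact key _ _ ⟨_, hinit, .refl⟩ le_rfl

end Cutting

/-! ## The push-relabel method on a bipartite network

The vertices are the numbers below `V`, and those below `n` form one side.  Vertices of negative
excess play the role of the sink.  Active vertices, those of positive excess, are visited in
passes, so that the total time is `O(V² · D)`, where `D` bounds the labels. -/

/-- A state of the method.  The fields `K` and `L₀` are needed only for the analysis. -/
structure PushState where
  /-- excesses -/
  e : ℕ → ℝ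
  /-- residual capacities -/
  r : ℕ → ℕ → ℝ
  /-- distance labels -/
  h : ℕ → ℕ
  /-- current arcs -/
  cur : ℕ → ℕ
  /-- the vertex that is visited -/
  u : ℕ
  /-- whether an active vertex has been met in the current pass -/
  flag : ℕ
  /-- a strict bound for the labels of the active vertices at the start of the pass -/
  K : ℕ
  /-- the sum of the labels at the start of the pass -/
  L₀ : ℕ

namespace PushState

/-- The sum of the labels. -/
def L (V : ℕ) (σ : PushState) : ℕ := ∑ a ∈ Finset.range V, σ.h a

/-- Send `δ` from `a` to `b`. -/
def push (σ : PushState) (a b : ℕ) (δ : ℝ) : PushState :=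
  { σ with
    e := fun x => σ.e x + (if x = b then δ else 0) - (if x = a then δ else 0)
    r := fun x y => σ.r x y + (if x = b ∧ y = a then δ else 0) - (if x = a ∧ y = b then δ else 0)
    flag := 1 }

open Classical in
/-- One step of the method. -/
def step (V : ℕ) (σ : PushState) : PushState :=
  if V ≤ σ.u then
    { σ with
      u := 0, flag := 0, L₀ := σ.L V
      K := if σ.L₀ = σ.L V then σ.K - 1 else σ.K + (σ.L V - σ.L₀) }
  else if σ.e σ.u ≤ 0 then { σ with u := σ.u + 1 }
  else if V ≤ σ.cur σ.u then
    { σ with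
      h := Function.update σ.h σ.u (σ.h σ.u + 2)
      cur := Function.update σ.cur σ.u 0
      u := σ.u + 1
      flag := 1 }
  else if 0 < σ.r σ.u (σ.cur σ.u) ∧ σ.h σ.u = σ.h (σ.cur σ.u) + 1 then
    if σ.e σ.u ≤ σ.r σ.u (σ.cur σ.u) then
      { σ.push σ.u (σ.cur σ.u) (σ.e σ.u) with u := σ.u + 1 }
    else
      { σ.push σ.u (σ.cur σ.u) (σ.r σ.u (σ.cur σ.u)) with
        cur := Function.update σ.cur σ.u (σ.cur σ.u + 1) }
  else
    { σ with cur := Function.update σ.cur σ.u (σ.cur σ.u + 1), flag := 1 }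

/-- The method is finished when a pass has met no active vertex. -/
def Done (V : ℕ) (σ : PushState) : Prop := V ≤ σ.u ∧ σ.flag = 0

/-- The invariant of the flow and the labels. -/
structure FlowInv (n V : ℕ) (e₀ : ℕ → ℝ) (r₀ : ℕ → ℕ → ℝ) (σ : PushState) : Prop where
  r_nonneg : ∀ a b, 0 ≤ σ.r a b
  r_add : ∀ a b, σ.r a b + σ.r b a = r₀ a b + r₀ b a
  e_eq : ∀ a, σ.e a = e₀ a - ∑ b ∈ Finset.range V, (r₀ a b - σ.r a b)
  valid : ∀ a b, 0 < σ.r a b → σ.h a ≤ σ.h b + 1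
  cur_valid : ∀ a b, b < σ.cur a → 0 < σ.r a b → σ.h a ≤ σ.h b
  parity : ∀ a, σ.h a % 2 = if a < n then 1 else 0
  bipartite : ∀ a b, 0 < σ.r a b → (a < n ↔ ¬ b < n)
  label_of_neg : ∀ a, σ.e a < 0 → σ.h a = 0
  e_nonneg : ∀ a, 0 ≤ e₀ a → 0 ≤ σ.e a
  cur_le : ∀ a < V, σ.cur a ≤ V

/-- The invariant of the passes. -/
structure PassInv (V D : ℕ) (σ : PushState) : Prop where
  h_le : ∀ a < V, σ.h a ≤ D
  u_le : σ.u ≤ V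
  L_le : σ.L₀ ≤ σ.L V
  bound : ∀ a < V, 0 < σ.e a → σ.h a < σ.K + (σ.L V - σ.L₀)
  pass : σ.L₀ = σ.L V → ∀ a < σ.u, 0 < σ.e a → σ.h a + 1 < σ.K
  flag_eq : σ.flag = 0 → ∀ a < σ.u, σ.e a ≤ 0
  flag_ne : σ.flag ≠ 0 → σ.K ≠ 0 ∨ σ.L₀ ≠ σ.L V

/-- A bound for the number of steps to come. -/
def potential (V D : ℕ) (σ : PushState) : ℕ :=
  (σ.K + 2 * (V * D - σ.L₀)) * (V + 1) + (V - σ.u) +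
    ∑ a ∈ Finset.range V, ((D - σ.h a) * (V + 1) + (V - σ.cur a))

/-! ### The cut condition and the bound for the labels. -/

variable {n V D : ℕ} {e₀ : ℕ → ℝ} {r₀ : ℕ → ℕ → ℝ} {σ : PushState}

/-- The cut condition: no set of vertices has more excess than can leave it. -/
def CutCondition (V : ℕ) (e₀ : ℕ → ℝ) (r₀ : ℕ → ℕ → ℝ) : Prop :=
  ∀ S ⊆ Finset.range V,
    ∑ a ∈ S, e₀ a ≤ ∑ a ∈ S, ∑ b ∈ Finset.range V \ S, r₀ a b

/-- Gap argument. If the label `k` is missing, no residual arc leaves the set `S` of vertices with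
labels above `k`, since residual arcs descend by at most one. So `S` has sent out all it can, and
the cut condition makes its total excess nonpositive. But labels in `S` are positive, so no excess
there is negative, and that of `w` must vanish. -/
theorem FlowInv.exists_label_eq (hσ : FlowInv n V e₀ r₀ σ) (hcut : CutCondition V e₀ r₀)
    {w : ℕ} (hw : w < V) (he : 0 < σ.e w) {k : ℕ} (hk : k < σ.h w) :
    ∃ v < V, σ.h v = k := by
  by_contra! hgap
  set S := (Finset.range V).filter fun a => k < σ.h a with hS
  have hSV : S ⊆ Finset.range V := Finset.filter_subset _ _
  have hr : ∀ a ∈ S, ∀ b ∈ Finset.range V \ S, σ.r a b = 0 := by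
    intro a ha b hb
    simp only [hS, Finset.mem_filter, Finset.mem_sdiff, Finset.mem_range, not_and, not_lt] at ha hb
    by_contra h0
    have h1 := hσ.valid a b (lt_of_le_of_ne (hσ.r_nonneg a b) (Ne.symm h0))
    have h2 := hb.2 hb.1
    have h3 := hgap b hb.1
    omega
  -- The net flow `r₀ a b - σ.r a b` is antisymmetric, so it cancels inside `S`.
  have hin : ∑ a ∈ S, ∑ b ∈ S, (r₀ a b - σ.r a b) = 0 := by
    have h1 : ∑ a ∈ S, ∑ b ∈ S, (r₀ a b - σ.r a b) = - ∑ a ∈ S, ∑ b ∈ S, (r₀ a b - σ.r a b) := by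
      conv_lhs => rw [Finset.sum_comm]
      rw [← Finset.sum_neg_distrib]
      refine Finset.sum_congr rfl fun a _ => ?_
      rw [← Finset.sum_neg_distrib]
      refine Finset.sum_congr rfl fun b _ => ?_
      linarith [hσ.r_add a b]
    linarith
  have hsum : ∑ a ∈ S, σ.e a = ∑ a ∈ S, e₀ a - ∑ a ∈ S, ∑ b ∈ Finset.range V \ S, r₀ a b := by
    rw [Finset.sum_congr rfl fun a _ => hσ.e_eq a, Finset.sum_sub_distrib]
    congr 1
    rw [← add_zero (∑ a ∈ S, ∑ b ∈ Finset.range V \ S, r₀ a b), ← hin, ← Finset.sum_add_distrib]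
    refine Finset.sum_congr rfl fun a ha => ?_
    rw [← Finset.sum_sdiff hSV]
    congr 1
    exact Finset.sum_congr rfl fun b hb => by rw [hr a ha b hb, sub_zero]
  have hle : ∑ a ∈ S, σ.e a ≤ 0 := by linarith [hcut S hSV]
  have hnonneg : ∀ a ∈ S, 0 ≤ σ.e a := by
    intro a ha
    by_contra! hneg
    have := hσ.label_of_neg a hneg
    simp only [hS, Finset.mem_filter] at ha
    omega
  have hwS : w ∈ S := by simp [hS, hw, hk]
  exact absurd (Finset.single_le_sum hnonneg hwS) (by linarith)

/-- All labels below `σ.h w` occur. The odd ones are carried by different vertices below `n`, the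
even ones by different vertices in `[n, V)`; counting on the smaller side gives the bound. -/
theorem FlowInv.label_le (hσ : FlowInv n V e₀ r₀ σ) (hcut : CutCondition V e₀ r₀)
    {w : ℕ} (hw : w < V) (he : 0 < σ.e w) : σ.h w ≤ 2 * min n (V - n) + 1 := by
  choose! v hv hvk using fun k (hk : k < σ.h w) => hσ.exists_label_eq hcut hw he hk
  by_contra! hlt
  rcases le_total n (V - n) with h | h
  · rw [min_eq_left h] at hlt
    have hmaps : ∀ j ∈ Finset.range (n + 1), v (2 * j + 1) ∈ Finset.range n := by
      intro j hj
      rw [Finset.mem_range] at hj ⊢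
      have h1 := hvk (2 * j + 1) (by omega)
      have h2 := hσ.parity (v (2 * j + 1))
      by_contra hcon
      rw [if_neg hcon] at h2
      omega
    have hinj : Set.InjOn (fun j => v (2 * j + 1)) (Finset.range (n + 1)) := by
      intro i hi j hj hij
      simp only [Finset.coe_range, Set.mem_Iio] at hi hj hij
      have h1 := hvk (2 * i + 1) (by omega)
      have h2 := hvk (2 * j + 1) (by omega)
      rw [hij] at h1
      omega
    simpa using Finset.card_le_card_of_injOn _ hmaps hinj
  · rw [min_eq_right h] at hlt
    have hmaps : ∀ j ∈ Finset.range (V - n + 1), v (2 * j) ∈ Finset.Ico n V := by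
      intro j hj
      rw [Finset.mem_range] at hj
      rw [Finset.mem_Ico]
      have h1 := hvk (2 * j) (by omega)
      have h2 := hσ.parity (v (2 * j))
      refine ⟨?_, hv _ (by omega)⟩
      by_contra! hcon
      rw [if_pos hcon] at h2
      omega
    have hinj : Set.InjOn (fun j => v (2 * j)) (Finset.range (V - n + 1)) := by
      intro i hi j hj hij
      simp only [Finset.coe_range, Set.mem_Iio] at hi hj hij
      have h1 := hvk (2 * i) (by omega)
      have h2 := hvk (2 * j) (by omega)
      rw [hij] at h1
      omega
    simpa using Finset.card_le_card_of_injOn _ hmaps hinj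

/-! ### Steps preserve the flow invariant. -/

theorem FlowInv.push (hσ : FlowInv n V e₀ r₀ σ) {a b : ℕ} {δ : ℝ} (ha : a < V) (hb : b < V)
    (hr : 0 < σ.r a b) (hlab : σ.h a = σ.h b + 1) (hδ : 0 ≤ δ) (hδr : δ ≤ σ.r a b)
    (hδe : δ ≤ σ.e a) : FlowInv n V e₀ r₀ (σ.push a b δ) := by
  have hab : a ≠ b := by rintro rfl; omega
  refine ⟨fun x y => ?_, fun x y => ?_, fun x => ?_, fun x y h => ?_, fun x y hy h => ?_, hσ.parity,
    fun x y h => ?_, fun x h => ?_, fun x h => ?_, hσ.cur_le⟩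
  · simp only [PushState.push]
    have := hσ.r_nonneg x y
    split_ifs with h1 h2 h2
    · linarith
    · linarith
    · obtain ⟨rfl, rfl⟩ := h2; linarith
    · linarith
  · simp only [PushState.push]
    rw [← hσ.r_add x y]
    simp only [and_comm]
    ring
  · simp only [PushState.push, Finset.sum_sub_distrib, Finset.sum_add_distrib, ite_and,
      Finset.sum_ite_irrel, Finset.sum_ite_eq', Finset.sum_const_zero, Finset.mem_range, ha, hb,
      if_true]
    rw [hσ.e_eq x, Finset.sum_sub_distrib]
    ring
  · simp only [PushState.push] at h ⊢
    -- The only arc that can become residual is `(b, a)`; it leads upwards because `σ.h a = σ.h b +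
    -- 1`, so it harms neither `valid` nor `cur_valid`.
    by_cases h1 : x = b ∧ y = a
    · obtain ⟨rfl, rfl⟩ := h1; omega
    · rw [if_neg h1] at h
      apply hσ.valid
      split_ifs at h <;> linarith
  · simp only [PushState.push] at h hy ⊢
    by_cases h1 : x = b ∧ y = a
    · obtain ⟨rfl, rfl⟩ := h1; omega
    · rw [if_neg h1] at h
      apply hσ.cur_valid _ _ hy
      split_ifs at h <;> linarith
  · simp only [PushState.push] at h
    by_cases h1 : x = b ∧ y = a
    · obtain ⟨rfl, rfl⟩ := h1
      have := hσ.bipartite _ _ hr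
      tauto
    · rw [if_neg h1] at h
      apply hσ.bipartite
      split_ifs at h <;> linarith
  · simp only [PushState.push] at h ⊢
    apply hσ.label_of_neg
    by_cases h1 : x = a
    · subst h1
      rw [if_neg hab, if_pos rfl] at h
      linarith
    · rw [if_neg h1] at h
      split_ifs at h <;> linarith
  · have := hσ.e_nonneg x h
    simp only [PushState.push]
    by_cases h1 : x = a
    · subst h1
      rw [if_neg hab, if_pos rfl]
      linarith
    · rw [if_neg h1]
      split_ifs <;> linarith

/-- When all arcs of `a` have been scanned, each residual arc `(a, b)` has `σ.h a ≤ σ.h b`. The two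
labels differ in parity, so in fact `σ.h a + 1 ≤ σ.h b`, which leaves room for raising the label by
2. -/
theorem FlowInv.relabel (hσ : FlowInv n V e₀ r₀ σ) (hr₀ : ∀ a b, 0 < r₀ a b → a < V ∧ b < V)
    {a : ℕ} (he : 0 < σ.e a) (hcur : V ≤ σ.cur a) {u : ℕ} :
    FlowInv n V e₀ r₀ { σ with
      h := Function.update σ.h a (σ.h a + 2), cur := Function.update σ.cur a 0, u := u, flag := 1 } := by
  have hle : ∀ x, σ.h x ≤ Function.update σ.h a (σ.h a + 2) x := by
    intro x
    rcases eq_or_ne x a with rfl | hx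
    · simp
    · simp [hx]
  refine ⟨hσ.r_nonneg, hσ.r_add, hσ.e_eq, fun x y h => ?_, fun x y hy h => ?_, fun x => ?_,
    hσ.bipartite, fun x h => ?_, hσ.e_nonneg, fun x hxV => ?_⟩
  · simp only at h
    rcases eq_or_ne x a with rfl | hx
    · have hyV : y < V := by
        by_contra hy
        have h1 : r₀ x y ≤ 0 := not_lt.1 fun h => hy (hr₀ _ _ h).2
        have h2 : r₀ y x ≤ 0 := not_lt.1 fun h => hy (hr₀ _ _ h).1
        linarith [hσ.r_add x y, hσ.r_nonneg y x]
      have h1 := hσ.cur_valid x y (by omega) h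
      have h2 := hσ.bipartite _ _ h
      have h3 := hσ.parity x
      have h4 := hσ.parity y
      have h5 := hle y
      simp only [Function.update_self]
      by_cases hxn : x < n
      · rw [if_pos hxn] at h3
        rw [if_neg (h2.1 hxn)] at h4
        omega
      · rw [if_neg hxn] at h3
        rw [if_pos (by tauto)] at h4
        omega
    · have := hσ.valid x y h
      have := hle y
      simp only [Function.update_of_ne hx]
      omega
  · rcases eq_or_ne x a with rfl | hx
    · simp at hy
    · simp only [Function.update_of_ne hx] at hy h ⊢
      exact (hσ.cur_valid x y hy h).trans (hle y)
  · rcases eq_or_ne x a with rfl | hx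
    · simpa using hσ.parity x
    · simpa [hx] using hσ.parity x
  · rcases eq_or_ne x a with rfl | hx
    · simp only at h; linarith
    · simpa [hx] using hσ.label_of_neg x h
  · rcases eq_or_ne x a with rfl | hx
    · simp
    · simpa [hx] using hσ.cur_le x hxV

theorem FlowInv.advance (hσ : FlowInv n V e₀ r₀ σ) {a : ℕ} (hcur : σ.cur a < V)
    (h : 0 < σ.r a (σ.cur a) → σ.h a ≠ σ.h (σ.cur a) + 1) {k : ℕ} :
    FlowInv n V e₀ r₀ { σ with cur := Function.update σ.cur a (σ.cur a + 1), flag := k } := by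
  refine ⟨hσ.r_nonneg, hσ.r_add, hσ.e_eq, hσ.valid, fun x y hy hr => ?_, hσ.parity, hσ.bipartite,
    hσ.label_of_neg, hσ.e_nonneg, fun x hxV => ?_⟩
  · rcases eq_or_ne x a with rfl | hx
    · simp only [Function.update_self] at hy hr ⊢
      rcases Nat.lt_succ_iff_lt_or_eq.1 hy with hy | rfl
      · exact hσ.cur_valid x y hy hr
      · have := hσ.valid _ _ hr
        have := h hr
        omega
    · simp only [Function.update_of_ne hx] at hy
      exact hσ.cur_valid x y hy hr
  · rcases eq_or_ne x a with rfl | hx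
    · simpa using hcur
    · simpa [hx] using hσ.cur_le x hxV

theorem FlowInv.of_eq {σ' : PushState} (hσ : FlowInv n V e₀ r₀ σ) (he : σ'.e = σ.e)
    (hr : σ'.r = σ.r) (hh : σ'.h = σ.h) (hc : σ'.cur = σ.cur) : FlowInv n V e₀ r₀ σ' := by
  obtain ⟨h1, h2, h3, h4, h5, h6, h7, h8, h9, h10⟩ := hσ
  constructor <;> simpa only [he, hr, hh, hc]

theorem FlowInv.step (hσ : FlowInv n V e₀ r₀ σ) (hr₀ : ∀ a b, 0 < r₀ a b → a < V ∧ b < V) :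
    FlowInv n V e₀ r₀ (σ.step V) := by
  unfold PushState.step
  split_ifs with h1 h2 h3 h4 h5 h6
  · exact hσ.of_eq rfl rfl rfl rfl
  · exact hσ.of_eq rfl rfl rfl rfl
  · exact hσ.of_eq rfl rfl rfl rfl
  · exact hσ.relabel hr₀ (not_le.1 h3) h4
  · exact (hσ.push (not_le.1 h1) (not_le.1 h4) h5.1 h5.2 (not_le.1 h3).le h6 le_rfl).of_eq
      rfl rfl rfl rfl
  -- The push has used up the arc, so the current arc may move on.
  · refine (hσ.push (not_le.1 h1) (not_le.1 h4) h5.1 h5.2 h5.1.le le_rfl (not_le.1 h6).le).advance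
      (not_le.1 h4) fun h => ?_
    have hne : σ.u ≠ σ.cur σ.u := fun h' => by rw [← h'] at h5; omega
    simp [PushState.push, hne] at h
  · exact hσ.advance (not_le.1 h4) fun h h' => h5 ⟨h, h'⟩

/-! ### Passes and the potential. -/

theorem L_le_of_label_le (h : ∀ a < V, σ.h a ≤ D) : σ.L V ≤ V * D := by
  simpa [L] using Finset.sum_le_card_nsmul (Finset.range V) σ.h D fun a ha => h a (Finset.mem_range.1 ha)

theorem L_relabel {a k u l : ℕ} {c : ℕ → ℕ} (ha : a < V) :
    L V { σ with h := Function.update σ.h a (σ.h a + k), cur := c, u := u, flag := l } =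
      σ.L V + k := by
  simp only [L]
  rw [Finset.sum_update_of_mem (Finset.mem_range.2 ha),
    ← Finset.add_sum_erase _ _ (Finset.mem_range.2 ha), Finset.erase_eq]
  ring

/-- In a pass without relabelling, every visited vertex has been emptied and can become active again
only through a push from a label one higher. The bound `K` for active labels therefore drops by one
at the end of such a pass; in any other pass it grows at most by the total increase of the labels.
-/
theorem PassInv.step (hσ : PassInv V D σ) (hlab : σ.u < V → 0 < σ.e σ.u → σ.h σ.u + 2 ≤ D) :
    PassInv V D (σ.step V) := by
  have hact : σ.u < V → 0 < σ.e σ.u → σ.K ≠ 0 ∨ σ.L₀ ≠ σ.L V := by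
    intro hu he
    have := hσ.bound _ hu he
    by_contra! hcon
    omega
  unfold PushState.step
  split_ifs with h1 h2 h3 h4 h5 h6
  · refine ⟨hσ.h_le, Nat.zero_le _, le_rfl, fun a ha he => ?_, fun _ a ha => ?_, fun _ a ha => ?_,
      fun h => absurd rfl h⟩
    · have := hσ.pass h2 a (lt_of_lt_of_le ha h1) he
      simp only at he ⊢
      omega
    · simp at ha
    · simp at ha
  · refine ⟨hσ.h_le, Nat.zero_le _, le_rfl, fun a ha he => ?_, fun _ a ha => ?_, fun _ a ha => ?_,
      fun h => absurd rfl h⟩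
    · have := hσ.bound a ha he
      simp only at he ⊢
      omega
    · simp at ha
    · simp at ha
  · refine ⟨hσ.h_le, not_le.1 h1, hσ.L_le, hσ.bound, fun h a ha he => ?_, fun h a ha => ?_,
      hσ.flag_ne⟩
    · rcases Nat.lt_succ_iff_lt_or_eq.1 ha with ha | rfl
      · exact hσ.pass h a ha he
      · exact absurd h3 (not_le.2 he)
    · rcases Nat.lt_succ_iff_lt_or_eq.1 ha with ha | rfl
      · exact hσ.flag_eq h a ha
      · exact h3
  · have hu := not_le.1 h1
    have hL := hσ.L_le
    refine ⟨fun a ha => ?_, hu, ?_, fun a ha he => ?_, fun h => ?_, fun h => absurd h one_ne_zero,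
      fun _ => Or.inr ?_⟩
    · rcases eq_or_ne a σ.u with rfl | hne
      · simpa using hlab (not_le.1 h1) (not_le.1 h3)
      · simpa [hne] using hσ.h_le a ha
    · rw [L_relabel hu]
      exact hL.trans (Nat.le_add_right _ _)
    · rw [L_relabel hu]
      have := hσ.bound a ha he
      rcases eq_or_ne a σ.u with rfl | hne
      · simp only [Function.update_self]
        omega
      · simp only [Function.update_of_ne hne]
        omega
    · rw [L_relabel hu] at h
      simp only at h
      omega
    · rw [L_relabel hu]
      simp only
      omega
  · have hu := not_le.1 h1
    have hne : σ.u ≠ σ.cur σ.u := fun h' => by rw [← h'] at h5; omega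
    have hb := hσ.bound _ hu (not_le.1 h3)
    refine ⟨hσ.h_le, hu, hσ.L_le, fun a ha he => ?_, fun h a ha he => ?_,
      fun h => absurd h one_ne_zero, fun _ => hact hu (not_le.1 h3)⟩
    · change σ.h a < σ.K + (σ.L V - σ.L₀)
      rcases eq_or_ne a (σ.cur σ.u) with rfl | hac
      · omega
      · apply hσ.bound a ha
        simp only [PushState.push, if_neg hac] at he
        split_ifs at he with hau
        · rw [hau]; exact not_le.1 h3
        · simpa using he
    · change σ.L₀ = σ.L V at h
      change σ.h a + 1 < σ.K
      -- The receiving vertex lies one below `σ.u`, whose label is less than `K`.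
      rcases eq_or_ne a (σ.cur σ.u) with rfl | hac
      · omega
      · simp only [PushState.push, if_neg hac] at he
        split_ifs at he with hau
        -- The vertex just left has sent away its whole excess.
        · simp [hau] at he
        · rcases Nat.lt_succ_iff_lt_or_eq.1 ha with ha | rfl
          · exact hσ.pass h a ha (by simpa using he)
          · exact absurd rfl hau
  · have hu := not_le.1 h1
    have hne : σ.u ≠ σ.cur σ.u := fun h' => by rw [← h'] at h5; omega
    have hb := hσ.bound _ hu (not_le.1 h3)
    refine ⟨hσ.h_le, hσ.u_le, hσ.L_le, fun a ha he => ?_, fun h a ha he => ?_,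
      fun h => absurd h one_ne_zero, fun _ => hact hu (not_le.1 h3)⟩
    · change σ.h a < σ.K + (σ.L V - σ.L₀)
      rcases eq_or_ne a (σ.cur σ.u) with rfl | hac
      · omega
      · apply hσ.bound a ha
        simp only [PushState.push, if_neg hac] at he
        split_ifs at he with hau
        · rw [hau]; exact not_le.1 h3
        · simpa using he
    · change σ.L₀ = σ.L V at h
      change a < σ.u at ha
      change σ.h a + 1 < σ.K
      rcases eq_or_ne a (σ.cur σ.u) with rfl | hac
      · omega
      · simp only [PushState.push, if_neg hac, if_neg ha.ne] at he
        exact hσ.pass h a ha (by simpa using he)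
  · exact ⟨hσ.h_le, hσ.u_le, hσ.L_le, hσ.bound, hσ.pass, fun h => absurd h one_ne_zero,
      fun _ => hact (not_le.1 h1) (not_le.1 h3)⟩

/-- The weight `V + 1` pays for resetting `u` at the end of a pass, or a current arc at a
relabelling. The factor 2 before `V * D - σ.L₀` is there because a pass that raises the sum of the
labels by `d` may raise `K` by `d` as well; the net change is still `-d`. -/
theorem PassInv.potential_step_lt (hσ : PassInv V D σ)
    (hlab : σ.u < V → 0 < σ.e σ.u → σ.h σ.u + 2 ≤ D) (hdone : ¬ σ.Done V) :
    (σ.step V).potential V D < σ.potential V D := by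
  have hL := L_le_of_label_le hσ.h_le
  have hL₀ := hσ.L_le
  have hadv : σ.u < V → σ.cur σ.u < V → ∑ a ∈ Finset.range V,
      ((D - σ.h a) * (V + 1) + (V - Function.update σ.cur σ.u (σ.cur σ.u + 1) a)) <
      ∑ a ∈ Finset.range V, ((D - σ.h a) * (V + 1) + (V - σ.cur a)) := by
    intro hu hc
    refine Finset.sum_lt_sum (fun a _ => ?_) ⟨σ.u, Finset.mem_range.2 hu, ?_⟩
    · rcases eq_or_ne a σ.u with rfl | hne
      · simp only [Function.update_self]; omega
      · simp [hne]
    · simp only [Function.update_self]; omega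
  unfold PushState.step
  split_ifs with h1 h2 h3 h4 h5 h6
  -- An active vertex was met and nothing was relabelled, so `σ.K` is positive and the truncated
  -- `σ.K - 1` really decreases.
  · have hK := hσ.flag_ne fun h => hdone ⟨h1, h⟩
    simp only [potential]
    have : (σ.K - 1 + 2 * (V * D - σ.L V) + 1) * (V + 1) ≤
        (σ.K + 2 * (V * D - σ.L₀)) * (V + 1) := Nat.mul_le_mul_right _ (by omega)
    rw [add_mul _ 1] at this
    omega
  · simp only [potential]
    have : (σ.K + (σ.L V - σ.L₀) + 2 * (V * D - σ.L V) + 1) * (V + 1) ≤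
        (σ.K + 2 * (V * D - σ.L₀)) * (V + 1) := Nat.mul_le_mul_right _ (by omega)
    rw [add_mul _ 1] at this
    omega
  · simp only [potential]
    omega
  · simp only [potential]
    have : ∑ a ∈ Finset.range V, ((D - Function.update σ.h σ.u (σ.h σ.u + 2) a) * (V + 1) +
        (V - Function.update σ.cur σ.u 0 a)) ≤
        ∑ a ∈ Finset.range V, ((D - σ.h a) * (V + 1) + (V - σ.cur a)) := by
      refine Finset.sum_le_sum fun a _ => ?_
      rcases eq_or_ne a σ.u with rfl | hne
      · simp only [Function.update_self]
        have h7 := hlab (not_le.1 h1) (not_le.1 h3)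
        have : (D - (σ.h σ.u + 2) + 1) * (V + 1) ≤ (D - σ.h σ.u) * (V + 1) :=
          Nat.mul_le_mul_right _ (by omega)
        rw [add_mul _ 1] at this
        omega
      · simp [hne]
    omega
  · simp only [potential, PushState.push]
    omega
  · have := hadv (not_le.1 h1) (not_le.1 h4)
    simp only [potential, PushState.push]
    omega
  · have := hadv (not_le.1 h1) (not_le.1 h4)
    simp only [potential]
    omega

/-- The initial state. -/
def start (n V : ℕ) (e₀ : ℕ → ℝ) (r₀ : ℕ → ℕ → ℝ) : PushState where
  e := e₀
  r := r₀
  h a := if a < n then 1 else 0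
  cur _ := 0
  u := 0
  flag := 0
  K := 2
  L₀ := ∑ a ∈ Finset.range V, if a < n then 1 else 0

/-- The requirements on the initial excesses and capacities. -/
structure Admissible (n V : ℕ) (e₀ : ℕ → ℝ) (r₀ : ℕ → ℕ → ℝ) : Prop where
  r_nonneg : ∀ a b, 0 ≤ r₀ a b
  lt : ∀ a b, 0 < r₀ a b → a < V ∧ b < V
  bipartite : ∀ a b, 0 < r₀ a b → (a < n ↔ ¬ b < n)
  e_nonneg : ∀ a < n, 0 ≤ e₀ a
  cut : CutCondition V e₀ r₀

/-- The bound for the labels. -/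
abbrev maxLabel (n V : ℕ) : ℕ := 2 * min n (V - n) + 3

/-- The complete invariant. -/
def Inv (n V : ℕ) (e₀ : ℕ → ℝ) (r₀ : ℕ → ℕ → ℝ) (σ : PushState) : Prop :=
  FlowInv n V e₀ r₀ σ ∧ PassInv V (maxLabel n V) σ

/-- The initial labels 0 and 1 explain `K = 2`. Vertices of negative excess lie on the side with
label 0, since excesses below `n` are nonnegative. -/
theorem Admissible.inv_start (h : Admissible n V e₀ r₀) : Inv n V e₀ r₀ (start n V e₀ r₀) := by
  refine ⟨⟨h.r_nonneg, fun _ _ => rfl, by simp [start], fun a b _ => ?_, ?_, fun a => ?_,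
    h.bipartite, fun a ha => ?_, fun _ h => h, by simp [start]⟩,
    ⟨fun a _ => ?_, Nat.zero_le _, le_rfl, fun a _ _ => ?_, ?_, ?_, ?_⟩⟩
  · simp only [start]; split_ifs <;> omega
  · simp [start]
  · simp only [start]; split_ifs <;> rfl
  · simp only [start]
    rw [if_neg fun han => absurd ha (not_lt.2 (h.e_nonneg a han))]
  · simp only [start, maxLabel]; split_ifs <;> omega
  · simp only [start]; split_ifs <;> omega
  · simp [start]
  · simp [start]
  · simp [start]

theorem Inv.step (hadm : Admissible n V e₀ r₀) (hσ : Inv n V e₀ r₀ σ) (hdone : ¬ σ.Done V) :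
    Inv n V e₀ r₀ (σ.step V) ∧
      (σ.step V).potential V (maxLabel n V) < σ.potential V (maxLabel n V) := by
  have hlab : σ.u < V → 0 < σ.e σ.u → σ.h σ.u + 2 ≤ maxLabel n V := fun hu he => by
    have := hσ.1.label_le hadm.cut hu he
    unfold maxLabel
    omega
  exact ⟨⟨hσ.1.step hadm.lt, hσ.2.step hlab⟩, hσ.2.potential_step_lt hlab hdone⟩

theorem Inv.nonpos_of_done (hσ : Inv n V e₀ r₀ σ) (hdone : σ.Done V) : ∀ a < V, σ.e a ≤ 0 :=
  fun a ha => hσ.2.flag_eq hdone.2 a (lt_of_lt_of_le ha hdone.1)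

/-- Termination of the method, used as an existence theorem for saturating flows independently of
any program. -/
theorem Admissible.exists_done (hadm : Admissible n V e₀ r₀) :
    ∃ σ, Inv n V e₀ r₀ σ ∧ σ.Done V := by
  have key : ∀ (N : ℕ) (σ : PushState), Inv n V e₀ r₀ σ → σ.potential V (maxLabel n V) ≤ N →
      ∃ σ, Inv n V e₀ r₀ σ ∧ σ.Done V := by
    intro N
    induction N with
    | zero =>
      intro σ hσ hN
      by_contra! hcon
      have := (hσ.step hadm (hcon σ hσ)).2
      omega
    | succ N ih =>
      intro σ hσ hN
      by_cases hdone : σ.Done V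
      · exact ⟨σ, hσ, hdone⟩
      · have := hσ.step hadm hdone
        exact ih _ this.1 (by omega)
  exact key _ _ hadm.inv_start le_rfl

theorem potential_start_le :
    (start n V e₀ r₀).potential V (maxLabel n V) ≤
      (2 + 2 * (V * maxLabel n V)) * (V + 1) + V + V * (maxLabel n V * (V + 1) + V) := by
  simp only [potential, start]
  have h1 : ∀ x, (2 + 2 * (V * maxLabel n V - x)) * (V + 1) ≤
      (2 + 2 * (V * maxLabel n V)) * (V + 1) := fun x => Nat.mul_le_mul_right _ (by omega)
  have h2 : ∑ a ∈ Finset.range V, ((maxLabel n V - if a < n then 1 else 0) * (V + 1) + (V - 0)) ≤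
      V * (maxLabel n V * (V + 1) + V) := by
    refine (Finset.sum_le_card_nsmul _ _ (maxLabel n V * (V + 1) + V) fun a _ => ?_).trans (by simp)
    exact Nat.add_le_add (Nat.mul_le_mul_right _ (Nat.sub_le _ _)) (Nat.sub_le _ _)
  have := h1 (∑ a ∈ Finset.range V, if a < n then 1 else 0)
  omega

end PushState

/-! ## Transport problems -/

section Transport

open Classical in
/-- The initial excesses: demands below `n`, negated supplies above. -/
def initExcess (n : ℕ) (dem mass : ℕ → ℝ) (a : ℕ) : ℝ := if a < n then dem a else - mass (a - n)

open Classical in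
/-- The initial residual capacities. -/
def initCap (n : ℕ) (M : ℕ → ℕ → Prop) (tot : ℝ) (a b : ℕ) : ℝ :=
  if a < n ∧ n ≤ b ∧ M (b - n) a then tot else 0

open Classical in
/-- Supplies `mass k`, `k < m`, and demands `dem Q`, `Q < n`, that satisfy Hall's condition for the
relation `M`. -/
structure HallData (n m : ℕ) (M : ℕ → ℕ → Prop) (mass dem : ℕ → ℝ) : Prop where
  lt : ∀ k Q, M k Q → k < m ∧ Q < n
  mass_nonneg : ∀ k, 0 ≤ mass k
  dem_nonneg : ∀ Q, 0 ≤ dem Q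
  hall : ∀ p : ℕ → Prop, ∑ Q ∈ Finset.range n, (if p Q then dem Q else 0) ≤
    ∑ k ∈ Finset.range m, if ∃ Q, p Q ∧ M k Q then mass k else 0

variable {n m : ℕ} {M : ℕ → ℕ → Prop} {mass dem : ℕ → ℝ} {tot : ℝ}

/-- The total supply `tot` replaces the capacity `∞`: a single arc of this capacity that leaves `S`
already carries any excess `S` can have. If no arc leaves `S`, all suppliers of the demands in `S`
are in `S`, and Hall's condition applies. -/
theorem HallData.cutCondition (h : HallData n m M mass dem)
    (htot : tot = ∑ k ∈ Finset.range m, mass k) :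
    PushState.CutCondition (n + m) (initExcess n dem mass) (initCap n M tot) := by
  classical
  intro S hS
  have htot0 : 0 ≤ tot := htot ▸ Finset.sum_nonneg fun k _ => h.mass_nonneg k
  have hcap : ∀ a b, 0 ≤ initCap n M tot a b := by
    intro a b
    unfold initCap
    split_ifs <;> simp [htot0]
  have hlhs : ∑ a ∈ S, initExcess n dem mass a =
      ∑ Q ∈ Finset.range n, (if Q ∈ S then dem Q else 0) -
        ∑ k ∈ Finset.range m, if n + k ∈ S then mass k else 0 := by
    rw [← Finset.inter_eq_right.2 hS, ← Finset.sum_ite_mem, Finset.sum_range_add, sub_eq_add_neg,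
      ← Finset.sum_neg_distrib]
    congr 1
    · refine Finset.sum_congr rfl fun Q hQ => ?_
      have hQ := Finset.mem_range.1 hQ
      have hQ' : Q < n + m := by omega
      simp [initExcess, hQ, hQ']
    · refine Finset.sum_congr rfl fun k hk => ?_
      have hk := Finset.mem_range.1 hk
      simp only [initExcess, Finset.mem_inter, Finset.mem_range]
      split_ifs <;> simp_all
  have hhall : ∑ Q ∈ Finset.range n, (if Q ∈ S then dem Q else 0) ≤
      ∑ k ∈ Finset.range m, if ∃ Q, Q ∈ S ∧ M k Q then mass k else 0 := by
    convert h.hall fun Q => Q ∈ S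
  by_cases hex : ∃ k Q, Q ∈ S ∧ M k Q ∧ n + k ∉ S
  · obtain ⟨k, Q, hQ, hM, hk⟩ := hex
    obtain ⟨hkm, hQn⟩ := h.lt k Q hM
    have h1 : tot ≤ ∑ a ∈ S, ∑ b ∈ Finset.range (n + m) \ S, initCap n M tot a b := by
      have h2 : initCap n M tot Q (n + k) = tot := by simp [initCap, hQn, hM]
      have h3 : n + k ∈ Finset.range (n + m) \ S := by simp [hkm, hk]
      calc tot = initCap n M tot Q (n + k) := h2.symm
        _ ≤ ∑ b ∈ Finset.range (n + m) \ S, initCap n M tot Q b :=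
          Finset.single_le_sum (f := fun b => initCap n M tot Q b) (fun b _ => hcap Q b) h3
        _ ≤ _ := Finset.single_le_sum
          (f := fun a => ∑ b ∈ Finset.range (n + m) \ S, initCap n M tot a b)
          (fun a _ => Finset.sum_nonneg fun b _ => hcap a b) hQ
    refine le_trans ?_ h1
    rw [hlhs, htot]
    have h4 : ∑ k ∈ Finset.range m, (if ∃ Q, Q ∈ S ∧ M k Q then mass k else 0) ≤
        ∑ k ∈ Finset.range m, mass k := Finset.sum_le_sum fun k _ => by
      split_ifs
      · exact le_rfl
      · exact h.mass_nonneg k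
    have h5 : 0 ≤ ∑ k ∈ Finset.range m, if n + k ∈ S then mass k else 0 :=
      Finset.sum_nonneg fun k _ => by
        split_ifs
        · exact h.mass_nonneg k
        · exact le_rfl
    linarith
  · push Not at hex
    refine le_trans ?_ (Finset.sum_nonneg fun a _ => Finset.sum_nonneg fun b _ => hcap a b)
    rw [hlhs, sub_nonpos]
    refine hhall.trans (Finset.sum_le_sum fun k _ => ?_)
    split_ifs with h1 h2
    · exact le_rfl
    · obtain ⟨Q, hQ, hM⟩ := h1
      exact absurd (hex k Q hQ hM) h2
    · exact h.mass_nonneg k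
    · exact le_rfl

theorem HallData.admissible (h : HallData n m M mass dem)
    (htot : tot = ∑ k ∈ Finset.range m, mass k) :
    PushState.Admissible n (n + m) (initExcess n dem mass) (initCap n M tot) := by
  classical
  have hpos : ∀ a b, 0 < initCap n M tot a b → a < n ∧ n ≤ b ∧ M (b - n) a := by
    intro a b hab
    by_contra hcon
    rw [initCap, if_neg hcon] at hab
    exact lt_irrefl _ hab
  refine ⟨fun a b => ?_, fun a b hab => ?_, fun a b hab => ?_, fun a ha => ?_, h.cutCondition htot⟩
  · unfold initCap
    split_ifs
    · exact htot ▸ Finset.sum_nonneg fun k _ => h.mass_nonneg k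
    · exact le_rfl
  · obtain ⟨h1, h2, h3⟩ := hpos a b hab
    have := (h.lt _ _ h3).1
    omega
  · obtain ⟨h1, h2, h3⟩ := hpos a b hab
    omega
  · rw [initExcess, if_pos ha]
    exact h.dem_nonneg a

open Classical in
/-- A solution of the transport problem. -/
structure IsTransport (n m : ℕ) (M : ℕ → ℕ → Prop) (mass dem : ℕ → ℝ) (f : ℕ → ℕ → ℝ) : Prop where
  nonneg : ∀ k Q, 0 ≤ f k Q
  eq_zero : ∀ k Q, ¬ M k Q → f k Q = 0
  supply : ∀ k < m, ∑ Q ∈ Finset.range n, f k Q ≤ mass k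
  demand : ∀ Q < n, ∑ k ∈ Finset.range m, f k Q = dem Q

/-- The reverse arc from `n + k` to `Q` has initial capacity 0, so its residual capacity is the
amount sent from `Q` to `n + k`. -/
theorem HallData.isTransport (h : HallData n m M mass dem) {σ : PushState}
    (hσ : PushState.Inv n (n + m) (initExcess n dem mass) (initCap n M tot) σ)
    (hdone : σ.Done (n + m)) :
    IsTransport n m M mass dem fun k Q => if Q < n then σ.r (n + k) Q else 0 := by
  have hadd := hσ.1.r_add
  have hnn := hσ.1.r_nonneg
  have hsmall : ∀ a < n, ∀ b < n, σ.r a b = 0 := by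
    intro a ha b hb
    have := hadd a b
    simp only [initCap, not_le.2 ha, not_le.2 hb, false_and, and_false, if_false] at this
    linarith [hnn a b, hnn b a]
  have hlarge : ∀ a ≥ n, ∀ b ≥ n, σ.r a b = 0 := by
    intro a ha b hb
    have := hadd a b
    simp only [initCap, not_lt.2 ha, not_lt.2 hb, false_and, if_false] at this
    linarith [hnn a b, hnn b a]
  refine ⟨fun k Q => ?_, fun k Q hM => ?_, fun k hk => ?_, fun Q hQ => ?_⟩
  · split_ifs
    · exact hnn _ _
    · exact le_rfl
  · split_ifs with hQ
    · have := hadd (n + k) Q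
      simp only [initCap, add_tsub_cancel_left, hM, and_false, if_false, not_lt.2 (Nat.le_add_right n k),
        false_and] at this
      linarith [hnn (n + k) Q, hnn Q (n + k)]
    · rfl
  · have h1 := hσ.nonpos_of_done hdone (n + k) (by omega)
    rw [hσ.1.e_eq, Finset.sum_range_add] at h1
    simp only [initExcess, initCap, not_lt.2 (Nat.le_add_right n k), false_and, if_false,
      add_tsub_cancel_left, hlarge _ (Nat.le_add_right n k) _ (Nat.le_add_right n _)] at h1
    simp only [zero_sub, Finset.sum_neg_distrib, neg_zero, Finset.sum_const_zero] at h1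
    rw [Finset.sum_congr rfl fun Q hQ => if_pos (Finset.mem_range.1 hQ)]
    linarith
  · have h1 := hσ.nonpos_of_done hdone Q (by omega)
    -- An excess that starts nonnegative stays so; together with `h1` it is zero, and the demand is
    -- met exactly.
    have h2 := hσ.1.e_nonneg Q (by rw [initExcess, if_pos hQ]; exact h.dem_nonneg Q)
    have h3 := hσ.1.e_eq Q
    rw [le_antisymm h1 h2, initExcess, if_pos hQ, Finset.sum_range_add] at h3
    have h4 : ∑ b ∈ Finset.range n, (initCap n M tot Q b - σ.r Q b) = 0 :=
      Finset.sum_eq_zero fun b hb => by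
        have hb := Finset.mem_range.1 hb
        simp [initCap, not_le.2 hb, hsmall Q hQ b hb]
    have h5 : ∀ k, initCap n M tot Q (n + k) - σ.r Q (n + k) = σ.r (n + k) Q := by
      intro k
      have := hadd Q (n + k)
      have h6 : initCap n M tot (n + k) Q = 0 := by simp [initCap]
      linarith
    rw [h4, zero_add, Finset.sum_congr rfl fun k _ => h5 k] at h3
    simp only [hQ, if_true]
    linarith

end Transport

/-! ## The transport problem of a collection -/

section Collection

variable {Ω : Type*} {n m : ℕ} {F : Fin n → Set Ω} {P : Fin m → Finset (Fin n)}

/-- `Q` belongs to the `k`-th subcollection. -/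
def Mem (P : Fin m → Finset (Fin n)) (k Q : ℕ) : Prop :=
  ∃ (k' : Fin m) (Q' : Fin n), k = k' ∧ Q = Q' ∧ Q' ∈ P k'

@[simp]
theorem mem_val_iff {k : Fin m} {Q : Fin n} : Mem P k Q ↔ Q ∈ P k := by
  constructor
  · rintro ⟨k', Q', hk, hQ, h⟩
    rwa [Fin.ext hk, Fin.ext hQ]
  · exact fun h => ⟨k, Q, rfl, rfl, h⟩

theorem Mem.lt {k Q : ℕ} (h : Mem P k Q) : k < m ∧ Q < n := by
  obtain ⟨k', Q', rfl, rfl, -⟩ := h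
  exact ⟨k'.2, Q'.2⟩

/-- `P` lists the elements of `P₀(F)` without repetition. -/
structure Enumerates (F : Fin n → Set Ω) (P : Fin m → Finset (Fin n)) : Prop where
  injective : Function.Injective P
  mem_iff : ∀ A, A ∈ P0 F ↔ ∃ k, P k = A

theorem Enumerates.mem (h : Enumerates F P) (k : Fin m) : P k ∈ P0 F := (h.mem_iff _).2 ⟨k, rfl⟩

variable [MeasurableSpace Ω] {μ : Measure Ω} {Λ : ℝ}

/-- The measure of the `k`-th atom. -/
def mass (μ : Measure Ω) (F : Fin n → Set Ω) (P : Fin m → Finset (Fin n)) (k : ℕ) : ℝ :=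
  if h : k < m then (μ (atom F (P ⟨k, h⟩))).toReal else 0

open Classical in
/-- The demand of the set `Q`. -/
def demand (μ : Measure Ω) (F : Fin n → Set Ω) (Λ : ℝ) (P : Fin m → Finset (Fin n)) (Q : ℕ) : ℝ :=
  (∑ k ∈ Finset.range m, if Mem P k Q then mass μ F P k else 0) / Λ

theorem mass_val (k : Fin m) : mass μ F P k = (μ (atom F (P k))).toReal := by
  simp [mass]

theorem mass_nonneg (k : ℕ) : 0 ≤ mass μ F P k := by
  unfold mass
  split_ifs
  · exact ENNReal.toReal_nonneg
  · exact le_rfl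

open Classical in
theorem Enumerates.measure_biUnion (h : Enumerates F P) (hF : ∀ Q, MeasurableSet (F Q))
    (hfin : ∀ Q, μ (F Q) < ∞) (S : Finset (Fin n)) :
    (μ (⋃ Q ∈ S, F Q)).toReal =
      ∑ k ∈ Finset.range m, if ∃ Q : Fin n, Q ∈ S ∧ Mem P k Q then mass μ F P k else 0 := by
  have hP0 : P0 F = Finset.univ.map ⟨P, h.injective⟩ := by
    ext A
    simp [h.mem_iff]
  rw [measure_biUnion_eq_sum_atom hF, Finset.sum_filter, hP0, Finset.sum_map, ENNReal.toReal_sum,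
    Finset.sum_range]
  · refine Finset.sum_congr rfl fun k _ => ?_
    simp only [Function.Embedding.coeFn_mk, mem_val_iff, mass_val]
    split_ifs <;> rfl
  · intro k _
    simp only [Function.Embedding.coeFn_mk]
    split_ifs
    · exact measure_atom_ne_top hfin (h.mem k)
    · exact ENNReal.zero_ne_top

theorem Enumerates.demand_val (h : Enumerates F P) (hF : ∀ Q, MeasurableSet (F Q))
    (hfin : ∀ Q, μ (F Q) < ∞) (Q : Fin n) : demand μ F Λ P Q = (μ (F Q)).toReal / Λ := by
  have := h.measure_biUnion hF hfin {Q}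
  simp only [Finset.mem_singleton, Set.iUnion_iUnion_eq_left] at this
  rw [demand, this]
  refine congrArg (· / Λ) (Finset.sum_congr rfl fun k _ => ?_)
  by_cases hM : Mem P k Q <;> simp [hM]

open Classical in
-- The Carleson condition for `S`, divided by `Λ`: its left side becomes the demand of `S`, and `μ
-- (⋃ Q ∈ S, F Q)` is the total mass of the atoms that can serve `S`.
theorem Enumerates.hallData (h : Enumerates F P) (hF : ∀ Q, MeasurableSet (F Q))
    (hfin : ∀ Q, μ (F Q) < ∞) (hΛ : IsCarleson μ F Λ) :
    HallData n m (Mem P) (mass μ F P) (demand μ F Λ P) := by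
  have hΛ0 : 0 < Λ := by linarith [hΛ.1]
  refine ⟨fun k Q => Mem.lt, mass_nonneg, fun Q => ?_, fun p => ?_⟩
  · refine div_nonneg (Finset.sum_nonneg fun k _ => ?_) hΛ0.le
    split_ifs
    · exact mass_nonneg k
    · exact le_rfl
  · set S : Finset (Fin n) := Finset.univ.filter fun Q => p Q with hS
    have hmeas : μ (⋃ Q ∈ S, F Q) ≠ ∞ := (measure_biUnion_lt_top S.finite_toSet fun Q _ => hfin Q).ne
    have h1 := ENNReal.toReal_mono (ENNReal.mul_ne_top ENNReal.ofReal_ne_top hmeas) (hΛ.2 S)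
    rw [ENNReal.toReal_mul, ENNReal.toReal_ofReal hΛ0.le, ENNReal.toReal_sum fun Q _ => (hfin Q).ne,
      h.measure_biUnion hF hfin] at h1
    rw [Finset.sum_range]
    have h2 : ∑ Q : Fin n, (if p Q then demand μ F Λ P Q else 0) =
        (∑ Q ∈ S, (μ (F Q)).toReal) / Λ := by
      rw [Finset.sum_div, hS, Finset.sum_filter]
      refine Finset.sum_congr rfl fun Q _ => ?_
      rw [h.demand_val hF hfin]
    rw [h2, div_le_iff₀' hΛ0]
    refine h1.trans (mul_le_mul_of_nonneg_left (le_of_eq ?_) hΛ0.le)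
    refine Finset.sum_congr rfl fun k _ => ?_
    congr 1
    simp only [hS, Finset.mem_filter, Finset.mem_univ, true_and, eq_iff_iff]
    constructor
    · rintro ⟨Q, h3, h4⟩
      exact ⟨Q, h3, h4⟩
    · rintro ⟨Q, h3, h4⟩
      exact ⟨⟨Q, h4.lt.2⟩, h3, h4⟩

open Classical in
-- A transport fixes the flow on the middle edges, and conservation fixes it elsewhere. The second
-- clause of the conclusion links the values in the machine's memory to an actual maximum flow.
theorem Enumerates.exists_isSaturating (h : Enumerates F P) (hF : ∀ Q, MeasurableSet (F Q))
    (hfin : ∀ Q, μ (F Q) < ∞) (hΛ : 1 ≤ Λ) {f : ℕ → ℕ → ℝ}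
    (hf : IsTransport n m (Mem P) (mass μ F P) (demand μ F Λ P) f) :
    ∃ g : Vertex F → Vertex F → ℝ≥0, IsSaturating μ F Λ g ∧
      ∀ (k : Fin m) (Q : Fin n), g (.coll ⟨P k, h.mem k⟩) (.elt Q) = (f k Q).toNNReal := by
  choose idx hidx using fun A : {A // A ∈ P0 F} => (h.mem_iff A.1).1 A.2
  have hidx' : ∀ k, idx ⟨P k, h.mem k⟩ = k := fun k => h.injective (hidx _)
  let e : Fin m ≃ {A // A ∈ P0 F} :=
    ⟨fun k => ⟨P k, h.mem k⟩, idx, hidx', fun A => Subtype.ext (hidx A)⟩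
  have hsum : ∀ k : Fin m, ∑ Q ∈ P k, (f k Q).toNNReal = (∑ Q ∈ Finset.range n, f k Q).toNNReal := by
    intro k
    rw [Finset.sum_range, Real.toNNReal_sum_of_nonneg fun Q _ => hf.nonneg _ _]
    refine Finset.sum_subset (Finset.subset_univ _) fun Q _ hQ => ?_
    rw [hf.eq_zero _ _ (by rwa [mem_val_iff]), Real.toNNReal_zero]
  let g : Vertex F → Vertex F → ℝ≥0 := fun u v => match u, v with
    | .source, .coll A => ∑ Q ∈ A.1, (f (idx A) Q).toNNReal
    | .coll A, .elt Q => (f (idx A) Q).toNNReal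
    | .elt Q, .sink => (demand μ F Λ P Q).toNNReal
    | _, _ => 0
  have hdem : ∀ Q : Fin n, ((demand μ F Λ P Q).toNNReal : ℝ≥0∞) =
      ENNReal.ofReal Λ⁻¹ * μ (F Q) := by
    intro Q
    rw [h.demand_val hF hfin, div_eq_inv_mul]
    change ENNReal.ofReal _ = _
    rw [ENNReal.ofReal_mul (by positivity), ENNReal.ofReal_toReal (hfin Q).ne]
  refine ⟨g, ⟨network_isFlow_iff.2 ⟨fun A => rfl, fun Q => ?_, fun A => ?_, fun Q => ?_⟩, hdem⟩,
    fun k Q => ?_⟩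
  · change _ = (demand μ F Λ P Q).toNNReal
    rw [← e.sum_comp, ← hf.demand Q Q.2, Finset.sum_range,
      Real.toNNReal_sum_of_nonneg fun k _ => hf.nonneg _ _]
    refine Finset.sum_congr rfl fun k _ => ?_
    split_ifs with hQ
    · change (f (idx ⟨P k, h.mem k⟩) Q).toNNReal = _
      rw [hidx']
    · rw [hf.eq_zero _ _ (by rwa [mem_val_iff]), Real.toNNReal_zero]
  · obtain ⟨k, rfl⟩ := e.surjective A
    change ((∑ Q ∈ P k, (f (idx ⟨P k, h.mem k⟩) Q).toNNReal : ℝ≥0) : ℝ≥0∞) ≤ μ (atom F (P k))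
    rw [hidx', hsum]
    change ENNReal.ofReal _ ≤ _
    rw [ENNReal.ofReal_le_iff_le_toReal (measure_atom_ne_top hfin (h.mem k)), ← mass_val]
    exact hf.supply k k.2
  · exact (hdem Q).le
  · change (f (idx ⟨P k, h.mem k⟩) Q).toNNReal = _
    rw [hidx']

theorem exists_isSaturating (hF : ∀ Q, MeasurableSet (F Q)) (hfin : ∀ Q, μ (F Q) < ∞)
    (hΛ : IsCarleson μ F Λ) : ∃ g : Vertex F → Vertex F → ℝ≥0, IsSaturating μ F Λ g := by
  let e := (P0 F).equivFin.symm
  have hP : Enumerates F fun k => (e k).1 :=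
    ⟨Subtype.val_injective.comp e.injective, fun A =>
      ⟨fun hA => ⟨e.symm ⟨A, hA⟩, by simp⟩, by rintro ⟨k, rfl⟩; exact (e k).2⟩⟩
  have hhall := hP.hallData hF hfin hΛ
  obtain ⟨σ, hσ, hdone⟩ := (hhall.admissible rfl).exists_done
  obtain ⟨g, hg, -⟩ := hP.exists_isSaturating hF hfin hΛ.1 (hhall.isTransport hσ hdone)
  exact ⟨g, hg⟩

end Collection

/-! ## Reasoning about programs -/

section Logic

variable {Ω : Type*} {n : ℕ}

@[simp]
theorem write_of_ne {α : Type*} {M : ℕ → ℕ → ℕ → α} {a b i j : ℕ} {x : α} (h : b ≠ a) :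
    write M a i j x b = M b := by
  funext i' j'
  simp [write, h]

theorem write_self_apply {α : Type*} {M : ℕ → ℕ → ℕ → α} {a i j i' j' : ℕ} {x : α} :
    write M a i j x a i' j' = if i' = i ∧ j' = j then x else M a i' j' := by
  simp [write]

open Classical in
/-- The effect of a program without loops. -/
def Prog.run (O : Oracles Ω n) : Prog → Store Ω → Store Ω
  | .skip, s => s
  | .setNat a i j x, s => { s with nat := write s.nat a (i.eval s) (j.eval s) (x.eval s) }
  | .setReal a i j x, s => { s with real := write s.real a (i.eval s) (j.eval s) (x.eval s) }
  | .setSet a i j x, s => { s with set := write s.set a (i.eval s) (j.eval s) (x.eval s) }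
  | .callUnion a i j q r, s =>
    { s with
      real := write s.real a (i.eval s) (j.eval s) (O.union (ofIndicator n (s.nat q (r.eval s)))) }
  | .callSplit a i j E x, s =>
    { s with set := write s.set a (i.eval s) (j.eval s) (O.split (E.eval s) (x.eval s)) }
  | .seq p q, s => q.run O (p.run O s)
  | .ite b p q, s => if b.eval s then p.run O s else q.run O s
  | .while _ _, s => s

/-- A bound for the time of a program without loops. -/
def Prog.cost (O : Oracles Ω n) : Prog → ℕ
  | .skip => 1
  | .setNat _ i j x => i.time + j.time + x.time + 1
  | .setReal _ i j x => i.time + j.time + x.time + 1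
  | .setSet _ i j x => i.time + j.time + x.time + 1
  | .callUnion _ i j _ r => i.time + j.time + r.time + 1 + O.EO₁
  | .callSplit _ i j E x => i.time + j.time + E.time + x.time + 1 + O.EO₂
  | .seq p q => p.cost O + q.cost O
  | .ite b p q => b.time + 1 + (p.cost O + q.cost O)
  | .while _ _ => 0

/-- Programs without loops. -/
def Prog.loopFree : Prog → Bool
  | .seq p q => p.loopFree && q.loopFree
  | .ite _ p q => p.loopFree && q.loopFree
  | .while _ _ => false
  | _ => true

theorem Prog.exec_run (O : Oracles Ω n) (p : Prog) (hp : p.loopFree = true) (s : Store Ω) :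
    ∃ T ≤ p.cost O, Exec O p s (p.run O s) T := by
  classical
  induction p generalizing s with
  | skip => exact ⟨_, le_rfl, .skip s⟩
  | setNat a i j x => exact ⟨_, le_rfl, .setNat s a i j x⟩
  | setReal a i j x => exact ⟨_, le_rfl, .setReal s a i j x⟩
  | setSet a i j x => exact ⟨_, le_rfl, .setSet s a i j x⟩
  | callUnion a i j q r => exact ⟨_, le_rfl, .callUnion s a i j q r⟩
  | callSplit a i j E x => exact ⟨_, le_rfl, .callSplit s a i j E x⟩
  | seq p q ihp ihq =>
    simp only [Prog.loopFree, Bool.and_eq_true] at hp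
    obtain ⟨T, hT, h⟩ := ihp hp.1 s
    obtain ⟨T', hT', h'⟩ := ihq hp.2 (p.run O s)
    exact ⟨_, add_le_add hT hT', h.seq h'⟩
  | ite b p q ihp ihq =>
    simp only [Prog.loopFree, Bool.and_eq_true] at hp
    by_cases hb : b.eval s
    · obtain ⟨T, hT, h⟩ := ihp hp.1 s
      refine ⟨b.time + 1 + T, ?_, ?_⟩
      · simp only [Prog.cost]; omega
      · rw [Prog.run, if_pos hb]; exact .iteTrue hb h
    · obtain ⟨T, hT, h⟩ := ihq hp.2 s
      refine ⟨b.time + 1 + T, ?_, ?_⟩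
      · simp only [Prog.cost]; omega
      · rw [Prog.run, if_neg hb]; exact .iteFalse hb h
  | _ => simp [Prog.loopFree] at hp

/-- Whether a program writes to the array `a` of natural numbers. -/
def Prog.writesNat : Prog → ℕ → Bool
  | .setNat b _ _ _, a => b == a
  | .seq p q, a => p.writesNat a || q.writesNat a
  | .ite _ p q, a => p.writesNat a || q.writesNat a
  | .while _ p, a => p.writesNat a
  | _, _ => false

/-- Whether a program writes to the array `a` of real numbers. -/
def Prog.writesReal : Prog → ℕ → Bool
  | .setReal b _ _ _, a => b == a
  | .callUnion b _ _ _ _, a => b == a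
  | .seq p q, a => p.writesReal a || q.writesReal a
  | .ite _ p q, a => p.writesReal a || q.writesReal a
  | .while _ p, a => p.writesReal a
  | _, _ => false

/-- Whether a program writes to the array `a` of sets. -/
def Prog.writesSet : Prog → ℕ → Bool
  | .setSet b _ _ _, a => b == a
  | .callSplit b _ _ _ _, a => b == a
  | .seq p q, a => p.writesSet a || q.writesSet a
  | .ite _ p q, a => p.writesSet a || q.writesSet a
  | .while _ p, a => p.writesSet a
  | _, _ => false

/-- The arrays that `p` does not write to are the same in `s` and `s'`. -/
structure Frame (p : Prog) (s s' : Store Ω) : Prop where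
  nat : ∀ a, p.writesNat a = false → s'.nat a = s.nat a
  real : ∀ a, p.writesReal a = false → s'.real a = s.real a
  set : ∀ a, p.writesSet a = false → s'.set a = s.set a

theorem Frame.refl (p : Prog) (s : Store Ω) : Frame p s s :=
  ⟨fun _ _ => rfl, fun _ _ => rfl, fun _ _ => rfl⟩

theorem Frame.trans {p : Prog} {s s' s'' : Store Ω} (h : Frame p s s') (h' : Frame p s' s'') :
    Frame p s s'' :=
  ⟨fun a ha => (h'.nat a ha).trans (h.nat a ha), fun a ha => (h'.real a ha).trans (h.real a ha),
    fun a ha => (h'.set a ha).trans (h.set a ha)⟩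

theorem Frame.mono {p q : Prog} {s s' : Store Ω} (h : Frame p s s')
    (hn : ∀ a, q.writesNat a = false → p.writesNat a = false)
    (hr : ∀ a, q.writesReal a = false → p.writesReal a = false)
    (hs : ∀ a, q.writesSet a = false → p.writesSet a = false) : Frame q s s' :=
  ⟨fun a ha => h.nat a (hn a ha), fun a ha => h.real a (hr a ha), fun a ha => h.set a (hs a ha)⟩

/-- For a concrete program and array the side conditions of `Frame` hold by `rfl`, so untouched data
can be carried past whole program parts. -/
theorem Exec.frame {O : Oracles Ω n} {p : Prog} {s s' : Store Ω} {T : ℕ} (h : Exec O p s s' T) :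
    Frame p s s' := by
  induction h with
  | skip s => exact .refl _ _
  | setNat s a i j x =>
    refine ⟨fun b hb => write_of_ne ?_, fun _ _ => rfl, fun _ _ => rfl⟩
    rintro rfl; simp [Prog.writesNat] at hb
  | setReal s a i j x =>
    refine ⟨fun _ _ => rfl, fun b hb => write_of_ne ?_, fun _ _ => rfl⟩
    rintro rfl; simp [Prog.writesReal] at hb
  | setSet s a i j x =>
    refine ⟨fun _ _ => rfl, fun _ _ => rfl, fun b hb => write_of_ne ?_⟩
    rintro rfl; simp [Prog.writesSet] at hb
  | callUnion s a i j q r =>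
    refine ⟨fun _ _ => rfl, fun b hb => write_of_ne ?_, fun _ _ => rfl⟩
    rintro rfl; simp [Prog.writesReal] at hb
  | callSplit s a i j E x =>
    refine ⟨fun _ _ => rfl, fun _ _ => rfl, fun b hb => write_of_ne ?_⟩
    rintro rfl; simp [Prog.writesSet] at hb
  | seq _ _ ihp ihq =>
    refine (ihp.mono ?_ ?_ ?_).trans (ihq.mono ?_ ?_ ?_) <;>
      simp +contextual [Prog.writesNat, Prog.writesReal, Prog.writesSet]
  | iteTrue _ _ ih =>
    refine ih.mono ?_ ?_ ?_ <;> simp +contextual [Prog.writesNat, Prog.writesReal, Prog.writesSet]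
  | iteFalse _ _ ih =>
    refine ih.mono ?_ ?_ ?_ <;> simp +contextual [Prog.writesNat, Prog.writesReal, Prog.writesSet]
  | whileTrue _ _ _ ih ih' =>
    refine (ih.mono ?_ ?_ ?_).trans ih' <;>
      simp +contextual [Prog.writesNat, Prog.writesReal, Prog.writesSet]
  | whileFalse => exact .refl _ _

/-- `p`, started in `s`, halts within time `t` in a state that satisfies `Φ`. -/
def Run (O : Oracles Ω n) (p : Prog) (s : Store Ω) (t : ℕ) (Φ : Store Ω → Prop) : Prop :=
  ∃ s' T, Exec O p s s' T ∧ T ≤ t ∧ Φ s'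

variable {O : Oracles Ω n} {p q : Prog} {s : Store Ω} {t t' : ℕ} {Φ Ψ : Store Ω → Prop}

theorem Run.mono (h : Run O p s t Φ) (ht : t ≤ t') (hΦ : ∀ s', Frame p s s' → Φ s' → Ψ s') :
    Run O p s t' Ψ := by
  obtain ⟨s', T, h1, h2, h3⟩ := h
  exact ⟨s', T, h1, h2.trans ht, hΦ s' h1.frame h3⟩

theorem Run.seq (h : Run O p s t fun s' => Run O q s' t' Φ) : Run O (.seq p q) s (t + t') Φ := by
  obtain ⟨s', T, h1, h2, s'', T', h3, h4, h5⟩ := h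
  exact ⟨s'', _, h1.seq h3, add_le_add h2 h4, h5⟩

theorem Run.of_loopFree (hp : p.loopFree = true) (h : Φ (p.run O s)) : Run O p s (p.cost O) Φ := by
  obtain ⟨T, hT, hexec⟩ := p.exec_run O hp s
  exact ⟨_, T, hexec, hT, h⟩

theorem Run.seq_left (hp : p.loopFree = true) (h : Run O q (p.run O s) t Φ) :
    Run O (.seq p q) s (p.cost O + t) Φ :=
  Run.seq (Run.of_loopFree hp h)

theorem Run.seq_right (hq : q.loopFree = true) (h : Run O p s t fun s' => Φ (q.run O s')) :
    Run O (.seq p q) s (t + q.cost O) Φ :=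
  Run.seq (h.mono le_rfl fun _ _ h' => Run.of_loopFree hq h')

/-- The index of the invariant is a variant that decreases strictly, hence a bound for the number of
rounds. -/
theorem Run.whileLoop {b : BExp} (I : ℕ → Store Ω → Prop) {t : ℕ}
    (hstep : ∀ k s, I k s → b.eval s → Run O p s t fun s' => ∃ k' < k, I k' s') {k : ℕ}
    (h : I k s) :
    Run O (.while b p) s (k * (b.time + 1 + t) + (b.time + 1)) fun s' =>
      (∃ k', I k' s') ∧ ¬ b.eval s' := by
  classical
  induction k using Nat.strong_induction_on generalizing s with
  | _ k ih =>
    by_cases hb : b.eval s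
    · obtain ⟨s', T, h1, h2, k', hk', h3⟩ := hstep k s h hb
      obtain ⟨s'', T', h4, h5, h6⟩ := ih k' hk' h3
      refine ⟨s'', _, .whileTrue hb h1 h4, ?_, h6⟩
      have : (k' + 1) * (b.time + 1 + t) ≤ k * (b.time + 1 + t) := Nat.mul_le_mul_right _ hk'
      rw [add_mul, one_mul] at this
      omega
    · exact ⟨s, _, .whileFalse hb, Nat.le_add_left _ _, ⟨k, h⟩, hb⟩

/-- The loop counter `c`. -/
abbrev ctr (c : ℕ) : NExp := .get c (.lit 0) (.lit 0)

/-- The loop `for c = 0, 1, …, N - 1`, where `N` is in the cell `(0, j)` of array 0. -/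
def forLoop (c j : ℕ) (body : Prog) : Prog :=
  .seq (.setNat c (.lit 0) (.lit 0) (.lit 0))
    (.while (.not (.natLe (.get 0 (.lit 0) (.lit j)) (ctr c)))
      (.seq body (.setNat c (.lit 0) (.lit 0) (.add (ctr c) (.lit 1)))))

/-- The state with the counter `c` changed. -/
def Store.setCtr (s : Store Ω) (c x : ℕ) : Store Ω := { s with nat := write s.nat c 0 0 x }

/-- A round costs 9 for the test and 8 for the increment besides the body, whence 17. The
initialisation costs 4 and the last, failing test 9, whence 13. -/
theorem Run.forLoop {c j N : ℕ} {body : Prog} (I : ℕ → Store Ω → Prop)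
    (hN : s.nat 0 0 j = N) (hw : (body.writesNat c || body.writesNat 0 || c == 0) = false)
    (hctr : ∀ i s x, I i s → I i (s.setCtr c x)) (h0 : I 0 s)
    (hstep : ∀ i < N, ∀ s', Frame (CarlesonSparse.forLoop c j body) s s' → I i s' →
      s'.nat c 0 0 = i → Run O body s' t fun s'' => I (i + 1) s'') :
    Run O (CarlesonSparse.forLoop c j body) s (N * (t + 17) + 13) (I N) := by
  simp only [Bool.or_eq_false_iff, beq_eq_false_iff_ne] at hw
  obtain ⟨⟨hwc, hw0⟩, hc0⟩ := hw
  set b : BExp := .not (.natLe (.get 0 (.lit 0) (.lit j)) (ctr c)) with hb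
  set inc : Prog := .setNat c (.lit 0) (.lit 0) (.add (ctr c) (.lit 1)) with hinc
  have hfr : ∀ s₁ s₂ : Store Ω, Frame (.seq body inc) s₁ s₂ →
      Frame (CarlesonSparse.forLoop c j body) s₁ s₂ := by
    intro s₁ s₂ h
    refine h.mono ?_ ?_ ?_ <;>
      simp +contextual [CarlesonSparse.forLoop, Prog.writesNat, Prog.writesReal, Prog.writesSet,
        hinc]
  -- The variant `k` is the number of rounds left.
  let J : ℕ → Store Ω → Prop := fun k s' => ∃ i, k + i = N ∧ I i s' ∧ s'.nat c 0 0 = i ∧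
    Frame (CarlesonSparse.forLoop c j body) s s'
  have hN' : ∀ s', Frame (CarlesonSparse.forLoop c j body) s s' → s'.nat 0 0 j = N := by
    intro s' h
    rw [h.nat 0, hN]
    simp [CarlesonSparse.forLoop, Prog.writesNat, hw0, hc0]
  have hw : Run O (.while b (.seq body inc)) (s.setCtr c 0) (N * (t + 17) + 9) (I N) := by
    have := Run.whileLoop (O := O) (b := b) (p := .seq body inc) (t := t + 8) J ?_ (k := N)
      (s := s.setCtr c 0) ?_
    · refine this.mono ?_ ?_
      · simp only [hb, BExp.time, NExp.time]
        exact le_of_eq (by ring)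
      · rintro s' - ⟨⟨k, i, hk, hI, hi, hs'⟩, hbs⟩
        simp only [hb, BExp.eval, NExp.eval, hN' s' hs', hi, not_not] at hbs
        have : i = N := by omega
        exact this ▸ hI
    · rintro k s' ⟨i, hk, hI, hi, hs'⟩ hbs
      simp only [hb, BExp.eval, NExp.eval, hN' s' hs', hi, not_le] at hbs
      refine Run.seq (t := t) (t' := 8) ((hstep i hbs s' hs' hI hi).mono le_rfl ?_)
      intro s'' hf hI'
      refine (Run.of_loopFree (O := O) rfl ?_).mono (t := inc.cost O) (Φ := fun s''' =>
        s''' = s''.setCtr c (i + 1)) le_rfl ?_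
      · simp only [hinc, Prog.run, NExp.eval, Store.setCtr]
        rw [hf.nat c hwc, hi]
      · rintro s''' hf' rfl
        refine ⟨k - 1, by omega, i + 1, by omega, hctr _ _ _ hI', by simp [Store.setCtr, write], ?_⟩
        refine (hs'.trans (hfr _ _ ((hf.mono ?_ ?_ ?_).trans (hf'.mono ?_ ?_ ?_)))) <;>
          simp +contextual [Prog.writesNat, Prog.writesReal, Prog.writesSet]
    · refine ⟨0, rfl, hctr _ _ _ h0, by simp [Store.setCtr, write], ?_⟩
      refine ⟨fun a ha => ?_, fun _ _ => rfl, fun _ _ => rfl⟩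
      refine write_of_ne ?_
      rintro rfl
      simp [CarlesonSparse.forLoop, Prog.writesNat] at ha
  refine (Run.seq (t := 4) (t' := N * (t + 17) + 9)
    ((Run.of_loopFree (O := O) (s := s) (p := .setNat c (.lit 0) (.lit 0) (.lit 0))
      (Φ := fun s' => s' = s.setCtr c 0) rfl rfl).mono le_rfl ?_)).mono (by omega) fun _ _ h => h
  rintro s' - rfl
  exact hw

end Logic

attribute [local simp] Prog.run NExp.eval RExp.eval SExp.eval BExp.eval write_self_apply
  Prog.cost NExp.time RExp.time SExp.time BExp.time

/-! ## The program: atoms and their measures -/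

section Preparation

variable {Ω : Type*} {n m : ℕ} {F : Fin n → Set Ω} {P : Fin m → Finset (Fin n)} {Λ : ℝ}

open Classical in
/-- The input is still in memory. -/
structure HasInput (F : Fin n → Set Ω) (Λ : ℝ) (P : Fin m → Finset (Fin n)) (s : Store Ω) :
    Prop where
  n_eq : s.nat 0 0 0 = n
  m_eq : s.nat 0 0 1 = m
  ind : ∀ k Q, s.nat 1 k Q = if Mem P k Q then 1 else 0
  lam : s.real 0 0 0 = Λ
  sets : ∀ Q : Fin n, s.set 0 0 Q = F Q

theorem hasInput_input : HasInput F Λ P (input F Λ P) := by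
  classical
  refine ⟨by simp [input], by simp [input], fun k Q => ?_, by simp [input], fun Q => by simp [input]⟩
  simp only [input, Mem]
  simp

theorem HasInput.ind_pos {s : Store Ω} (h : HasInput F Λ P s) {k Q : ℕ} (hM : Mem P k Q) :
    s.nat 1 k Q = 1 := by
  rw [h.ind, if_pos hM]

theorem HasInput.ind_neg {s : Store Ω} (h : HasInput F Λ P s) {k Q : ℕ} (hM : ¬ Mem P k Q) :
    s.nat 1 k Q = 0 := by
  rw [h.ind, if_neg hM]

theorem HasInput.frame {p : Prog} {s s' : Store Ω} (h : HasInput F Λ P s) (hf : Frame p s s')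
    (hp : (p.writesNat 0 || p.writesNat 1 || p.writesReal 0 || p.writesSet 0) = false) :
    HasInput F Λ P s' := by
  simp only [Bool.or_eq_false_iff] at hp
  obtain ⟨h1, h2, h3, h4, h5⟩ := h
  constructor
  · rwa [hf.nat 0 hp.1.1.1]
  · rwa [hf.nat 0 hp.1.1.1]
  · rwa [hf.nat 1 hp.1.1.2]
  · rwa [hf.real 0 hp.1.2]
  · rwa [hf.set 0 hp.2]

/-- Form the union of the collection and the indicator vector of the whole collection. -/
def initUnion : Prog :=
  forLoop 20 0 (.seq (.setNat 3 (.lit 0) (ctr 20) (.lit 1))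
    (.setSet 3 (.lit 0) (.lit 0) (.union (.get 3 (.lit 0) (.lit 0)) (.get 0 (.lit 0) (ctr 20)))))

variable {O : Oracles Ω n} {s : Store Ω}

theorem run_initUnion (hs : HasInput F Λ P s) (h0 : s.set 3 0 0 = ∅) :
    Run O initUnion s (50 * n + 13) fun s' =>
      (∀ Q < n, s'.nat 3 0 Q = 1) ∧ s'.set 3 0 0 = ⋃ Q, F Q := by
  refine (Run.forLoop (t := 30) (fun i s' => (∀ Q < i, s'.nat 3 0 Q = 1) ∧
    s'.set 3 0 0 = {x | ∃ Q : Fin n, (Q : ℕ) < i ∧ x ∈ F Q}) hs.n_eq rfl ?_ ?_ ?_).mono ?_ ?_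
  · exact fun i s x h => h
  · simp [h0]
  · rintro i hi s' hf ⟨h1, h2⟩ hc
    refine (Run.of_loopFree rfl ?_).mono (by simp) fun _ _ h => h
    have hF := (hs.frame hf rfl).sets ⟨i, hi⟩
    simp only at hF
    simp [hc, h2, hF]
    refine ⟨fun Q h3 h4 => h1 Q (by omega), ?_⟩
    ext x
    simp only [Set.mem_union, Set.mem_ofPred_eq]
    constructor
    · rintro (⟨Q, hQ, hx⟩ | hx)
      · exact ⟨Q, hQ.le, hx⟩
      · exact ⟨⟨i, hi⟩, le_rfl, hx⟩
    · rintro ⟨Q, hQ, hx⟩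
      rcases hQ.lt_or_eq with hQ | rfl
      · exact Or.inl ⟨Q, hQ, hx⟩
      · exact Or.inr hx
  · omega
  · rintro s' - ⟨h1, h2⟩
    refine ⟨h1, ?_⟩
    rw [h2]
    ext x
    simp


/-- The measure of the union of the complementary subcollection. -/
def coMeasure [MeasurableSpace Ω] (μ : Measure Ω) (F : Fin n → Set Ω) (A : Finset (Fin n)) : ℝ :=
  (μ (⋃ Q ∈ Aᶜ, F Q)).toReal

/-- Form the atoms, and ask for the measures of the unions of the complementary subcollections. -/
def formAtoms : Prog :=
  forLoop 20 1 (.seq (.setSet 2 (.lit 0) (ctr 20) (.get 3 (.lit 0) (.lit 0)))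
    (.seq
      (forLoop 21 0
        (.seq (.setNat 2 (ctr 20) (ctr 21) (.sub (.lit 1) (.get 1 (ctr 20) (ctr 21))))
          (.ite (.natLe (.lit 1) (.get 1 (ctr 20) (ctr 21)))
            (.setSet 2 (.lit 0) (ctr 20)
              (.inter (.get 2 (.lit 0) (ctr 20)) (.get 0 (.lit 0) (ctr 21))))
            (.setSet 2 (.lit 0) (ctr 20)
              (.diff (.get 2 (.lit 0) (ctr 20)) (.get 0 (.lit 0) (ctr 21)))))))
      (.callUnion 1 (.lit 0) (ctr 20) 2 (ctr 20))))

/-- No set expression denotes `Ω`, so the intersections start from the union of the collection. Row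
`k` of array 2 collects the indicator vector of the complement of `P k` for the oracle call. -/
theorem run_formAtoms [MeasurableSpace Ω] {μ : Measure Ω} (hP : Enumerates F P)
    (hO : O.Correct μ F) (hs : HasInput F Λ P s) (hU : s.set 3 0 0 = ⋃ Q, F Q) :
    Run O formAtoms s (m * (117 * n + 100 + O.EO₁) + 13) fun s' =>
      (∀ k : Fin m, s'.real 1 0 k = coMeasure μ F (P k)) ∧
      ∀ k : Fin m, s'.set 2 0 k = atom F (P k) := by
  refine (Run.forLoop (t := 117 * n + 83 + O.EO₁) (fun i s' =>
    (∀ k : Fin m, (k : ℕ) < i → s'.real 1 0 k = coMeasure μ F (P k)) ∧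
      ∀ k : Fin m, (k : ℕ) < i → s'.set 2 0 k = atom F (P k)) hs.m_eq rfl ?_ ?_ ?_).mono ?_ ?_
  · exact fun i s x h => h
  · simp
  · rintro i hi s' hf ⟨h1, h2⟩ hc
    have hs' := hs.frame hf rfl
    have hU' : s'.set 3 0 0 = ⋃ Q, F Q := by rw [hf.set 3 rfl, hU]
    refine (Run.seq_left rfl (Run.seq_right rfl ((Run.forLoop (t := 100) (fun q s'' =>
      (∀ Q < q, s''.nat 2 i Q ≠ 0 ↔ ¬ Mem P i Q) ∧
      s''.set 2 0 i = {x | (x ∈ ⋃ Q, F Q) ∧ ∀ Q : Fin n, (Q : ℕ) < q → (x ∈ F Q ↔ Mem P i Q)} ∧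
      ∀ k : Fin m, (k : ℕ) < i → s''.set 2 0 k = atom F (P k)) (N := n) ?_ rfl ?_ ?_ ?_).mono
        le_rfl ?_))).mono ?_ fun _ _ h => h
    · exact hs'.n_eq
    · exact fun i s x h => h
    · refine ⟨by simp, by simp [hc, hU']; ext x; simp, fun k hk => ?_⟩
      simp [hc, hk.ne, h2 k hk]
    · rintro q hq s'' hf' ⟨h3, h4, h5⟩ hc'
      refine (Run.of_loopFree rfl ?_).mono (by simp) fun _ _ h => h
      have hc2 : s''.nat 20 0 0 = i := by rw [hf'.nat 20 rfl]; exact hc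
      have hF : s''.set 0 0 q = F ⟨q, hq⟩ := by
        rw [hf'.set 0 rfl]; exact hs'.sets ⟨q, hq⟩
      have hind : s''.nat 1 i q = s'.nat 1 i q := by rw [hf'.nat 1 rfl]; rfl
      by_cases hM : Mem P i q
      · simp [hc2, hc', hind, hs'.ind_pos hM, h4, hF]
        refine ⟨fun Q h6 => ?_, ?_, fun k hk => ?_⟩
        · rcases h6.lt_or_eq with h7 | rfl
          · simpa [h7.ne] using h3 Q h7
          · simp [hM]
        · ext x
          simp only [Set.mem_inter_iff, Set.mem_ofPred_eq]
          constructor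
          · rintro ⟨⟨h6, h7⟩, h8⟩
            refine ⟨h6, fun Q hQ => ?_⟩
            rcases hQ.lt_or_eq with hQ | hQ
            · exact h7 Q hQ
            · subst hQ; exact iff_of_true h8 hM
          · rintro ⟨h6, h7⟩
            exact ⟨⟨h6, fun Q hQ => h7 Q hQ.le⟩, (h7 ⟨q, hq⟩ le_rfl).2 hM⟩
        · rw [if_neg hk.ne, h5 k hk]
      · simp [hc2, hc', hind, hs'.ind_neg hM, h4, hF]
        refine ⟨fun Q h6 => ?_, ?_, fun k hk => ?_⟩
        · split_ifs with h7
          · simp [h7, hM]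
          · simpa using h3 Q (by omega)
        · ext x
          simp only [Set.mem_sdiff, Set.mem_ofPred_eq]
          constructor
          · rintro ⟨⟨h6, h7⟩, h8⟩
            refine ⟨h6, fun Q hQ => ?_⟩
            rcases hQ.lt_or_eq with hQ | hQ
            · exact h7 Q hQ
            · subst hQ; exact iff_of_false h8 hM
          · rintro ⟨h6, h7⟩
            exact ⟨⟨h6, fun Q hQ => h7 Q hQ.le⟩, fun h => hM ((h7 ⟨q, hq⟩ le_rfl).1 h)⟩
        · rw [if_neg hk.ne, h5 k hk]
    · rintro s'' hf' ⟨h3, h4, h5⟩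
      have hc2 : s''.nat 20 0 0 = i := by rw [hf'.nat 20 rfl]; exact hc
      have hr : ∀ k, s''.real 1 0 k = s'.real 1 0 k := by intro k; rw [hf'.real 1 rfl]; rfl
      simp [hc2]
      refine ⟨fun k hk => ?_, fun k hk => ?_⟩
      · split_ifs with h6
        · subst h6
          have : ofIndicator n (s''.nat 2 k) = (P k)ᶜ := by
            ext Q
            simp only [ofIndicator, Finset.mem_filter, Finset.mem_univ, true_and,
              Finset.mem_compl, h3 Q Q.2, mem_val_iff]
          rw [hO.union, this, coMeasure]
        · rw [hr]
          exact h1 k (by omega)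
      · rcases hk.lt_or_eq with hk | hk
        · exact h5 k hk
        · subst hk
          rw [h4]
          ext x
          simp only [Fin.is_lt, forall_const, mem_val_iff, mem_atom_iff, Set.mem_ofPred_eq,
            Set.mem_iUnion]
          refine ⟨fun h => h.2, fun h => ⟨?_, h⟩⟩
          -- Starting from the union loses nothing, because `P k` is nonempty.
          obtain ⟨Q, hQ⟩ := (mem_P0.1 (hP.mem k)).1
          exact ⟨Q, (h Q).2 hQ⟩
    · simp
      omega
  · exact le_of_eq (by ring)
  · rintro s' - ⟨h1, h2⟩
    exact ⟨fun k => h1 k k.2, fun k => h2 k k.2⟩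

/-- Proper inclusion between the listed subcollections. -/
def Below (P : Fin m → Finset (Fin n)) (j k : ℕ) : Prop :=
  j ≠ k ∧ ∀ Q, Mem P j Q → Mem P k Q

/-- Compute the matrix of proper inclusion; zeros stand for true. -/
def compareAll : Prog :=
  forLoop 20 1 (forLoop 21 1
    (.seq
      (.ite (.and (.natLe (ctr 20) (ctr 21)) (.natLe (ctr 21) (ctr 20)))
        (.setNat 4 (ctr 20) (ctr 21) (.lit 1)) (.setNat 4 (ctr 20) (ctr 21) (.lit 0)))
      (forLoop 22 0
        (.setNat 4 (ctr 20) (ctr 21) (.add (.get 4 (ctr 20) (ctr 21))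
          (.sub (.get 1 (ctr 20) (ctr 22)) (.get 1 (ctr 21) (ctr 22))))))))

/-- Truncated subtraction of indicators is 1 exactly at the `Q` in `P j` but not in `P k`. The entry
counts these, starting from 1 on the diagonal, so it vanishes exactly for proper inclusion. -/
theorem run_compareAll (hs : HasInput F Λ P s) :
    Run O compareAll s (m * (m * (117 * n + 130) + 30) + 13) fun s' =>
      ∀ j < m, ∀ k < m, s'.nat 4 j k = 0 ↔ Below P j k := by
  refine (Run.forLoop (t := m * (117 * n + 130) + 13) (fun i s' =>
    ∀ j < i, ∀ k < m, s'.nat 4 j k = 0 ↔ Below P j k) hs.m_eq rfl ?_ ?_ ?_).mono ?_ ?_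
  · exact fun i s x h => h
  · simp
  · rintro i hi s' hf h1 hc
    have hs' := hs.frame hf rfl
    refine (Run.forLoop (t := 117 * n + 113) (fun l s'' =>
      (∀ j < i, ∀ k < m, s''.nat 4 j k = 0 ↔ Below P j k) ∧
      ∀ k < l, s''.nat 4 i k = 0 ↔ Below P i k) hs'.m_eq rfl ?_ ?_ ?_).mono ?_ ?_
    · exact fun i s x h => h
    · exact ⟨h1, by simp⟩
    · rintro l hl s₂ hf₂ ⟨h2, h3⟩ hc₂
      have hs₂ := hs'.frame hf₂ rfl
      have hc₁ : s₂.nat 20 0 0 = i := by rw [hf₂.nat 20 rfl, hc]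
      refine (Run.seq_left rfl ((Run.forLoop (t := 100) (fun q s₃ =>
        (∀ j < i, ∀ k < m, s₃.nat 4 j k = 0 ↔ Below P j k) ∧
        (∀ k < l, s₃.nat 4 i k = 0 ↔ Below P i k) ∧
        (s₃.nat 4 i l = 0 ↔ i ≠ l ∧ ∀ Q < q, Mem P i Q → Mem P l Q)) (N := n) ?_ rfl ?_ ?_ ?_).mono
          le_rfl (Ψ := fun s₃ => (∀ j < i, ∀ k < m, s₃.nat 4 j k = 0 ↔ Below P j k) ∧
            ∀ k < l + 1, s₃.nat 4 i k = 0 ↔ Below P i k) ?_)).mono ?_ fun _ _ h => h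
      · rw [Prog.run]
        split_ifs <;> simp [hs₂.n_eq]
      · exact fun i s x h => h
      · by_cases h : i = l
        · subst h
          simp [hc₁, hc₂]
          refine ⟨fun j hj k hk => ?_, fun k hk => ?_⟩
          · simp [hj.ne, h2 j hj k hk]
          · simp [hk.ne, h3 k hk]
        · have h' : ¬ (i ≤ l ∧ l ≤ i) := by omega
          simp [hc₁, hc₂, h', h]
          refine ⟨fun j hj k hk => ?_, fun k hk => ?_⟩
          · simp [hj.ne, h2 j hj k hk]
          · simp [hk.ne, h3 k hk]
      · rintro q hq s₃ hf₃ ⟨h4, h5, h6⟩ hc₃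
        refine (Run.of_loopFree rfl ?_).mono (by simp) fun _ _ h => h
        have hrun : ∀ a, a ≠ 4 → (Prog.run O (.ite (.and (.natLe (ctr 20) (ctr 21))
            (.natLe (ctr 21) (ctr 20))) (.setNat 4 (ctr 20) (ctr 21) (.lit 1))
            (.setNat 4 (ctr 20) (ctr 21) (.lit 0))) s₂).nat a = s₂.nat a := by
          intro a ha
          rw [Prog.run]
          split_ifs <;> simp [ha]
        have hc₁' : s₃.nat 20 0 0 = i := by rw [hf₃.nat 20 rfl, hrun _ (by simp), hc₁]
        have hc₂' : s₃.nat 21 0 0 = l := by rw [hf₃.nat 21 rfl, hrun _ (by simp), hc₂]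
        have hind : ∀ k Q, s₃.nat 1 k Q = s₂.nat 1 k Q := fun k Q => by
          rw [hf₃.nat 1 rfl, hrun _ (by simp)]
        simp [hc₁', hc₂', hc₃, hind, hs₂.ind]
        refine ⟨fun j hj k hk => ?_, fun k hk => ?_, ?_⟩
        · rw [if_neg (by omega)]; exact h4 j hj k hk
        · rw [if_neg (by omega)]; exact h5 k hk
        · rw [h6]
          constructor
          · rintro ⟨⟨h7, h8⟩, h9⟩
            refine ⟨h7, fun Q hQ hM => ?_⟩
            rcases hQ.lt_or_eq with hQ | rfl
            · exact h8 Q hQ hM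
            · by_contra hM'
              simp [hM, hM'] at h9
          · rintro ⟨h7, h8⟩
            refine ⟨⟨h7, fun Q hQ => h8 Q hQ.le⟩, ?_⟩
            by_cases hM : Mem P i q
            · simp [hM, h8 q le_rfl hM]
            · simp [hM]
      · rintro s₃ - ⟨h4, h5, h6⟩
        refine ⟨h4, fun k hk => ?_⟩
        rcases Nat.lt_succ_iff_lt_or_eq.1 hk with hk | rfl
        · exact h5 k hk
        · rw [h6]
          refine and_congr_right fun _ => ⟨fun h Q hM => h Q hM.lt.2 hM, fun h Q _ => h Q⟩
      · simp
        omega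
    · exact le_of_eq (by ring)
    · rintro s'' - ⟨h2, h3⟩ j hj k hk
      rcases Nat.lt_succ_iff_lt_or_eq.1 hj with hj | rfl
      · exact h2 j hj k hk
      · exact h3 k hk
  · exact le_of_eq (by ring)
  · exact fun s' _ h => h

end Preparation

/-! ## The program: measures of the atoms and the network -/

section Masses

variable {Ω : Type*} {n m : ℕ} {F : Fin n → Set Ω} {P : Fin m → Finset (Fin n)} {Λ : ℝ}

open Classical in
/-- The number of sets in the `k`-th subcollection. -/
def rank (P : Fin m → Finset (Fin n)) (k : ℕ) : ℕ := ((Finset.range n).filter (Mem P k)).card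

theorem rank_le (k : ℕ) : rank P k ≤ n := by
  classical
  simpa [rank] using Finset.card_filter_le (Finset.range n) (Mem P k)

theorem Enumerates.exists_mem (hP : Enumerates F P) {k : ℕ} (hk : k < m) : ∃ Q, Mem P k Q := by
  obtain ⟨Q, hQ⟩ := (mem_P0.1 (hP.mem ⟨k, hk⟩)).1
  exact ⟨Q, ⟨k, hk⟩, Q, rfl, rfl, hQ⟩

theorem Enumerates.rank_pos (hP : Enumerates F P) {k : ℕ} (hk : k < m) : 0 < rank P k := by
  obtain ⟨Q, hQ⟩ := hP.exists_mem hk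
  exact Finset.card_pos.2 ⟨Q, by simp [hQ, hQ.lt.2]⟩

theorem Enumerates.rank_lt (hP : Enumerates F P) {j k : ℕ} (hj : j < m) (hk : k < m)
    (h : Below P j k) : rank P j < rank P k := by
  classical
  refine Finset.card_lt_card (Finset.ssubset_iff_subset_ne.2 ⟨?_, fun heq => h.1 ?_⟩)
  · exact Finset.monotone_filter_right _ fun Q _ => h.2 Q
  · have : P ⟨j, hj⟩ = P ⟨k, hk⟩ := by
      ext Q
      have h1 := Finset.ext_iff.1 heq Q
      simp only [Finset.mem_filter, Finset.mem_range, Q.2, true_and] at h1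
      rwa [← mem_val_iff (P := P), ← mem_val_iff (P := P)]
    exact congrArg Fin.val (hP.injective this)

variable [MeasurableSpace Ω] {μ : Measure Ω}

/-- The measure of the union of the collection. -/
def totalMeasure (μ : Measure Ω) (F : Fin n → Set Ω) : ℝ := (μ (⋃ Q, F Q)).toReal

theorem Enumerates.totalMeasure_eq (hP : Enumerates F P) (hF : ∀ Q, MeasurableSet (F Q))
    (hfin : ∀ Q, μ (F Q) < ∞) : totalMeasure μ F = ∑ k ∈ Finset.range m, mass μ F P k := by
  classical
  have h1 := hP.measure_biUnion hF hfin (μ := μ) Finset.univ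
  simp only [Finset.mem_univ, Set.iUnion_true, true_and] at h1
  rw [totalMeasure, h1]
  refine Finset.sum_congr rfl fun k hk => if_pos ?_
  obtain ⟨Q, hQ⟩ := hP.exists_mem (Finset.mem_range.1 hk)
  exact ⟨⟨Q, hQ.lt.2⟩, hQ⟩

open Classical in
-- Removing the union of the sets outside `P k` leaves the atoms of the subcollections of `P k`. All
-- of them other than `P k` itself have smaller rank, so the system is triangular.
theorem Enumerates.mass_eq (hP : Enumerates F P) (hF : ∀ Q, MeasurableSet (F Q))
    (hfin : ∀ Q, μ (F Q) < ∞) (k : Fin m) :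
    mass μ F P k = totalMeasure μ F - coMeasure μ F (P k) -
      ∑ j ∈ Finset.range m, if Below P j k then mass μ F P j else 0 := by
  have h2 : (mass μ F P k : ℝ) =
      ∑ j ∈ Finset.range m, if j = (k : ℕ) then mass μ F P j else 0 := by simp
  rw [hP.totalMeasure_eq hF hfin, coMeasure, hP.measure_biUnion hF hfin,
    ← Finset.sum_sub_distrib, ← Finset.sum_sub_distrib, h2]
  refine Finset.sum_congr rfl fun j hj => ?_
  by_cases hjk : j = k
  · have h3 : ¬ ∃ Q : Fin n, Q ∈ (P k)ᶜ ∧ Mem P j Q := by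
      rintro ⟨Q, h4, h5⟩
      rw [hjk, mem_val_iff] at h5
      exact Finset.mem_compl.1 h4 h5
    rw [if_pos hjk, if_neg h3, if_neg fun h => h.1 hjk]
    ring
  · by_cases h3 : ∃ Q : Fin n, Q ∈ (P k)ᶜ ∧ Mem P j Q
    · have h4 : ¬ Below P j k := by
        rintro ⟨-, h5⟩
        obtain ⟨Q, h6, h7⟩ := h3
        exact Finset.mem_compl.1 h6 (mem_val_iff.1 (h5 Q h7))
      rw [if_neg hjk, if_pos h3, if_neg h4]
      ring
    · have h4 : Below P j k := by
        refine ⟨hjk, fun Q h5 => by_contra fun h6 => h3 ⟨⟨Q, h5.lt.2⟩, ?_, h5⟩⟩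
        rw [Finset.mem_compl]
        exact fun h7 => h6 (mem_val_iff (k := k) (Q := ⟨Q, h5.lt.2⟩) |>.2 h7)
      rw [if_neg hjk, if_neg h3, if_pos h4]
      ring

/-- Ask for the measure of the union of the whole collection. -/
def askTotal : Prog := .callUnion 2 (.lit 0) (.lit 0) 3 (.lit 0)

variable {O : Oracles Ω n} {s : Store Ω}

theorem run_askTotal (hO : O.Correct μ F) (h : ∀ Q < n, s.nat 3 0 Q = 1) :
    Run O askTotal s (10 + O.EO₁) fun s' => s'.real 2 0 0 = totalMeasure μ F := by
  refine (Run.of_loopFree rfl ?_).mono (by simp [askTotal]) fun _ _ h => h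
  have : ofIndicator n (s.nat 3 0) = Finset.univ := by
    ext Q
    simp [ofIndicator, h Q Q.2]
  simp only [askTotal, Prog.run, NExp.eval, write_self_apply, and_self, if_true, this, hO.union]
  simp [totalMeasure]

/-- Solve for the measures of the atoms. -/
def solveMasses : Prog :=
  forLoop 20 0 (forLoop 21 1
    (.seq (.setReal 3 (.lit 0) (ctr 21)
        (.sub (.get 2 (.lit 0) (.lit 0)) (.get 1 (.lit 0) (ctr 21))))
      (forLoop 22 1
        (.ite (.natLe (.get 4 (ctr 22) (ctr 21)) (.lit 0))
          (.setReal 3 (.lit 0) (ctr 21)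
            (.sub (.get 3 (.lit 0) (ctr 21)) (.get 3 (.lit 0) (ctr 22))))
          .skip))))

/-- Sorting by rank is avoided: every round recomputes all masses in place, and after `c` rounds
those of rank at most `c` are correct. Ranks are at most `n`, so `n` rounds suffice, at a cost of
order `nm²`. -/
theorem run_solveMasses (hP : Enumerates F P) (hF : ∀ Q, MeasurableSet (F Q))
    (hfin : ∀ Q, μ (F Q) < ∞) (hs : HasInput F Λ P s) (htot : s.real 2 0 0 = totalMeasure μ F)
    (hco : ∀ k : Fin m, s.real 1 0 k = coMeasure μ F (P k))
    (hcmp : ∀ j < m, ∀ k < m, s.nat 4 j k = 0 ↔ Below P j k) :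
    Run O solveMasses s (n * (m * (117 * m + 130) + 30) + 13) fun s' =>
      ∀ k < m, s'.real 3 0 k = mass μ F P k := by
  classical
  refine (Run.forLoop (t := m * (117 * m + 130) + 13) (fun c s' =>
    ∀ k < m, rank P k ≤ c → s'.real 3 0 k = mass μ F P k) hs.n_eq rfl ?_ ?_ ?_).mono ?_ ?_
  · exact fun i s x h => h
  · intro k hk hr
    have := hP.rank_pos hk
    omega
  · rintro c - s₁ hf₁ h1 hc₁
    have hs₁ := hs.frame hf₁ rfl
    refine (Run.forLoop (t := 117 * m + 113) (fun l s₂ => ∀ k < m,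
      (rank P k ≤ c ∨ rank P k ≤ c + 1 ∧ k < l) → s₂.real 3 0 k = mass μ F P k)
      hs₁.m_eq rfl ?_ ?_ ?_).mono ?_ ?_
    · exact fun i s x h => h
    · intro k hk hr
      exact h1 k hk (by omega)
    · rintro l hl s₂ hf₂ h2 hc₂
      have hs₂ := hs₁.frame hf₂ rfl
      have htot₂ : s₂.real 2 0 0 = totalMeasure μ F := by rw [hf₂.real 2 rfl, hf₁.real 2 rfl, htot]
      have hco₂ : s₂.real 1 0 l = coMeasure μ F (P ⟨l, hl⟩) := by
        rw [hf₂.real 1 rfl, hf₁.real 1 rfl, ← hco]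
      refine (Run.seq_left rfl ((Run.forLoop (t := 100) (fun j s₃ =>
        (∀ k < m, k ≠ l → (rank P k ≤ c ∨ rank P k ≤ c + 1 ∧ k < l) →
          s₃.real 3 0 k = mass μ F P k) ∧
        (rank P l ≤ c + 1 → s₃.real 3 0 l = totalMeasure μ F - coMeasure μ F (P ⟨l, hl⟩) -
          ∑ i ∈ Finset.range j, if Below P i l then mass μ F P i else 0)) (N := m)
        ?_ rfl ?_ ?_ ?_).mono le_rfl (Ψ := fun s₃ => ∀ k < m,
          (rank P k ≤ c ∨ rank P k ≤ c + 1 ∧ k < l + 1) →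
            s₃.real 3 0 k = mass μ F P k) ?_)).mono ?_ fun _ _ h => h
      · exact hs₂.m_eq
      · exact fun i s x h => h
      · simp [hc₂, htot₂, hco₂]
        intro k hk hkl hr
        rw [if_neg hkl]
        exact h2 k hk hr
      · rintro j hj s₃ hf₃ ⟨h3, h4⟩ hc₃
        refine (Run.of_loopFree rfl ?_).mono (by simp) fun _ _ h => h
        have hc₂' : s₃.nat 21 0 0 = l := by rw [hf₃.nat 21 rfl]; exact hc₂
        have hcmp₃ : s₃.nat 4 j l = 0 ↔ Below P j l := by
          rw [hf₃.nat 4 rfl]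
          change s₂.nat 4 j l = 0 ↔ _
          rw [hf₂.nat 4 rfl, hf₁.nat 4 rfl, hcmp j hj l hl]
        by_cases hB : Below P j l
        · have h0 := hcmp₃.2 hB
          simp [hc₂', hc₃, h0, Finset.sum_range_succ, hB]
          refine ⟨fun k hk hkl hr => ?_, fun hr => ?_⟩
          · rw [if_neg hkl]
            exact h3 k hk hkl hr
          -- The subtracted mass has rank at most `c`, so it is already correct; it is not the entry
          -- being rebuilt, since `j ≠ l`.
          · have := hP.rank_lt hj hl hB
            rw [h4 hr, h3 j hj hB.1 (Or.inl (by omega))]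
            ring
        · have h0 : s₃.nat 4 j l ≠ 0 := fun h => hB (hcmp₃.1 h)
          simp [hc₂', hc₃, h0, Finset.sum_range_succ, hB]
          exact ⟨h3, h4⟩
      · rintro s₃ - ⟨h3, h4⟩ k hk hr
        by_cases hkl : k = l
        · subst hkl
          rw [h4 (by omega)]
          exact (hP.mass_eq hF hfin ⟨k, hl⟩).symm
        · exact h3 k hk hkl (by omega)
      · simp
        omega
    · exact le_of_eq (by ring)
    · intro s₂ _ h2 k hk hr
      exact h2 k hk (Or.inr ⟨hr, hk⟩)
  · exact le_of_eq (by ring)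
  · intro s' _ h k hk
    exact h k hk (rank_le k)

/-- Enter the number of vertices and the demand sides of the network. -/
def initDemands : Prog :=
  .seq (.setNat 9 (.lit 0) (.lit 0) (.add (.get 0 (.lit 0) (.lit 0)) (.get 0 (.lit 0) (.lit 1))))
    (forLoop 20 0
      (.seq (.setNat 5 (.lit 0) (ctr 20) (.lit 1))
        (.seq
          (forLoop 21 1
            (.ite (.natLe (.lit 1) (.get 1 (ctr 21) (ctr 20)))
              (.seq
                (.setReal 4 (.lit 0) (ctr 20)
                  (.add (.get 4 (.lit 0) (ctr 20)) (.get 3 (.lit 0) (ctr 21))))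
                (.setReal 5 (ctr 20) (.add (.get 0 (.lit 0) (.lit 0)) (ctr 21))
                  (.get 2 (.lit 0) (.lit 0))))
              .skip))
          (.setReal 4 (.lit 0) (ctr 20)
            (.div (.get 4 (.lit 0) (ctr 20)) (.get 0 (.lit 0) (.lit 0)))))))

/-- Demands come from adding masses of atoms, without further oracle calls. The total measure is
entered as the capacity of the arcs, in the role of `∞`. -/
theorem run_initDemands (hs : HasInput F Λ P s)
    (htot : s.real 2 0 0 = totalMeasure μ F) (hmass : ∀ k < m, s.real 3 0 k = mass μ F P k)
    (h4 : ∀ j, s.real 4 0 j = 0) (h5 : ∀ i j, s.real 5 i j = 0) (h5n : ∀ j, s.nat 5 0 j = 0) :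
    Run O initDemands s (n * (117 * m + 130) + 100) fun s' =>
      s'.nat 9 0 0 = n + m ∧ (∀ a, s'.nat 5 0 a = if a < n then 1 else 0) ∧
      (∀ a, s'.real 4 0 a = if a < n then demand μ F Λ P a else 0) ∧
      ∀ a b, s'.real 5 a b = initCap n (Mem P) (totalMeasure μ F) a b := by
  classical
  refine (Run.seq_left rfl ((Run.forLoop (t := 117 * m + 113) (fun i s₁ =>
      (∀ a, s₁.nat 5 0 a = if a < i then 1 else 0) ∧
      (∀ a, s₁.real 4 0 a = if a < i then demand μ F Λ P a else 0) ∧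
      ∀ a b, s₁.real 5 a b = if a < i ∧ n ≤ b ∧ Mem P (b - n) a then totalMeasure μ F else 0)
      (N := n) ?_ rfl ?_ ?_ ?_).mono le_rfl ?_)).mono ?_ fun _ _ h => h
  · exact hs.n_eq
  · exact fun i s x h => h
  · simp [h4, h5, h5n]
  · rintro i hi s₁ hf₁ ⟨h1, h2, h3⟩ hc₁
    have hs₁ : HasInput F Λ P s₁ := by
      refine HasInput.frame ?_ hf₁ ?_
      · exact ⟨hs.n_eq, hs.m_eq, hs.ind, hs.lam, hs.sets⟩
      · rfl
    have htot₁ : s₁.real 2 0 0 = totalMeasure μ F := by rw [hf₁.real 2 rfl]; exact htot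
    have hmass₁ : ∀ k < m, s₁.real 3 0 k = mass μ F P k := by rw [hf₁.real 3 rfl]; exact hmass
    refine (Run.seq_left rfl (Run.seq_right rfl ((Run.forLoop (t := 80) (fun k s₂ =>
      (∀ a, s₂.nat 5 0 a = if a ≤ i then 1 else 0) ∧
      (∀ a, a ≠ i → s₂.real 4 0 a = if a < i then demand μ F Λ P a else 0) ∧
      s₂.real 4 0 i = ∑ l ∈ Finset.range k, (if Mem P l i then mass μ F P l else 0) ∧
      (∀ a b, a ≠ i → s₂.real 5 a b =
        if a < i ∧ n ≤ b ∧ Mem P (b - n) a then totalMeasure μ F else 0) ∧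
      ∀ b, s₂.real 5 i b = if b < n + k ∧ n ≤ b ∧ Mem P (b - n) i then totalMeasure μ F else 0)
      (N := m) ?_ rfl ?_ ?_ ?_).mono le_rfl ?_))).mono ?_ fun _ _ h => h
    · exact hs₁.m_eq
    · exact fun i s x h => h
    · simp [hc₁, h2, h3, h1]
      refine ⟨fun a => ?_, fun b => ?_⟩
      · split_ifs <;> omega
      · exact fun h6 h7 => absurd h6 (not_lt.2 h7)
    · rintro k hk s₂ hf₂ ⟨h6, h7, h8, h9, h10⟩ hc₂
      refine (Run.of_loopFree rfl ?_).mono (by simp) fun _ _ h => h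
      have hc₁' : s₂.nat 20 0 0 = i := by rw [hf₂.nat 20 rfl]; exact hc₁
      have hind : s₂.nat 1 k i = s₁.nat 1 k i := by rw [hf₂.nat 1 rfl]; rfl
      have hn : s₂.nat 0 0 0 = n := by rw [hf₂.nat 0 rfl]; exact hs₁.n_eq
      have htot₂ : s₂.real 2 0 0 = totalMeasure μ F := by rw [hf₂.real 2 rfl]; exact htot₁
      have hmass₂ : s₂.real 3 0 k = mass μ F P k := by rw [hf₂.real 3 rfl]; exact hmass₁ k hk
      by_cases hM : Mem P k i
      · simp [hc₁', hc₂, hind, hs₁.ind_pos hM, hn, htot₂, hmass₂, h8, Finset.sum_range_succ, hM]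
        refine ⟨h6, fun a ha => ?_, fun a b ha => ?_, fun b => ?_⟩
        · rw [if_neg ha, h7 a ha]
        · rw [if_neg fun h => ha h.1, h9 a b ha]
        · by_cases hb : b = n + k
          · simp [hb, hM]
          · rw [if_neg hb, h10]
            have : b < n + k ↔ b < n + (k + 1) := by omega
            simp only [this]
      · simp [hc₁', hc₂, hind, hs₁.ind_neg hM, h8, Finset.sum_range_succ, hM]
        refine ⟨h6, h7, h9, fun b => ?_⟩
        rw [h10]
        by_cases hb : b = n + k
        · simp [hb, hM]
        · have : b < n + k ↔ b < n + (k + 1) := by omega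
          simp only [this]
    · rintro s₂ hf₂ ⟨h6, h7, h8, h9, h10⟩
      have hc₁' : s₂.nat 20 0 0 = i := by rw [hf₂.nat 20 rfl]; exact hc₁
      have hlam : s₂.real 0 0 0 = Λ := by rw [hf₂.real 0 rfl]; exact hs₁.lam
      simp [hc₁', hlam]
      refine ⟨h6, fun a => ?_, fun a b => ?_⟩
      · split_ifs with h11 h12 h12
        · rw [h8, h11, demand]
        · omega
        · rw [h7 a h11, if_pos (by omega)]
        · rw [h7 a h11, if_neg (by omega)]
      · by_cases ha : a = i
        · subst ha
          rw [h10]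
          congr 1
          rw [eq_iff_iff]
          refine ⟨fun h => ⟨le_rfl, h.2⟩, fun h => ⟨?_, h.2⟩⟩
          have := h.2.2.lt
          omega
        · rw [h9 a b ha]
          have : a < i ↔ a ≤ i := by omega
          simp only [this]
    · simp
      omega
  · rintro s₁ hf₁ ⟨h1, h2, h3⟩
    refine ⟨?_, h1, h2, fun a b => ?_⟩
    · rw [hf₁.nat 9 rfl]
      simp [hs.n_eq, hs.m_eq]
    · rw [h3, initCap]
  · simp
    nlinarith

/-- Enter the supplies of the network. -/
def initSupplies : Prog :=
  forLoop 20 1 (.setReal 4 (.lit 0) (.add (.get 0 (.lit 0) (.lit 0)) (ctr 20))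
    (.sub (.lit 0) (.get 3 (.lit 0) (ctr 20))))

theorem run_initSupplies (hs : HasInput F Λ P s) (hmass : ∀ k < m, s.real 3 0 k = mass μ F P k)
    (h4 : ∀ a, s.real 4 0 a = if a < n then demand μ F Λ P a else 0) :
    Run O initSupplies s (m * 50 + 13) fun s' =>
      ∀ a, s'.real 4 0 a = initExcess n (demand μ F Λ P) (mass μ F P) a := by
  refine (Run.forLoop (t := 33) (fun i s₁ => ∀ a, s₁.real 4 0 a =
    if a < n + i then initExcess n (demand μ F Λ P) (mass μ F P) a else 0)
    hs.m_eq rfl ?_ ?_ ?_).mono (by omega) ?_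
  · exact fun i s x h => h
  · intro a
    rw [h4, add_zero]
    split_ifs with h
    · rw [initExcess, if_pos h]
    · rfl
  · rintro i hi s₁ hf₁ h1 hc₁
    refine (Run.of_loopFree rfl ?_).mono (by simp) fun _ _ h => h
    have hs₁ := hs.frame hf₁ rfl
    have hmass₁ : s₁.real 3 0 i = mass μ F P i := by rw [hf₁.real 3 rfl, hmass i hi]
    simp [hc₁, hs₁.n_eq, hmass₁]
    intro a
    by_cases ha : a = n + i
    · simp [ha, initExcess]
    · rw [if_neg ha, h1]
      have : a < n + i ↔ a < n + (i + 1) := by omega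
      simp only [this]
  · intro s₁ _ h1 a
    rw [h1]
    split_ifs with h
    · rfl
    · have h2 : ¬ a < n := by omega
      have h3 : ¬ a - n < m := by omega
      simp [initExcess, h2, mass, h3]

end Masses

/-! ## The program: maximum flow -/

section MaxFlow

variable {Ω : Type*} {n N V : ℕ}

/-- Send the amount `x` from the vertex in `(7, 0, 0)` to the vertex in `(10, 0, 0)`. -/
def pushProg (x : RExp) : Prog :=
  .seq (.setReal 6 (.lit 0) (.lit 0) x)
  (.seq (.setReal 4 (.lit 0) (ctr 10) (.add (.get 4 (.lit 0) (ctr 10)) (.get 6 (.lit 0) (.lit 0))))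
  (.seq (.setReal 4 (.lit 0) (ctr 7) (.sub (.get 4 (.lit 0) (ctr 7)) (.get 6 (.lit 0) (.lit 0))))
  (.seq (.setReal 5 (ctr 10) (ctr 7) (.add (.get 5 (ctr 10) (ctr 7)) (.get 6 (.lit 0) (.lit 0))))
    (.setReal 5 (ctr 7) (ctr 10) (.sub (.get 5 (ctr 7) (ctr 10)) (.get 6 (.lit 0) (.lit 0)))))))

/-- Go on to the next vertex. -/
def nextVertex : Prog := .setNat 7 (.lit 0) (.lit 0) (.add (ctr 7) (.lit 1))

/-- Go on to the next arc. -/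
def nextArc : Prog := .setNat 6 (.lit 0) (ctr 7) (.add (.get 6 (.lit 0) (ctr 7)) (.lit 1))

/-- One step of the push-relabel method. -/
def pushBody : Prog :=
  .ite (.natLe (ctr 9) (ctr 7))
    (.seq (.setNat 7 (.lit 0) (.lit 0) (.lit 0)) (.setNat 8 (.lit 0) (.lit 0) (.lit 0)))
    (.ite (.realLe (.get 4 (.lit 0) (ctr 7)) (.lit 0)) nextVertex
      (.seq (.setNat 8 (.lit 0) (.lit 0) (.lit 1))
        (.ite (.natLe (ctr 9) (.get 6 (.lit 0) (ctr 7)))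
          (.seq (.setNat 5 (.lit 0) (ctr 7) (.add (.get 5 (.lit 0) (ctr 7)) (.lit 2)))
            (.seq (.setNat 6 (.lit 0) (ctr 7) (.lit 0)) nextVertex))
          (.seq (.setNat 10 (.lit 0) (.lit 0) (.get 6 (.lit 0) (ctr 7)))
            (.ite (.and (.not (.realLe (.get 5 (ctr 7) (ctr 10)) (.lit 0)))
                (.and
                  (.natLe (.get 5 (.lit 0) (ctr 7)) (.add (.get 5 (.lit 0) (ctr 10)) (.lit 1)))
                  (.natLe (.add (.get 5 (.lit 0) (ctr 10)) (.lit 1)) (.get 5 (.lit 0) (ctr 7)))))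
              (.ite (.realLe (.get 4 (.lit 0) (ctr 7)) (.get 5 (ctr 7) (ctr 10)))
                (.seq (pushProg (.get 4 (.lit 0) (ctr 7))) nextVertex)
                (.seq (pushProg (.get 5 (ctr 7) (ctr 10))) nextArc))
              nextArc)))))

/-- Run the push-relabel method. -/
def pushLoop : Prog :=
  .while (.not (.and (.natLe (ctr 9) (ctr 7)) (.natLe (ctr 8) (.lit 0)))) pushBody

/-- The memory holds the state `σ`. -/
structure Sim (V : ℕ) (σ : PushState) (s : Store Ω) : Prop where
  e : s.real 4 0 = σ.e
  r : s.real 5 = σ.r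
  h : s.nat 5 0 = σ.h
  cur : s.nat 6 0 = σ.cur
  u : s.nat 7 0 0 = σ.u
  flag : s.nat 8 0 0 = σ.flag
  V_eq : s.nat 9 0 0 = V

variable {σ : PushState} {s : Store Ω} {O : Oracles Ω N}

theorem run_pushProg (x : RExp) {a b : ℕ} {δ : ℝ} (ha : s.nat 7 0 0 = a) (hb : s.nat 10 0 0 = b)
    (hx : x.eval s = δ) :
    ((pushProg x).run O s).nat = s.nat ∧
    (((pushProg x).run O s).real 4 0 = fun y =>
      s.real 4 0 y + (if y = b then δ else 0) - (if y = a then δ else 0)) ∧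
    ((pushProg x).run O s).real 5 = fun y z =>
      s.real 5 y z + (if y = b ∧ z = a then δ else 0) - (if y = a ∧ z = b then δ else 0) := by
  refine ⟨rfl, ?_, ?_⟩
  · funext y
    simp only [pushProg, Prog.run, NExp.eval, RExp.eval, ha, hb, hx]
    simp only [write_self_apply, true_and, ne_eq, Nat.reduceEqDiff,
      not_false_eq_true, write_of_ne, and_self, if_true]
    by_cases h1 : y = a <;> by_cases h2 : y = b <;> by_cases h3 : a = b <;> simp_all
  · funext y z
    simp only [pushProg, Prog.run, NExp.eval, RExp.eval, ha, hb, hx]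
    simp only [write_self_apply, true_and, ne_eq, Nat.reduceEqDiff,
      not_false_eq_true, write_of_ne, and_self, if_true]
    by_cases h1 : y = a ∧ z = b
    · obtain ⟨rfl, rfl⟩ := h1
      by_cases h3 : y = z
      · subst h3; simp
      · simp [h3]
    · by_cases h2 : y = b ∧ z = a
      · obtain ⟨rfl, rfl⟩ := h2
        by_cases h3 : y = z
        · subst h3; simp at h1
        · simp [h3]
      · simp [h1, h2]

theorem write_row {α : Type*} {M : ℕ → ℕ → ℕ → α} {a i j : ℕ} {x : α} :
    write M a i j x a i = Function.update (M a i) j x := by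
  funext j'
  simp [write, Function.update_apply]

/-- One execution of the loop body is one step of the abstract method. The fields `K` and `L₀` have
no counterpart in memory. -/
theorem Sim.step (h : Sim V σ s) : Sim V (σ.step V) (pushBody.run O s) := by
  obtain ⟨e, r, lab, cur, u, flag, K, L₀⟩ := σ
  obtain ⟨he, hr, hh, hc, hu, hf, hV⟩ := h
  simp only at he hr hh hc hu hf
  -- The machine has no test for equality, so the program compares in both directions.
  have hlab : lab u ≤ lab (cur u) + 1 ∧ lab (cur u) + 1 ≤ lab u ↔ lab u = lab (cur u) + 1 := by
    omega
  by_cases h1 : V ≤ u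
  · constructor <;> simp [PushState.step, pushBody, h1, he, hr, hh, hc, hu, hV]
  by_cases h2 : e u ≤ 0
  · constructor <;> simp [PushState.step, pushBody, nextVertex, h1, h2, he, hr, hh, hc, hu, hf, hV]
  by_cases h3 : V ≤ cur u
  · constructor <;>
      simp [PushState.step, pushBody, nextVertex, h1, h2, h3, he, hr, hh, hc, hu, hV, write_row]
  by_cases h4 : 0 < r u (cur u) ∧ lab u = lab (cur u) + 1
  · obtain ⟨h4, h5⟩ := h4
    set s₁ : Store Ω := (Prog.seq (.setNat 8 (.lit 0) (.lit 0) (.lit 1))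
      (.setNat 10 (.lit 0) (.lit 0) (.get 6 (.lit 0) (ctr 7)))).run O s with hs₁
    have hu₁ : s₁.nat 7 0 0 = u := by simp [hs₁, hu]
    have hv₁ : s₁.nat 10 0 0 = cur u := by simp [hs₁, hu, hc]
    have he₁ : s₁.real 4 0 = e := by simp [hs₁, he]
    have hr₁ : s₁.real 5 = r := by simp [hs₁, hr]
    have hh₁ : s₁.nat 5 0 = lab := by simp [hs₁, hh]
    have hc₁ : s₁.nat 6 0 = cur := by simp [hs₁, hc]
    have hf₁ : s₁.nat 8 0 0 = 1 := by simp [hs₁]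
    have hV₁ : s₁.nat 9 0 0 = V := by simp [hs₁, hV]
    by_cases h6 : e u ≤ r u (cur u)
    · have hrun : pushBody.run O s =
          nextVertex.run O ((pushProg (.get 4 (.lit 0) (ctr 7))).run O s₁) := by
        simp [pushBody, h1, h2, h3, h4, hu, hV, he, hc, hr, hh, hs₁, h5, h6]
      obtain ⟨h7, h8, h9⟩ := run_pushProg (O := O) (s := s₁) (.get 4 (.lit 0) (ctr 7)) hu₁ hv₁
        (δ := e u) (by simp [hu₁, he₁])
      rw [hrun]
      constructor <;> simp only [PushState.step, h1, h2, h3, h4, ← h5, h6, if_true, if_false,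
        PushState.push, and_self, nextVertex, Prog.run, NExp.eval, h7, h8, h9, hu₁, he₁, hr₁]
      · simp [hh₁]
      · simp [hc₁]
      · simp
      · simp [hf₁]
      · simp [hV₁]
    · have hrun : pushBody.run O s =
          nextArc.run O ((pushProg (.get 5 (ctr 7) (ctr 10))).run O s₁) := by
        simp [pushBody, h1, h2, h3, h4, hu, hV, he, hc, hr, hh, hs₁, h5, h6]
      obtain ⟨h7, h8, h9⟩ := run_pushProg (O := O) (s := s₁) (.get 5 (ctr 7) (ctr 10)) hu₁ hv₁
        (δ := r u (cur u)) (by simp [hu₁, hv₁, hr₁])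
      rw [hrun]
      constructor <;> simp only [PushState.step, h1, h2, h3, h4, ← h5, h6, if_true, if_false,
        PushState.push, and_self, nextArc, Prog.run, NExp.eval, h7, h8, h9, hu₁, he₁, hr₁]
      · simp [hh₁]
      · rw [write_row, hc₁]
      · simp [hu₁]
      · simp [hf₁]
      · simp [hV₁]
  · have h4' : ¬ (0 < r u (cur u) ∧ lab u ≤ lab (cur u) + 1 ∧ lab (cur u) < lab u) := by
      rw [Nat.lt_iff_add_one_le, hlab]; exact h4
    constructor <;> simp [PushState.step, pushBody, nextArc, h1, h2, h3, h4, h4', he, hr, hh, hc, hu,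
      hV, write_row]

/-- The loop body contains no loop and takes bounded time, so the potential serves as the variant.
-/
theorem run_pushLoop {e₀ : ℕ → ℝ} {r₀ : ℕ → ℕ → ℝ} (hadm : PushState.Admissible n V e₀ r₀)
    (hs : Sim V (PushState.start n V e₀ r₀) s) :
    Run O pushLoop s
      ((PushState.start n V e₀ r₀).potential V (PushState.maxLabel n V) * 1020 + 20) fun s' =>
        ∃ σ, PushState.Inv n V e₀ r₀ σ ∧ σ.Done V ∧ Sim V σ s' := by
  have hbool : ∀ (σ : PushState) (s : Store Ω), Sim V σ s →
      ((BExp.not (.and (.natLe (ctr 9) (ctr 7)) (.natLe (ctr 8) (.lit 0)))).eval s ↔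
        ¬ σ.Done V) := by
    intro σ s h
    simp [PushState.Done, h.u, h.flag, h.V_eq]
  refine (Run.whileLoop (t := 1000) (fun k s' => ∃ σ, PushState.Inv n V e₀ r₀ σ ∧ Sim V σ s' ∧
    σ.potential V (PushState.maxLabel n V) = k) ?_ ⟨_, hadm.inv_start, hs, rfl⟩).mono ?_ ?_
  · rintro k s₁ ⟨σ, hσ, hs₁, rfl⟩ hb
    refine (Run.of_loopFree rfl ?_).mono
      (by simp [pushBody, pushProg, nextVertex, nextArc]) fun _ _ h => h
    have := hσ.step hadm ((hbool σ s₁ hs₁).1 hb)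
    exact ⟨_, this.2, _, this.1, hs₁.step, rfl⟩
  · simp only [BExp.time, NExp.time]
    omega
  · rintro s' - ⟨⟨k, σ, hσ, hs', -⟩, hb⟩
    rw [hbool σ s' hs', not_not] at hb
    exact ⟨σ, hσ, hb, hs'⟩

/-- Here `V ≤ 2 max n m` and `D ≤ 5 min n m`, so `V * D ≤ 10nm` and `V * (V * D)` is of the order of
`(n + m)nm`. The potential is at most `8 + 1 + 3 = 12` times `V * (V * D)`, and `12 · 20 = 240`. -/
theorem potential_bound {m : ℕ} (hn : 0 < n) (hm : 0 < m) {e₀ : ℕ → ℝ} {r₀ : ℕ → ℕ → ℝ} :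
    (PushState.start n (n + m) e₀ r₀).potential (n + m) (PushState.maxLabel n (n + m)) ≤
      240 * (n ^ 2 * m + n * m ^ 2) := by
  refine PushState.potential_start_le.trans ?_
  set D := PushState.maxLabel n (n + m) with hD
  have hD' : D = 2 * min n m + 3 := by simp [hD, PushState.maxLabel]
  have hD0 : 1 ≤ D := by omega
  obtain ⟨V, hV⟩ : ∃ V, V = n + m := ⟨_, rfl⟩
  have hV0 : 1 ≤ V := by omega
  have key : V * (V * D) ≤ 20 * (n ^ 2 * m + n * m ^ 2) := by
    rcases le_total n m with h | h
    · rw [min_eq_left h] at hD'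
      have h1 : V * D ≤ (2 * m) * (5 * n) := Nat.mul_le_mul (by omega) (by omega)
      calc V * (V * D) ≤ V * ((2 * m) * (5 * n)) := Nat.mul_le_mul_left _ h1
        _ = 10 * (n ^ 2 * m + n * m ^ 2) := by rw [hV]; ring
        _ ≤ _ := by omega
    · rw [min_eq_right h] at hD'
      have h1 : V * D ≤ (2 * n) * (5 * m) := Nat.mul_le_mul (by omega) (by omega)
      calc V * (V * D) ≤ V * ((2 * n) * (5 * m)) := Nat.mul_le_mul_left _ h1
        _ = 10 * (n ^ 2 * m + n * m ^ 2) := by rw [hV]; ring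
        _ ≤ _ := by omega
  rw [← hV]
  have h1 : 1 ≤ V * D := Nat.one_le_iff_ne_zero.2 (Nat.mul_ne_zero (by omega) (by omega))
  have h2 : (2 + 2 * (V * D)) * (V + 1) ≤ (4 * (V * D)) * (2 * V) :=
    Nat.mul_le_mul (by omega) (by omega)
  have h3 : V ≤ V * (V * D) := Nat.le_mul_of_pos_right _ (by omega)
  have h4 : V ≤ V * D := Nat.le_mul_of_pos_right _ (by omega)
  have h5 : V * (D * (V + 1) + V) ≤ V * (3 * (V * D)) := by
    refine Nat.mul_le_mul_left _ ?_
    have : D * (V + 1) ≤ D * (2 * V) := Nat.mul_le_mul_left _ (by omega)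
    have h6 : D * (2 * V) = 2 * (V * D) := by ring
    omega
  have h6 : (4 * (V * D)) * (2 * V) = 8 * (V * (V * D)) := by ring
  have h7 : V * (3 * (V * D)) = 3 * (V * (V * D)) := by ring
  omega

end MaxFlow

/-! ## The program: cutting the atoms -/

section CuttingProgram

variable {Ω : Type*} {n m : ℕ} {F : Fin n → Set Ω} {P : Fin m → Finset (Fin n)} {Λ : ℝ}

/-- The cutting loops. -/
def cutLoop : Prog :=
  forLoop 20 1
    (.seq
      (.seq (.setSet 4 (.lit 0) (.lit 0) (.get 2 (.lit 0) (ctr 20)))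
        (.setReal 7 (.lit 0) (.lit 0) (.get 3 (.lit 0) (ctr 20))))
      (forLoop 21 0
        (.ite (.natLe (.lit 1) (.get 1 (ctr 20) (ctr 21)))
          (.seq (.callSplit 5 (.lit 0) (.lit 0) (.get 4 (.lit 0) (.lit 0))
              (.div (.get 5 (.add (.get 0 (.lit 0) (.lit 0)) (ctr 20)) (ctr 21))
                (.get 7 (.lit 0) (.lit 0))))
            (.seq (.setSet 1 (.lit 0) (ctr 21)
                (.union (.get 1 (.lit 0) (ctr 21)) (.get 5 (.lit 0) (.lit 0))))
              (.seq (.setSet 4 (.lit 0) (.lit 0)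
                  (.diff (.get 4 (.lit 0) (.lit 0)) (.get 5 (.lit 0) (.lit 0))))
                (.setReal 7 (.lit 0) (.lit 0) (.sub (.get 7 (.lit 0) (.lit 0))
                  (.get 5 (.add (.get 0 (.lit 0) (.lit 0)) (ctr 20)) (ctr 21)))))))
          .skip)))

theorem drop_finRange {l i : ℕ} (hi : i < l) :
    (List.finRange l).drop i = ⟨i, hi⟩ :: (List.finRange l).drop (i + 1) := by
  rw [List.drop_eq_getElem_cons (by simpa using hi)]
  simp

variable [MeasurableSpace Ω] {μ : Measure Ω} {O : Oracles Ω n} {s : Store Ω}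

/-- The splitting oracle wants a fraction, and the measure of the uncut part cannot be queried. Real
array 7 therefore tracks it, by subtracting the flow values from the mass of the atom. -/
theorem run_cutLoop (hP : Enumerates F P) (hF : ∀ Q, MeasurableSet (F Q))
    (hfin : ∀ Q, μ (F Q) < ∞) (hO : O.Correct μ F) (hs : HasInput F Λ P s) {dem : ℕ → ℝ}
    {f : ℕ → ℕ → ℝ} (hf : IsTransport n m (Mem P) (mass μ F P) dem f)
    {g : Vertex F → Vertex F → ℝ≥0}
    (hg : ∀ (k : Fin m) (Q : Fin n), g (.coll ⟨P k, hP.mem k⟩) (.elt Q) = (f k Q).toNNReal)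
    (hr : ∀ k, ∀ Q < n, s.real 5 (n + k) Q = f k Q) (hmass : ∀ k < m, s.real 3 0 k = mass μ F P k)
    (hatom : ∀ k : Fin m, s.set 2 0 k = atom F (P k)) (h1 : ∀ Q, s.set 1 0 Q = ∅) :
    Run O cutLoop s (m * (n * (117 + O.EO₂) + 80) + 13) fun s' => IsCutOutput μ F g (output s') := by
  classical
  let A : Fin m → {A // A ∈ P0 F} := fun k => ⟨P k, hP.mem k⟩
  have hA : Function.Injective A := fun j k h => hP.injective (congrArg Subtype.val h)
  refine (Run.forLoop (t := n * (117 + O.EO₂) + 63) (fun i s₁ => ∃ R, CutReachable μ F g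
    ⟨((List.finRange m).drop i).map A, [], R, output s₁⟩) hs.m_eq rfl ?_ ?_ ?_).mono ?_ ?_
  · exact fun i s x h => h
  · refine ⟨∅, _, ⟨?_, ?_, rfl, ?_⟩, .refl⟩
    · exact (List.nodup_finRange m).map hA
    · rintro ⟨B, hB⟩
      obtain ⟨k, rfl⟩ := (hP.mem_iff B).1 hB
      exact List.mem_map.2 ⟨k, List.mem_finRange k, rfl⟩
    · funext Q
      exact h1 Q
  · rintro i hi s₁ hf₁ ⟨R, hR⟩ hc₁
    have hs₁ := hs.frame hf₁ rfl
    refine (Run.seq_left rfl ((Run.forLoop (t := 100 + O.EO₂) (fun q s₂ =>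
      CutReachable μ F g ⟨((List.finRange m).drop (i + 1)).map A,
        (((List.finRange n).drop q).filter (· ∈ P ⟨i, hi⟩)).map fun Q => (A ⟨i, hi⟩, Q),
        s₂.set 4 0 0, output s₂⟩ ∧ MeasurableSet (s₂.set 4 0 0) ∧
      s₂.real 7 0 0 = mass μ F P i - ∑ Q ∈ Finset.range q, f i Q ∧
      μ (s₂.set 4 0 0) = ENNReal.ofReal (s₂.real 7 0 0)) (N := n) ?_ rfl ?_ ?_ ?_).mono
        le_rfl ?_)).mono ?_ fun _ _ h => h
    · exact hs₁.n_eq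
    · exact fun i s x h => h
    · have hat : s₁.set 2 0 i = atom F (P ⟨i, hi⟩) := by rw [hf₁.set 2 rfl]; exact hatom ⟨i, hi⟩
      have hma : s₁.real 3 0 i = mass μ F P i := by rw [hf₁.real 3 rfl]; exact hmass i hi
      have hmv : mass μ F P i = (μ (atom F (P ⟨i, hi⟩))).toReal := mass_val (⟨i, hi⟩ : Fin m)
      refine ⟨?_, ?_, ?_, ?_⟩
      · obtain ⟨st, hst, hrun⟩ := hR
        refine ⟨st, hst, hrun.tail ?_⟩
        rw [drop_finRange hi, List.map_cons, List.drop_zero]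
        simp only [Prog.run, NExp.eval, SExp.eval, write_self_apply, hc₁, hat, and_self, if_true]
        exact CutStep.next (A ⟨i, hi⟩) _ R _ _ ((List.nodup_finRange n).filter _) (by simp [A])
      · simpa [hc₁, hat] using measurableSet_atom hF _
      · simp [hc₁, hma]
      · simp only [Prog.run, NExp.eval, SExp.eval, RExp.eval, write_self_apply, hc₁, hat, and_self,
          if_true, hma, hmv]
        rw [ENNReal.ofReal_toReal (measure_atom_ne_top hfin (hP.mem _))]
    · rintro q hq s₂ hf₂ ⟨h2, h3, h4, h5⟩ hc₂
      refine (Run.of_loopFree rfl ?_).mono (by simp; omega) fun _ _ h => h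
      have hc₁' : s₂.nat 20 0 0 = i := by rw [hf₂.nat 20 rfl]; exact hc₁
      have hind : s₂.nat 1 i q = s₁.nat 1 i q := by rw [hf₂.nat 1 rfl]; rfl
      have hn : s₂.nat 0 0 0 = n := by rw [hf₂.nat 0 rfl]; exact hs₁.n_eq
      have hr₂ : s₂.real 5 (n + i) q = f i q := by
        rw [hf₂.real 5 rfl]
        change s₁.real 5 (n + i) q = _
        rw [hf₁.real 5 rfl, hr i q hq]
      rw [drop_finRange hq] at h2
      by_cases hM : Mem P i q
      · have hM' : (⟨q, hq⟩ : Fin n) ∈ P ⟨i, hi⟩ :=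
          mem_val_iff (k := ⟨i, hi⟩) (Q := ⟨q, hq⟩) |>.1 hM
        rw [List.filter_cons_of_pos (by simpa using hM'), List.map_cons] at h2
        have hf0 := hf.nonneg i q
        -- The supply bound leaves at least `f i q` uncut, which makes the requested fraction at
        -- most 1.
        have hle : f i q ≤ s₂.real 7 0 0 := by
          have h6 := hf.supply i hi
          have h7 : ∑ Q ∈ Finset.range (q + 1), f i Q ≤ ∑ Q ∈ Finset.range n, f i Q :=
            Finset.sum_le_sum_of_subset_of_nonneg (Finset.range_subset_range.2 hq)
              fun Q _ _ => hf.nonneg i Q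
          rw [Finset.sum_range_succ] at h7
          rw [h4]
          linarith
        obtain ⟨h6, h7, h8⟩ := hO.split (s₂.set 4 0 0) (f i q / s₂.real 7 0 0) h3
          (div_nonneg hf0 (hf0.trans hle)) (div_le_one_of_le₀ hle (hf0.trans hle))
        set G := O.split (s₂.set 4 0 0) (f i q / s₂.real 7 0 0) with hG
        have h9 : μ G = ENNReal.ofReal (f i q) := by
          -- If nothing is left, the quotient is 0 by convention; this is correct since `f i q` is
          -- then 0 as well.
          rw [h8, h5, ← ENNReal.ofReal_mul (div_nonneg hf0 (hf0.trans hle)),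
            div_mul_cancel_of_imp fun h0 => le_antisymm (hle.trans h0.le) hf0]
        have hstep := CutStep.take (μ := μ) (f := g) (A ⟨i, hi⟩) ⟨q, hq⟩
          (((List.finRange m).drop (i + 1)).map A)
          ((((List.finRange n).drop (q + 1)).filter (· ∈ P ⟨i, hi⟩)).map fun Q => (A ⟨i, hi⟩, Q))
          (s₂.set 4 0 0) (output s₂) G h6 h7 (by rw [h9, hg]; rfl)
        obtain ⟨st, hst, hrun⟩ := h2
        have hrun' : CutReachable μ F g _ := ⟨st, hst, hrun.tail hstep⟩
        simp [hc₁', hc₂, hind, hs₁.ind_pos hM, hn, hr₂, ← hG, -List.map_drop]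
        refine ⟨?_, h3.diff h6, ?_, ?_⟩
        · convert hrun' using 2
          funext Q
          simp only [output, Function.update_apply]
          by_cases hQ : Q = ⟨q, hq⟩
          · subst hQ; simp
          · have : (Q : ℕ) ≠ q := fun h => hQ (Fin.ext h)
            simp [hQ, this]
        · rw [Finset.sum_range_succ, h4]
          ring
        · rw [measure_sdiff h7 h6.nullMeasurableSet (by rw [h9]; exact ENNReal.ofReal_ne_top), h5,
            h9, ENNReal.ofReal_sub _ hf0]
      · have hM' : (⟨q, hq⟩ : Fin n) ∉ P ⟨i, hi⟩ := fun h =>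
          hM (mem_val_iff (k := ⟨i, hi⟩) (Q := ⟨q, hq⟩) |>.2 h)
        rw [List.filter_cons_of_neg (by simpa using hM')] at h2
        simp [hc₁', hc₂, hind, hs₁.ind_neg hM, -List.map_drop]
        refine ⟨h2, h3, ?_, h5⟩
        rw [Finset.sum_range_succ, hf.eq_zero i q hM, add_zero, h4]
    · rintro s₂ - ⟨h2, -⟩
      rw [List.drop_of_length_le (l := List.finRange n) (by simp)] at h2
      exact ⟨_, h2⟩
    · simp
      nlinarith
  · exact le_of_eq (by ring)
  · rintro s' - ⟨R, hR⟩
    rw [List.drop_of_length_le (by simp)] at hR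
    exact ⟨_, hR, ⟨rfl, rfl⟩, rfl⟩

/-- The whole program. -/
def mainProg : Prog :=
  .seq initUnion <| .seq askTotal <| .seq formAtoms <| .seq compareAll <| .seq solveMasses <|
    .seq initDemands <| .seq initSupplies <| .seq pushLoop cutLoop

/-- The constant is dominated by the push-relabel loop: `240 · 1020 = 244800`. The inequalities `m₁`
to `m₅` absorb the terms of lower order, using `n, m ≥ 1`. -/
theorem run_mainProg (hn : 0 < n) (hm : 0 < m) (hP : Enumerates F P)
    (hF : ∀ Q, MeasurableSet (F Q)) (hfin : ∀ Q, μ (F Q) < ∞) (hΛ : IsCarleson μ F Λ)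
    (hO : O.Correct μ F) :
    Run O mainProg (input F Λ P)
      (300000 * (m * O.EO₁ + n * m * O.EO₂ + n ^ 2 * m + n * m ^ 2)) fun s =>
        ∃ f, (network μ F Λ).IsMaxFlow f ∧ IsCutOutput μ F f (output s) := by
  have hhall := hP.hallData hF hfin hΛ
  have hadm := hhall.admissible (hP.totalMeasure_eq hF hfin)
  set s₀ := input F Λ P with hs₀
  have i₀ : HasInput F Λ P s₀ := hasInput_input
  have zn : ∀ a i j, 1 < a → s₀.nat a i j = 0 := by
    intro a i j ha
    have h0 : a ≠ 0 := by omega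
    have h1 : a ≠ 1 := by omega
    simp [hs₀, input, h0, h1]
  have zr : ∀ a i j, 0 < a → s₀.real a i j = 0 := by
    intro a i j ha
    simp [hs₀, input, ha.ne']
  have zs : ∀ a i j, 0 < a → s₀.set a i j = ∅ := by
    intro a i j ha
    simp [hs₀, input, ha.ne']
  have hpot := potential_bound hn hm (e₀ := initExcess n (demand μ F Λ P) (mass μ F P))
    (r₀ := initCap n (Mem P) (totalMeasure μ F))
  obtain ⟨s₁, T₁, e₁, b₁, u₁, U₁⟩ := run_initUnion i₀ (zs 3 0 0 (by simp)) (O := O)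
  have f₁ := e₁.frame
  have i₁ := i₀.frame f₁ rfl
  obtain ⟨s₂, T₂, e₂, b₂, tot₂⟩ := run_askTotal hO u₁
  have f₂ := e₂.frame
  have i₂ := i₁.frame f₂ rfl
  obtain ⟨s₃, T₃, e₃, b₃, co₃, at₃⟩ := run_formAtoms hP hO i₂ (by rw [f₂.set 3 rfl, U₁])
  have f₃ := e₃.frame
  have i₃ := i₂.frame f₃ rfl
  obtain ⟨s₄, T₄, e₄, b₄, cmp₄⟩ := run_compareAll i₃ (O := O)
  have f₄ := e₄.frame
  have i₄ := i₃.frame f₄ rfl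
  have tot₄ : s₄.real 2 0 0 = totalMeasure μ F := by rw [f₄.real 2 rfl, f₃.real 2 rfl, tot₂]
  obtain ⟨s₅, T₅, e₅, b₅, mass₅⟩ := run_solveMasses hP hF hfin i₄ tot₄
    (fun k => by rw [f₄.real 1 rfl, co₃ k]) cmp₄ (O := O)
  have f₅ := e₅.frame
  have i₅ := i₄.frame f₅ rfl
  obtain ⟨s₆, T₆, e₆, b₆, V₆, h₆, d₆, r₆⟩ := run_initDemands i₅
    (by rw [f₅.real 2 rfl, tot₄]) mass₅
    (fun j => by
      rw [f₅.real 4 rfl, f₄.real 4 rfl, f₃.real 4 rfl, f₂.real 4 rfl, f₁.real 4 rfl]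
      exact zr 4 0 j (by simp))
    (fun i j => by
      rw [f₅.real 5 rfl, f₄.real 5 rfl, f₃.real 5 rfl, f₂.real 5 rfl, f₁.real 5 rfl]
      exact zr 5 i j (by simp))
    (fun j => by
      rw [f₅.nat 5 rfl, f₄.nat 5 rfl, f₃.nat 5 rfl, f₂.nat 5 rfl, f₁.nat 5 rfl]
      exact zn 5 0 j (by simp)) (O := O)
  have f₆ := e₆.frame
  have i₆ := i₅.frame f₆ rfl
  have mass₆ : ∀ k < m, s₆.real 3 0 k = mass μ F P k := by rwa [f₆.real 3 rfl]
  obtain ⟨s₇, T₇, e₇, b₇, x₇⟩ := run_initSupplies i₆ mass₆ d₆ (O := O)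
  have f₇ := e₇.frame
  have i₇ := i₆.frame f₇ rfl
  -- Current arcs, visited vertex and flag are still zero from the input, as `PushState.start`
  -- requires.
  have zero₇ : ∀ a, a = 6 ∨ a = 7 ∨ a = 8 → s₇.nat a = fun _ _ => 0 := by
    rintro a (rfl | rfl | rfl) <;>
    · rw [f₇.nat _ rfl, f₆.nat _ rfl, f₅.nat _ rfl, f₄.nat _ rfl, f₃.nat _ rfl, f₂.nat _ rfl,
        f₁.nat _ rfl]
      exact funext fun i => funext fun j => zn _ i j (by simp)
  obtain ⟨s₈, T₈, e₈, b₈, σ, hσ, hdone, sim⟩ := run_pushLoop (O := O) (s := s₇) hadm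
    { e := funext x₇
      r := funext fun a => funext fun b => by rw [f₇.real 5 rfl]; exact r₆ a b
      h := funext fun a => by rw [f₇.nat 5 rfl]; exact h₆ a
      cur := by rw [zero₇ 6 (by simp)]; rfl
      u := by rw [zero₇ 7 (by simp)]; rfl
      flag := by rw [zero₇ 8 (by simp)]; rfl
      V_eq := by rw [f₇.nat 9 rfl, V₆] }
  have f₈ := e₈.frame
  have i₈ := i₇.frame f₈ rfl
  have htr := hhall.isTransport hσ hdone
  obtain ⟨g, hsat, hg⟩ := hP.exists_isSaturating hF hfin hΛ.1 htr
  obtain ⟨s₉, T₉, e₉, b₉, out⟩ := run_cutLoop hP hF hfin hO i₈ htr hg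
    (fun k Q hQ => by rw [sim.r, if_pos hQ])
    (fun k hk => by rw [f₈.real 3 rfl, f₇.real 3 rfl]; exact mass₆ k hk)
    (fun k => by
      rw [f₈.set 2 rfl, f₇.set 2 rfl, f₆.set 2 rfl, f₅.set 2 rfl, f₄.set 2 rfl]
      exact at₃ k)
    (fun Q => by
      rw [f₈.set 1 rfl, f₇.set 1 rfl, f₆.set 1 rfl, f₅.set 1 rfl, f₄.set 1 rfl, f₃.set 1 rfl,
        f₂.set 1 rfl, f₁.set 1 rfl]
      exact zs 1 0 Q (by simp))
  refine ⟨s₉, _, e₁.seq (e₂.seq (e₃.seq (e₄.seq (e₅.seq (e₆.seq (e₇.seq (e₈.seq e₉))))))), ?_,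
    g, hsat.isMaxFlow, out⟩
  have m₁ : O.EO₁ ≤ m * O.EO₁ := Nat.le_mul_of_pos_left _ hm
  have m₂ : n * m ≤ n ^ 2 * m := Nat.mul_le_mul_right _ (Nat.le_self_pow two_ne_zero n)
  have m₃ : n ≤ n * m := Nat.le_mul_of_pos_right _ hm
  have m₄ : m ≤ n * m := Nat.le_mul_of_pos_left _ hn
  have m₅ : m ^ 2 ≤ n * m ^ 2 := Nat.le_mul_of_pos_left _ hn
  clear_value s₀
  generalize PushState.potential _ _ _ = pot at hpot b₈
  ring_nf at *
  omega

end CuttingProgram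

end CarlesonSparse

end

/-! ### Assembly of the theorem. -/

theorem CarlesonSparse.Enumerates.pos {Ω : Type*} [MeasurableSpace Ω] {μ : Measure Ω} {n m : ℕ}
    {F : Fin n → Set Ω} {P : Fin m → Finset (Fin n)} (hP : Enumerates F P) (hn : 0 < n)
    (hpos : ∀ Q, 0 < μ (F Q)) : 0 < m := by
  classical
  -- A set of positive measure contains a point, and the atom of this point is listed.
  obtain ⟨x, hx⟩ := nonempty_of_measure_ne_zero (hpos ⟨0, hn⟩).ne'
  obtain ⟨k, -⟩ := (hP.mem_iff {Q | x ∈ F Q}).1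
    (mem_P0.2 ⟨⟨⟨0, hn⟩, by simpa using hx⟩, x, mem_atom_iff.2 fun Q => by simp⟩)
  exact k.pos

theorem theorem3p9 :
    ∃ (prog : CarlesonSparse.Prog) (C : ℕ),
      ∀ (Ω : Type*) [MeasurableSpace Ω] (μ : Measure Ω) (_ : CarlesonSparse.NonAtomic μ)
        (n : ℕ) (_ : 0 < n) (F : Fin n → Set Ω)
        (_ : ∀ Q, MeasurableSet (F Q)) (_ : ∀ Q, 0 < μ (F Q)) (_ : ∀ Q, μ (F Q) < ∞)
        (Λ : ℝ) (_ : CarlesonSparse.IsCarleson μ F Λ),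
        (∃ f, (CarlesonSparse.network μ F Λ).IsMaxFlow f) ∧
        (∀ f, (CarlesonSparse.network μ F Λ).IsMaxFlow f →
          ∀ st, CarlesonSparse.CutReachable μ F f st →
            (¬ st.IsFinal → ∃ st', CarlesonSparse.CutStep μ F f st st') ∧
            (st.IsFinal → CarlesonSparse.IsSparseWitness μ F Λ⁻¹ st.E)) ∧
        CarlesonSparse.IsSparse μ F Λ⁻¹ ∧
        ∀ (m : ℕ) (P : Fin m → Finset (Fin n)) (_ : Function.Injective P)
          (_ : ∀ A, A ∈ CarlesonSparse.P0 F ↔ ∃ k, P k = A)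
          (O : CarlesonSparse.Oracles Ω n) (_ : O.Correct μ F),
          ∃ (s : CarlesonSparse.Store Ω) (T : ℕ),
            CarlesonSparse.Exec O prog (CarlesonSparse.input F Λ P) s T ∧
            T ≤ C * (m * O.EO₁ + n * m * O.EO₂ + n ^ 2 * m + n * m ^ 2) ∧
            ∃ f, (CarlesonSparse.network μ F Λ).IsMaxFlow f ∧
              CarlesonSparse.IsCutOutput μ F f (CarlesonSparse.output s) := by
  refine ⟨CarlesonSparse.mainProg, 300000, ?_⟩
  intro Ω _ μ hμ n hn F hF hpos hfin Λ hΛ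
  obtain ⟨g, hg⟩ := CarlesonSparse.exists_isSaturating hF hfin hΛ
  refine ⟨⟨g, hg.isMaxFlow⟩, fun f hf st hst => ?_, ⟨?_, ?_, ?_⟩, fun m P hinj hmem O hO => ?_⟩
  · have hinv := CarlesonSparse.CutInv.of_reachable hF (hg.of_isMaxFlow hf) hst
    exact ⟨hinv.exists_step hμ hfin, hinv.isSparseWitness⟩
  · exact inv_pos.2 (zero_lt_one.trans_le hΛ.1)
  · exact inv_le_one_of_one_le₀ hΛ.1
  · obtain ⟨st, hst, hfinal⟩ := CarlesonSparse.exists_final hμ hF hfin hg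
    exact ⟨st.E, (CarlesonSparse.CutInv.of_reachable hF hg hst).isSparseWitness hfinal⟩
  · have hP : CarlesonSparse.Enumerates F P := ⟨hinj, hmem⟩
    exact CarlesonSparse.run_mainProg hn (hP.pos hn hpos) hP hF hfin hΛ hO
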